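/- **Networks.** Let $d,s\ge 2$ and let $n_0<n_1<\dots<n_{d-1}<n_d=\ell$ and $p_0<p_1<\dots<p_{s-1}<p_s=\ell$ be integers; write $n=n_0$, $p=p_0$. Let $\mathcal G^{(1)}(h)=\mathrm{relu}(W^{(1)}_d\cdots\mathrm{relu}(W^{(1)}_1h)\cdots)$, $\mathcal G^{(1)}:\mathbb R^n\to\mathbb R^\ell$, with $W^{(1)}_i\in\mathbb R^{n_i\times n_{i-1}}$, and $\mathcal G^{(2)}(m)=\mathrm{relu}(W^{(2)}_s\cdots\mathrm{relu}(W^{(2)}_1m)\cdots)$, $\mathcal G^{(2)}:\mathbb R^p\to\mathbb R^\ell$, with $W^{(2)}_i\in\mathbb R^{p_i\times p_{i-1}}$, where $\mathrm{relu}(x)=\max(x,0)$ entrywise. For $h_0\in\mathbb R^n$, $m_0\in\mathbb R^p$ let $$f(h,m)=\tfrac12\big\|\mathcal G^{(1)}(h_0)\odot\mathcal G^{(2)}(m_0)-\mathcal G^{(1)}(h)\odot\mathcal G^{(2)}(m)\big\|_2^2 ,\qquad (h,m)\in\mathbb R^n\times\mathbb R^p .$$ **Random weights.** For $i\le d-1$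 the entries of $W^{(1)}_i$ are i.i.d. $\mathcal N(0,1/n_i)$; for $i\le s-1$ the entries of $W^{(2)}_i$ are i.i.d. $\mathcal N(0,1/p_i)$. The rows of $W^{(1)}_d$ are $w_j\mathbf 1_{\{\|w_j\|_2\le 3\sqrt{n_{d-1}/\ell}\}}$ with $w_1,\dots,w_\ell$ i.i.d. $\mathcal N(0,\frac1\ell I_{n_{d-1}})$; the rows of $W^{(2)}_s$ are $u_j\mathbf 1_{\{\|u_j\|_2\le 3\sqrt{p_{s-1}/\ell}\}}$ with $u_1,\dots,u_\ell$ i.i.d. $\mathcal N(0,\frac1\ell I_{p_{s-1}})$; and $(w_j)_j$, $(u_j)_j$ are independent of each other. **Directions and derivatives.** Let $D_vf(z)=\lim_{t\to0^+}\frac{f(z+tv)-f(z)}t$. Call $w\in\mathbb R^n\times\mathbb R^p$ admissible at $z$ if $f$ is differentiable at $z+\delta w$ for all sufficiently small $\delta>0$; for such $w$ let $$g_1=\Big(\lim_{\delta\to0^+}\nabla_hf(z+\delta w),\,0\Big),\qquad g_2=\Big(0,\,\lim_{\delta\to0^+}\nabla_mf(z+\delta w)\Big).$$ **Sets and constants.**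 For $r\in\mathbb R$ and $(\tilde h,\tilde m)\in\mathbb R^n\times\mathbb R^p$ let $$\mathcal A_{r,(\tilde h,\tilde m)}=\Big\{(h,m):\exists\,c>0,\ \big\|(h,m)-(c\tilde h,\tfrac1c\tilde m)\big\|_2\le r\,\big\|(c\tilde h,\tfrac1c\tilde m)\big\|_2\Big\},$$ and $\mathcal K=\{(h,0)\}\cup\{(0,m)\}$. Let $\check\theta_0=\pi$, $\check\theta_{i}=\arccos\frac{(\pi-\check\theta_{i-1})\cos\check\theta_{i-1}+\sin\check\theta_{i-1}}{\pi}$, and $\rho_a=\sum_{i=1}^{a-1}\frac{\sin\check\theta_i}{\pi}\prod_{j=i+1}^{a-1}\frac{\pi-\check\theta_j}{\pi}$. **Theorem.** One has $\rho_a>0$ for $a\ge2$ and $\rho_a\to1$ as $a\to\infty$. There are absolute constants $\tilde c,K_1,K_2>0$, and for each $\epsilon>0$ constants $c,\gamma>0$ depending only on $\epsilon$, with $c$ and $\gamma^{-1}$ bounded by $C\epsilon^{-k}$ for an absolute $C>0$ and an absolute $k\in\mathbb N$, such that the following holds. Suppose $d,s\ge2$ and $K_1(d^7s^2+d^2s^7)\epsilon^{1/4}<1$,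 the networks are as above with $$n_i\ge c\,n_{i-1}\log n_{i-1}\ (1\le i\le d-1),\qquad p_i\ge c\,p_{i-1}\log p_{i-1}\ (1\le i\le s-1),$$ $$\ell\ge c\big((n_{d-1}\log n_{d-1})^2+(p_{s-1}\log p_{s-1})^2\big).$$ Then on an event of probability at least $$1-\sum_{i=1}^d\tilde c\,n_ie^{-\gamma n_{i-1}}-\sum_{i=1}^s\tilde c\,p_ie^{-\gamma p_{i-1}}-c\,e^{-\gamma\ell}$$ the following holds for all $(h_0,m_0)\ne(0,0)$. 1. Some $w$ is admissible at every point. For every $$(h,m)\notin\mathcal K\cup\mathcal A_{K_2d^3s^3\epsilon^{1/4},(h_0,m_0)}\cup\mathcal A_{K_2d^8s^3\epsilon^{1/4},(-\rho_dh_0,m_0)}\cup\mathcal A_{K_2d^3s^8\epsilon^{1/4},(\rho_sh_0,-m_0)}\cup\mathcal A_{K_2d^8s^8\epsilon^{1/4},(-\rho_d\rho_sh_0,-m_0)}$$ and every $w$ admissible at $(h,m)$, the limits defining $g_1,g_2$ exist, and $D_{-g_1}f(h,m)$ exists and is $<0$, or $D_{-g_2}f(h,m)$ exists and is $<0$. 2.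 For every $(h,m)\in\mathcal K$ and every $(x,y)\in\mathbb R^n\times\mathbb R^p$, $D_{(x,y)}f(h,m)$ exists and is $\le0$. If moreover $h_0\ne0$ and $m_0\ne0$, then every point of $\mathcal K$ is a local maximizer of $f$. -/

import Mathlib

open MeasureTheory ProbabilityTheory Filter Topology
open scoped NNReal

noncomputable section

namespace BlindDemodulation

/-- `ℝᵏ` with its Euclidean norm. -/
abbrev Vec (k : ℕ) : Type := EuclideanSpace ℝ (Fin k)

/-! ### ReLU networks without bias -/

/-- The entrywise map `x ↦ max(x, 0)`. -/
def relu {k : ℕ} (x : Vec k) : Vec k := WithLp.toLp 2 fun i => max (x i) 0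

/-- One layer `x ↦ relu(W x)`. -/
def layer {a b : ℕ} (W : Matrix (Fin a) (Fin b) ℝ) (x : Vec b) : Vec a :=
  relu (WithLp.toLp 2 (W.mulVec x.ofLp))

/-- The first `k` layers `relu(W_k ⋯ relu(W_1 x)⋯)`; the matrix `W i` is the weight matrix of layer
`i + 1`, of size `n (i+1) × n i`. -/
def innerNet (n : ℕ → ℕ) (W : (i : ℕ) → Matrix (Fin (n (i + 1))) (Fin (n i)) ℝ) :
    (k : ℕ) → Vec (n 0) → Vec (n k)
  | 0, x => x
  | k + 1, x => layer (W k) (innerNet n W k x)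

/-- The network with `d` layers: `d - 1` inner layers of widths `n 0, …, n (d-1)`, followed by a
last layer with weight matrix `L` and output dimension `ℓ`. -/
def net (n : ℕ → ℕ) (d ℓ : ℕ) (W : (i : ℕ) → Matrix (Fin (n (i + 1))) (Fin (n i)) ℝ)
    (L : Matrix (Fin ℓ) (Fin (n (d - 1))) ℝ) (x : Vec (n 0)) : Vec ℓ :=
  layer L (innerNet n W (d - 1) x)

/-! ### The empirical risk and its one-sided derivatives -/

/-- The empirical risk `½ ‖G₁(h₀) ⊙ G₂(m₀) - G₁(h) ⊙ G₂(m)‖²` at `z = (h, m)`. -/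
def risk {a b ℓ : ℕ} (G₁ : Vec a → Vec ℓ) (G₂ : Vec b → Vec ℓ) (h₀ : Vec a) (m₀ : Vec b)
    (z : Vec a × Vec b) : ℝ :=
  (1 / 2) * ‖(WithLp.toLp 2 fun j => G₁ h₀ j * G₂ m₀ j - G₁ z.1 j * G₂ z.2 j : Vec ℓ)‖ ^ 2

/-- The (unnormalized) one-sided directional derivative of `f` at `z` in the direction `v` exists
and equals `D`. -/
def HasOneSidedDeriv {a b : ℕ} (f : Vec a × Vec b → ℝ) (z v : Vec a × Vec b) (D : ℝ) : Prop :=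
  Tendsto (fun t : ℝ => (f (z + t • v) - f z) / t) (𝓝[>] 0) (𝓝 D)

/-- `f` is differentiable at `z + δ w` for all sufficiently small `δ > 0`. -/
def DifferentiableAlong {a b : ℕ} (f : Vec a × Vec b → ℝ) (z w : Vec a × Vec b) : Prop :=
  ∀ᶠ δ : ℝ in 𝓝[>] 0, DifferentiableAt ℝ f (z + δ • w)

/-- The partial gradient of `f` with respect to the first variable. -/
def grad₁ {a b : ℕ} (f : Vec a × Vec b → ℝ) (z : Vec a × Vec b) : Vec a :=
  gradient (fun h => f (h, z.2)) z.1

/-- The partial gradient of `f` with respect to the second variable. -/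
def grad₂ {a b : ℕ} (f : Vec a × Vec b → ℝ) (z : Vec a × Vec b) : Vec b :=
  gradient (fun m => f (z.1, m)) z.2

/-- `v` is the one-sided limit of `∇_h f(z + δ w)` as `δ → 0⁺`. -/
def IsOneSidedGrad₁ {a b : ℕ} (f : Vec a × Vec b → ℝ) (z w : Vec a × Vec b) (v : Vec a) : Prop :=
  Tendsto (fun δ : ℝ => grad₁ f (z + δ • w)) (𝓝[>] 0) (𝓝 v)

/-- `v` is the one-sided limit of `∇_m f(z + δ w)` as `δ → 0⁺`. -/
def IsOneSidedGrad₂ {a b : ℕ} (f : Vec a × Vec b → ℝ) (z w : Vec a × Vec b) (v : Vec b) : Prop :=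
  Tendsto (fun δ : ℝ => grad₂ f (z + δ • w)) (𝓝[>] 0) (𝓝 v)

/-! ### The axes, the hyperbolic neighborhoods, and the constants `ρ` -/

/-- The set `{(h, 0)} ∪ {(0, m)}`. -/
def axes (a b : ℕ) : Set (Vec a × Vec b) := {z | z.2 = 0} ∪ {z | z.1 = 0}

/-- The set of `(h, m)` for which there is `c > 0` with
`‖(h, m) - (c h', c⁻¹ m')‖₂ ≤ r ‖(c h', c⁻¹ m')‖₂`. -/
def hyperbolicNhd {a b : ℕ} (r : ℝ) (h' : Vec a) (m' : Vec b) : Set (Vec a × Vec b) :=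
  {z | ∃ c : ℝ, 0 < c ∧
    ‖WithLp.toLp 2 (z.1 - c • h', z.2 - c⁻¹ • m')‖ ≤ r * ‖WithLp.toLp 2 (c • h', c⁻¹ • m')‖}

/-- The angle map `θ ↦ arccos(((π - θ) cos θ + sin θ) / π)`. -/
def angleMap (θ : ℝ) : ℝ :=
  Real.arccos (((Real.pi - θ) * Real.cos θ + Real.sin θ) / Real.pi)

/-- The iterates of the angle map started at `π`. -/
def angleIter (i : ℕ) : ℝ := angleMap^[i] Real.pi

/-- `ρ_a = ∑_{i=1}^{a-1} (sin θ_i / π) ∏_{j=i+1}^{a-1} (π - θ_j) / π`. -/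
def rho (a : ℕ) : ℝ :=
  ∑ i ∈ Finset.Ico 1 a, Real.sin (angleIter i) / Real.pi *
    ∏ j ∈ Finset.Ico (i + 1) a, (Real.pi - angleIter j) / Real.pi

/-- The union of the four hyperbolic neighborhoods. -/
def fourNhds {a b : ℕ} (K₂ ε : ℝ) (d s : ℕ) (h₀ : Vec a) (m₀ : Vec b) : Set (Vec a × Vec b) :=
  hyperbolicNhd (K₂ * d ^ 3 * s ^ 3 * ε ^ (1 / 4 : ℝ)) h₀ m₀ ∪
  hyperbolicNhd (K₂ * d ^ 8 * s ^ 3 * ε ^ (1 / 4 : ℝ)) (-(rho d) • h₀) m₀ ∪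
  hyperbolicNhd (K₂ * d ^ 3 * s ^ 8 * ε ^ (1 / 4 : ℝ)) (rho s • h₀) (-m₀) ∪
  hyperbolicNhd (K₂ * d ^ 8 * s ^ 8 * ε ^ (1 / 4 : ℝ)) (-(rho d * rho s) • h₀) (-m₀)

/-! ### The random weights -/

/-- The random matrix `V` has i.i.d. `N(0, 1/k)` entries. -/
def IsIIDGaussian {Ω : Type*} [MeasurableSpace Ω] (P : Measure Ω) {a b : ℕ} (k : ℕ)
    (V : Ω → Matrix (Fin a) (Fin b) ℝ) : Prop :=
  (∀ i j, HasLaw (fun ω => V ω i j) (gaussianReal 0 (k : ℝ≥0)⁻¹) P) ∧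
    iIndepFun (fun (ij : Fin a × Fin b) ω => V ω ij.1 ij.2) P

/-- Row truncation: each row `w` of the `ℓ × k` matrix `V` is replaced by
`w · 1_{‖w‖₂ ≤ 3 √(k / ℓ)}`. -/
def truncRows {ℓ k : ℕ} (V : Matrix (Fin ℓ) (Fin k) ℝ) : Matrix (Fin ℓ) (Fin k) ℝ :=
  Matrix.of fun i j =>
    if ‖(WithLp.toLp 2 (V i) : Vec k)‖ ≤ 3 * Real.sqrt ((k : ℝ) / ℓ) then V i j else 0

/-- The random inner weights `W` and the random matrix `V` (whose row truncation is the last weight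
matrix) follow the Gaussian model for a network with `d` layers: layer `i + 1 ≤ d - 1` has i.i.d.
`N(0, 1/n_{i+1})` entries, and `V` has i.i.d. `N(0, 1/ℓ)` entries. -/
def IsGaussianModel {Ω : Type*} [MeasurableSpace Ω] (P : Measure Ω) (n : ℕ → ℕ) (d ℓ : ℕ)
    (W : Ω → (i : ℕ) → Matrix (Fin (n (i + 1))) (Fin (n i)) ℝ)
    (V : Ω → Matrix (Fin ℓ) (Fin (n (d - 1))) ℝ) : Prop :=
  (∀ i < d - 1, IsIIDGaussian P (n (i + 1)) fun ω => W ω i) ∧ IsIIDGaussian P ℓ V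

/-- The widths are strictly increasing: `n_0 < n_1 < ⋯ < n_{d-1} < ℓ`. -/
def Expansive (n : ℕ → ℕ) (d ℓ : ℕ) : Prop :=
  (∀ i < d - 1, n i < n (i + 1)) ∧ n (d - 1) < ℓ

/-- Inner layers: `n_{i+1} ≥ c n_i log n_i`. -/
def InnerExpansive (c : ℝ) (n : ℕ → ℕ) (d : ℕ) : Prop :=
  ∀ i < d - 1, c * (n i * Real.log (n i)) ≤ n (i + 1)

/-- Last layers: `ℓ ≥ c ((n_{d-1} log n_{d-1})² + (p_{s-1} log p_{s-1})²)`. -/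
def LastExpansive (c : ℝ) (n p : ℕ → ℕ) (d s ℓ : ℕ) : Prop :=
  c * ((n (d - 1) * Real.log (n (d - 1))) ^ 2 + (p (s - 1) * Real.log (p (s - 1))) ^ 2) ≤ ℓ

/-- The failure probability `∑_{i=1}^d c' n_i e^{-γ n_{i-1}}` of one network, where `n_d = ℓ`. -/
def failProb (c' γ : ℝ) (n : ℕ → ℕ) (d ℓ : ℕ) : ℝ :=
  (∑ i ∈ Finset.range (d - 1), c' * n (i + 1) * Real.exp (-γ * n i)) +
    c' * ℓ * Real.exp (-γ * n (d - 1))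

/-! ### The landscape -/

/-- At `z`, one of the directions `-g₁`, `-g₂` strictly decreases `f`, where `g₁ = (v₁, 0)` and
`g₂ = (0, v₂)` are the one-sided partial gradients of `f` at `z` along `w`. -/
def HasDescent {a b : ℕ} (f : Vec a × Vec b → ℝ) (z w : Vec a × Vec b) : Prop :=
  ∃ v₁ v₂, IsOneSidedGrad₁ f z w v₁ ∧ IsOneSidedGrad₂ f z w v₂ ∧
    ((∃ D < 0, HasOneSidedDeriv f z (-(v₁, 0)) D) ∨
      (∃ D < 0, HasOneSidedDeriv f z (-(0, v₂)) D))

end BlindDemodulation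

end

/-!
The argument has a deterministic part and a probabilistic part, which meet in the *weight
distribution conditions* `WDC` and `JointWDC`.

**Deterministic part.** For a Gaussian vector `a`, the vector `2 𝔼[1_{⟪a, x⟫ > 0} max(⟪a, y⟫, 0) a]`
is the explicit vector `arcVec x y`. The condition `WDC δ W` says that the average over the rows of
`W` is `δ`-close to this expectation, uniformly in the directions; `JointWDC` says that the average
over the rows of the products that occur for the two last layers is close to the product of the two
expectations. A layer satisfying `WDC` halves squared norms and transforms angles by `angleMap`, up
to a small error. Since `angleMap` is `1`-Lipschitz, the errors add up only linearly over the layers,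
and by Hölder continuity of `arccos` the angles after `k` layers are those given by the iterates of
`angleMap`, up to `O(k √δ)`. The risk is piecewise polynomial, because the networks are piecewise
linear (`IsPiecewiseLinear`). Wherever the piece is constant, its partial gradient in `h` is therefore
close, after normalization, to `gradLim`, which is `‖m‖² h` minus a combination of `h₀` and `h` whose
coefficients depend only on the norms and on the angles `∠(h, h₀)` and `∠(m, m₀)`
(`abs_riskDeriv_sub_gradLim_le`).
Since `gradLim` is continuous off the axes, a point where it exceeds the error is a point from which
the negative one-sided partial gradient is a descent direction, whatever the piece entered
(`exists_descent_fst`, `exists_descent_snd`).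

If both limiting gradients are small, then the component of `gradLim` orthogonal to `h` forces
`∠(h, h₀)` to be close to `0` or to `π`, because the coefficient of `h₀` decays only polynomially in
the depth (`angProd_ge`); the same holds for `∠(m, m₀)`. The component along `h` determines
`‖h‖ ‖m‖` up to a small relative error, as `‖h₀‖ ‖m₀‖` times `cos θ_d cos φ_s`, where `θ_d` and `φ_s`
are the iterated angles. Iterating from the angle `0` gives cosine `1`, iterating from `π` gives
`ρ_k` (`rho_eq_cos`). The four sign patterns are the four hyperbolic neighborhoods
(`mem_fourNhds_of_norm_gradLim_le`).

At a point of an axis the product of the two networks vanishes, so that the one-sided derivative of the risk is minus the correlation of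
the target with the derivative of the product, and this correlation is nonnegative because all
outputs are. For nonzero targets, the correlation of the target with the product is bounded below by
a multiple of `‖h‖ ‖m‖` (`exists_le_sum_net`), which beats the square of the product near an axis.
These statements are collected in `landscape`.

The facts on `ρ` follow from `ρ_k = cos θ_k`, since the iterates `θ_k` of `angleMap` from `π` lie
below `π / 2` from the second one on and tend to `0` like `1 / k`.

**Probabilistic part.** The expectation is computed in `two_mul_integral_rowTerm` by reduction to a
Gaussian integral in the plane. For fixed directions, averages of products of two Gaussian
coordinates, possibly multiplied by an independent bounded weight, concentrate by a Chernoff bound.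
Uniformity in the directions comes from a net of the sphere; the discontinuity of the indicator is
absorbed by comparing with a slab around the hyperplane `⟪x, a⟫ = 0`, whose contribution also
concentrates (`measureReal_uniform_le`). For the last layers the second factor is the product of two
rectified linear functions, truncated at a level `9 q` exceeded only by rows of norm more than
`3 √q`. Hence the exponent loses a factor `q`, which is the reason for the square in the condition on
`ℓ`. Rows of norm more than `3 √q` are excluded with high probability, so the truncation of rows in
the model is inactive on the event in question.

With `t` a small multiple of `ε⁵` and `c = γ⁻¹ = 10⁹ / t²`, either some layer has width at most
`γ⁻¹`, in which case the claimed bound on the probability is trivial, or all widths exceed `10⁹ / t²`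
and the entropy of the nets is dominated by the exponent (`layer_net_bound_le`,
`joint_net_bound_le`).
-/

noncomputable section

namespace BlindDemodulation

open scoped RealInnerProductSpace

/-! ### The angle map -/

open Real in
/-- The cosine of `angleMap θ`, as a polynomial in `θ`, `cos θ`, `sin θ`. -/
def cosAngleMap (θ : ℝ) : ℝ := (1 - θ / π) * cos θ + sin θ / π

open Real in
lemma angleMap_eq (θ : ℝ) : angleMap θ = arccos (cosAngleMap θ) := by
  unfold angleMap cosAngleMap
  congr 1
  field_simp

open Real in
lemma abs_cosAngleMap_le {θ : ℝ} (h0 : 0 ≤ θ) (h1 : θ ≤ π) : |cosAngleMap θ| ≤ 1 := by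
  have hs := sin_nonneg_of_nonneg_of_le_pi h0 h1
  have hs1 : sin θ / π ≤ θ / π := by gcongr; exact sin_le h0
  have ht : 0 ≤ 1 - θ / π := by
    have : θ / π ≤ 1 := (div_le_one pi_pos).2 h1
    linarith
  have hs0 : 0 ≤ sin θ / π := by positivity
  have hc := abs_le.1 (abs_cos_le_one θ)
  unfold cosAngleMap
  rw [abs_le]
  constructor <;> nlinarith

open Real in
lemma cos_angleMap {θ : ℝ} (h0 : 0 ≤ θ) (h1 : θ ≤ π) :
    cos (angleMap θ) = cosAngleMap θ := by
  have := abs_le.1 (abs_cosAngleMap_le h0 h1)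
  rw [angleMap_eq, cos_arccos this.1 this.2]

lemma angleMap_nonneg (θ : ℝ) : 0 ≤ angleMap θ := Real.arccos_nonneg _

lemma angleMap_le_pi (θ : ℝ) : angleMap θ ≤ Real.pi := Real.arccos_le_pi _

open Real in
@[fun_prop]
lemma continuous_angleMap : Continuous angleMap := by
  unfold angleMap
  fun_prop

open Real in
lemma hasDerivAt_cosAngleMap (θ : ℝ) :
    HasDerivAt cosAngleMap (-(1 - θ / π) * sin θ) θ := by
  unfold cosAngleMap
  have h := ((((hasDerivAt_id θ).div_const π).const_sub 1).mul (hasDerivAt_cos θ)).add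
    ((hasDerivAt_sin θ).div_const π)
  refine h.congr_deriv ?_
  simp only [id_eq]
  ring

open Real in
lemma cosAngleMap_antitoneOn : AntitoneOn cosAngleMap (Set.Icc 0 π) := by
  refine antitoneOn_of_deriv_nonpos (convex_Icc _ _)
    (fun x _ => (hasDerivAt_cosAngleMap x).continuousAt.continuousWithinAt)
    (fun x _ => (hasDerivAt_cosAngleMap x).differentiableAt.differentiableWithinAt) ?_
  intro x hx
  rw [interior_Icc] at hx
  rw [(hasDerivAt_cosAngleMap x).deriv]
  have hs := sin_nonneg_of_nonneg_of_le_pi hx.1.le hx.2.le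
  have ht : 0 ≤ 1 - x / π := by
    have : x / π ≤ 1 := (div_le_one pi_pos).2 hx.2.le
    linarith
  nlinarith [mul_nonneg ht hs]

open Real in
lemma angleMap_monotoneOn : MonotoneOn angleMap (Set.Icc 0 π) := by
  intro x hx y hy hxy
  rw [angleMap_eq, angleMap_eq]
  exact antitone_arccos (cosAngleMap_antitoneOn hx hy hxy)

open Real in
lemma angleMap_zero : angleMap 0 = 0 := by simp [angleMap]

open Real in
lemma angleMap_pi : angleMap π = π / 2 := by simp [angleMap]

open Real in
lemma angleMap_le_half_pi {θ : ℝ} (h0 : 0 ≤ θ) (h1 : θ ≤ π) : angleMap θ ≤ π / 2 := by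
  rw [← angleMap_pi]
  exact angleMap_monotoneOn ⟨h0, h1⟩ ⟨pi_pos.le, le_rfl⟩ h1

open Real in
/-- `(1 - θ/π)² sin² θ ≤ sin² (angleMap θ)`: the derivative of `angleMap` is at most `1`. -/
lemma sq_mul_sin_le {θ : ℝ} (h0 : 0 ≤ θ) (h1 : θ ≤ π) :
    ((1 - θ / π) * sin θ) ^ 2 ≤ 1 - cosAngleMap θ ^ 2 := by
  have hs := sin_nonneg_of_nonneg_of_le_pi h0 h1
  have hs1 : sin θ / π ≤ θ / π := by gcongr; exact sin_le h0
  have ht : 0 ≤ 1 - θ / π := by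
    have : θ / π ≤ 1 := (div_le_one pi_pos).2 h1
    linarith
  have hs0 : 0 ≤ sin θ / π := by positivity
  have hc := cos_le_one θ
  unfold cosAngleMap
  have e : ((1 - θ / π) * sin θ) ^ 2 + ((1 - θ / π) * cos θ + sin θ / π) ^ 2
      = (1 - θ / π) ^ 2 + 2 * (1 - θ / π) * (sin θ / π) * cos θ + (sin θ / π) ^ 2 := by
    have := sin_sq_add_cos_sq θ
    linear_combination (1 - θ / π) ^ 2 * this
  have e2 : 2 * (1 - θ / π) * (sin θ / π) * cos θ ≤ 2 * (1 - θ / π) * (sin θ / π) := by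
    have : 0 ≤ 2 * (1 - θ / π) * (sin θ / π) := by positivity
    nlinarith
  nlinarith

open Real in
lemma cosAngleMap_mem_Ioo {θ : ℝ} (h0 : 0 < θ) (h1 : θ < π) :
    -1 < cosAngleMap θ ∧ cosAngleMap θ < 1 := by
  have := sq_mul_sin_le h0.le h1.le
  have hs := sin_pos_of_pos_of_lt_pi h0 h1
  have ht : 0 < 1 - θ / π := by
    have : θ / π < 1 := (div_lt_one pi_pos).2 h1
    linarith
  have : 0 < ((1 - θ / π) * sin θ) ^ 2 := by positivity
  constructor <;> nlinarith

open Real in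
lemma sub_angleMap_monotoneOn : MonotoneOn (fun θ => θ - angleMap θ) (Set.Icc 0 π) := by
  have hd : ∀ x ∈ Set.Ioo 0 π, HasDerivAt (fun θ => θ - angleMap θ)
      (1 - (-(1 / √(1 - cosAngleMap x ^ 2)) * (-(1 - x / π) * sin x))) x := by
    intro x hx
    have hm := cosAngleMap_mem_Ioo hx.1 hx.2
    have h2 := (hasDerivAt_arccos hm.1.ne' hm.2.ne).comp x (hasDerivAt_cosAngleMap x)
    have h3 : HasDerivAt angleMap
        (-(1 / √(1 - cosAngleMap x ^ 2)) * (-(1 - x / π) * sin x)) x := by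
      exact h2.congr_of_eventuallyEq (Eventually.of_forall angleMap_eq)
    exact (hasDerivAt_id x).sub h3
  refine monotoneOn_of_deriv_nonneg (convex_Icc _ _) (by fun_prop) ?_ ?_
  · intro x hx
    rw [interior_Icc] at hx
    exact (hd x hx).differentiableAt.differentiableWithinAt
  · intro x hx
    rw [interior_Icc] at hx
    rw [(hd x hx).deriv]
    have hm := cosAngleMap_mem_Ioo hx.1 hx.2
    have hpos : 0 < 1 - cosAngleMap x ^ 2 := by nlinarith
    have hle : (1 - x / π) * sin x ≤ √(1 - cosAngleMap x ^ 2) :=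
      le_sqrt_of_sq_le (sq_mul_sin_le hx.1.le hx.2.le)
    have : 1 / √(1 - cosAngleMap x ^ 2) * ((1 - x / π) * sin x) ≤ 1 := by
      rw [one_div, inv_mul_le_iff₀ (sqrt_pos.2 hpos)]
      linarith
    linarith

open Real in
lemma abs_angleMap_sub_le {x y : ℝ} (hx : x ∈ Set.Icc 0 π) (hy : y ∈ Set.Icc 0 π) :
    |angleMap x - angleMap y| ≤ |x - y| := by
  rcases le_total x y with h | h
  · have h1 := angleMap_monotoneOn hx hy h
    have h2 := sub_angleMap_monotoneOn hx hy h
    simp only at h2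
    rw [abs_sub_comm, abs_sub_comm x, abs_of_nonneg (by linarith), abs_of_nonneg (by linarith)]
    linarith
  · have h1 := angleMap_monotoneOn hy hx h
    have h2 := sub_angleMap_monotoneOn hy hx h
    simp only at h2
    rw [abs_of_nonneg (by linarith), abs_of_nonneg (by linarith)]
    linarith

open Real in
lemma angleMap_le_self {θ : ℝ} (h0 : 0 ≤ θ) (h1 : θ ≤ π) : angleMap θ ≤ θ := by
  have h := abs_angleMap_sub_le (x := θ) (y := 0) ⟨h0, h1⟩ ⟨le_rfl, pi_pos.le⟩
  rw [angleMap_zero, sub_zero, sub_zero, abs_of_nonneg h0, abs_of_nonneg (angleMap_nonneg _)] at h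
  exact h

lemma iterate_angleMap_mem {θ : ℝ} (h : θ ∈ Set.Icc 0 Real.pi) (k : ℕ) :
    angleMap^[k] θ ∈ Set.Icc 0 Real.pi := by
  cases k with
  | zero => exact h
  | succ k =>
    rw [Function.iterate_succ_apply']
    exact ⟨angleMap_nonneg _, angleMap_le_pi _⟩

lemma abs_iterate_angleMap_sub_le {x y : ℝ} (hx : x ∈ Set.Icc 0 Real.pi)
    (hy : y ∈ Set.Icc 0 Real.pi) (k : ℕ) :
    |angleMap^[k] x - angleMap^[k] y| ≤ |x - y| := by
  induction k with
  | zero => simp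
  | succ k ih =>
    rw [Function.iterate_succ_apply', Function.iterate_succ_apply']
    exact (abs_angleMap_sub_le (iterate_angleMap_mem hx k) (iterate_angleMap_mem hy k)).trans ih

lemma iterate_angleMap_zero (k : ℕ) : angleMap^[k] 0 = 0 := by
  induction k with
  | zero => rfl
  | succ k ih => rw [Function.iterate_succ_apply', ih, angleMap_zero]

open Real in
lemma iterate_angleMap_le {θ : ℝ} (h : θ ∈ Set.Icc 0 π) {j k : ℕ} (hjk : j ≤ k) :
    angleMap^[k] θ ≤ angleMap^[j] θ := by
  induction k, hjk using Nat.le_induction with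
  | base => exact le_rfl
  | succ k _ ih =>
    rw [Function.iterate_succ_apply']
    have := iterate_angleMap_mem h k
    exact (angleMap_le_self this.1 this.2).trans ih

open Real in
lemma iterate_angleMap_le_half_pi {θ : ℝ} (h : θ ∈ Set.Icc 0 π) {k : ℕ} (hk : 1 ≤ k) :
    angleMap^[k] θ ≤ π / 2 :=
  (iterate_angleMap_le h hk).trans (angleMap_le_half_pi h.1 h.2)

open Real in
lemma cos_iterate_angleMap_ge {θ : ℝ} (h : θ ∈ Set.Icc 0 π) {k : ℕ} (hk : 2 ≤ k) :
    1 / π ≤ cos (angleMap^[k] θ) := by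
  have h1 := iterate_angleMap_mem h 1
  have h2 : angleMap^[k] θ ≤ angleMap (π / 2) := by
    refine (iterate_angleMap_le h hk).trans ?_
    rw [Function.iterate_succ_apply']
    exact angleMap_monotoneOn h1 ⟨by positivity, by linarith [pi_pos]⟩
      (iterate_angleMap_le_half_pi h le_rfl)
  have h3 : cos (angleMap (π / 2)) = 1 / π := by
    rw [cos_angleMap (by positivity) (by linarith [pi_pos])]
    simp [cosAngleMap]
  rw [← h3]
  exact cos_le_cos_of_nonneg_of_le_pi (iterate_angleMap_mem h k).1 (angleMap_le_pi _) h2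

/-! ### The constants `ρ` -/

/-- `ρ_a` is the cosine of the `a`-th angle: both sides satisfy the same affine recursion. -/
lemma rho_eq_cos {a : ℕ} (ha : 1 ≤ a) : rho a = Real.cos (angleIter a) := by
  have hpi : Real.pi ∈ Set.Icc 0 Real.pi := ⟨Real.pi_pos.le, le_rfl⟩
  induction a, ha using Nat.le_induction with
  | base => simp [rho, angleIter, angleMap_pi]
  | succ a ha ih =>
    have hrec : rho (a + 1) = (1 - angleIter a / Real.pi) * rho a
        + Real.sin (angleIter a) / Real.pi := by
      unfold rho
      rw [Finset.sum_Ico_succ_top ha, Finset.mul_sum]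
      congr 1
      · refine Finset.sum_congr rfl fun i hi => ?_
        rw [Finset.prod_Ico_succ_top (by have := Finset.mem_Ico.1 hi; omega)]
        field_simp
      · simp
    have hm := iterate_angleMap_mem hpi a
    rw [hrec, ih, angleIter, angleIter, Function.iterate_succ_apply', cos_angleMap hm.1 hm.2]
    rfl

lemma rho_ge {a : ℕ} (ha : 2 ≤ a) : 1 / Real.pi ≤ rho a := by
  rw [rho_eq_cos (by omega)]
  exact cos_iterate_angleMap_ge ⟨Real.pi_pos.le, le_rfl⟩ ha

lemma rho_pos {a : ℕ} (ha : 2 ≤ a) : 0 < rho a :=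
  lt_of_lt_of_le (by positivity) (rho_ge ha)

lemma rho_le_one {a : ℕ} (ha : 1 ≤ a) : rho a ≤ 1 := by
  rw [rho_eq_cos ha]
  exact Real.cos_le_one _

open Real in
/-- For `0 ≤ θ ≤ π / 2`, `sin θ - θ cos θ ≥ 2 θ³ / (3 π)`. -/
lemma cube_le_sin_sub {θ : ℝ} (h0 : 0 ≤ θ) (h1 : θ ≤ π / 2) :
    2 * θ ^ 3 / (3 * π) ≤ sin θ - θ * cos θ := by
  have hd : ∀ x, HasDerivAt (fun x => sin x - x * cos x - 2 * x ^ 3 / (3 * π))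
      (x * sin x - 2 * x ^ 2 / π) x := by
    intro x
    have h := ((hasDerivAt_sin x).sub ((hasDerivAt_id x).mul (hasDerivAt_cos x))).sub
      ((((hasDerivAt_id x).pow 3).const_mul 2).div_const (3 * π))
    refine h.congr_deriv ?_
    simp only [id_eq]
    field_simp
    ring
  have hm : MonotoneOn (fun x => sin x - x * cos x - 2 * x ^ 3 / (3 * π))
      (Set.Icc 0 (π / 2)) := by
    refine monotoneOn_of_deriv_nonneg (convex_Icc _ _)
      (fun x _ => (hd x).continuousAt.continuousWithinAt)
      (fun x _ => (hd x).differentiableAt.differentiableWithinAt) ?_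
    intro x hx
    rw [interior_Icc] at hx
    rw [(hd x).deriv]
    have := mul_le_sin hx.1.le hx.2.le
    have h2 : 2 * x ^ 2 / π = x * (2 / π * x) := by ring
    rw [h2]
    nlinarith [hx.1]
  have := hm ⟨le_rfl, by positivity⟩ ⟨h0, h1⟩ h0
  simp at this
  linarith

open Real in
/-- The angle map contracts at least like `θ ↦ θ - θ² / 15`. -/
lemma angleMap_le_sub_sq {θ : ℝ} (h0 : 0 ≤ θ) (h1 : θ ≤ π / 2) :
    angleMap θ ≤ θ - θ ^ 2 / 15 := by
  have hpi := pi_pos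
  have hpi4 := pi_lt_d2
  have hs0 : 0 ≤ θ ^ 2 / 15 := by positivity
  have hs1 : θ ^ 2 / 15 ≤ θ := by nlinarith
  have hm : θ - θ ^ 2 / 15 ∈ Set.Icc 0 π := ⟨by linarith, by linarith⟩
  rw [angleMap_eq, ← arccos_cos hm.1 hm.2]
  refine antitone_arccos ?_
  have key := cube_le_sin_sub h0 h1
  have e : cosAngleMap θ = cos θ + (sin θ - θ * cos θ) / π := by
    unfold cosAngleMap
    field_simp
    ring
  have h2 : θ ^ 3 / 15 ≤ (sin θ - θ * cos θ) / π := by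
    rw [le_div_iff₀ hpi]
    refine le_trans ?_ key
    rw [le_div_iff₀ (by positivity)]
    have : 0 ≤ θ ^ 3 := by positivity
    have hp : π ^ 2 ≤ 10 := by nlinarith
    nlinarith
  have h3 : cos (θ - θ ^ 2 / 15) - cos θ ≤ θ ^ 3 / 15 := by
    rw [cos_sub_cos]
    have e1 : (θ - θ ^ 2 / 15 - θ) / 2 = -(θ ^ 2 / 30) := by ring
    rw [e1, sin_neg]
    have a1 : sin ((θ - θ ^ 2 / 15 + θ) / 2) ≤ θ :=
      (sin_le (by linarith)).trans (by linarith)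
    have a2 : sin (θ ^ 2 / 30) ≤ θ ^ 2 / 30 := sin_le (by positivity)
    have a3 : 0 ≤ sin (θ ^ 2 / 30) :=
      sin_nonneg_of_nonneg_of_le_pi (by positivity) (by linarith)
    nlinarith [mul_le_mul a1 a2 a3 h0]
  linarith

open Real in
/-- The iterated angles decay at least like `15 / k`. -/
lemma iterate_angleMap_le_div {θ : ℝ} (h : θ ∈ Set.Icc 0 π) {k : ℕ} (hk : 1 ≤ k) :
    angleMap^[k] θ ≤ 15 / (k + 7) := by
  induction k, hk using Nat.le_induction with
  | base =>
    have h1 := iterate_angleMap_le_half_pi h le_rfl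
    have := pi_lt_d2
    norm_num at h1 ⊢
    linarith
  | succ k hk ih =>
    have hm := iterate_angleMap_mem h k
    have hm2 := iterate_angleMap_le_half_pi h hk
    have hpi4 := pi_lt_d2
    rw [Function.iterate_succ_apply']
    refine (angleMap_le_sub_sq hm.1 hm2).trans ?_
    set x := angleMap^[k] θ
    have hk7 : (0 : ℝ) < k + 7 := by positivity
    have hk1 : (1 : ℝ) ≤ k := by exact_mod_cast hk
    push_cast
    -- the quadratic is increasing below `15 / 2`
    have h1 : x - x ^ 2 / 15 ≤ 15 / (k + 7) - (15 / (k + 7)) ^ 2 / 15 := by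
      have h15 : 15 / ((k : ℝ) + 7) ≤ 15 / 8 := by gcongr; linarith
      nlinarith [hm.1]
    refine h1.trans ?_
    rw [div_pow, le_div_iff₀ (by positivity)]
    have e : (15 / ((k : ℝ) + 7) - 15 ^ 2 / (k + 7) ^ 2 / 15) * (k + 1 + 7)
      = 15 - 15 / (k + 7) ^ 2 := by field_simp; ring
    rw [e]
    have : 0 ≤ 15 / ((k : ℝ) + 7) ^ 2 := by positivity
    linarith

lemma tendsto_rho : Tendsto rho atTop (𝓝 1) := by
  have hpi : Real.pi ∈ Set.Icc 0 Real.pi := ⟨Real.pi_pos.le, le_rfl⟩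
  have h1 : Tendsto angleIter atTop (𝓝 0) := by
    have h2 : Tendsto (fun k : ℕ => 15 / ((k : ℝ) + 7)) atTop (𝓝 0) :=
      tendsto_const_nhds.div_atTop (tendsto_natCast_atTop_atTop.atTop_add tendsto_const_nhds)
    refine squeeze_zero' (Eventually.of_forall fun k => (iterate_angleMap_mem hpi k).1) ?_ h2
    filter_upwards [eventually_ge_atTop 1] with k hk
    exact iterate_angleMap_le_div hpi hk
  have h3 := (Real.continuous_cos.tendsto 0).comp h1
  rw [Real.cos_zero] at h3
  refine h3.congr' ?_
  filter_upwards [eventually_ge_atTop 1] with k hk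
  exact (rho_eq_cos hk).symm

/-! ### The coefficients of the limiting gradient -/

/-- `∏_{j < k} (1 - θ_j / π)`, where `θ_j` is the `j`-th iterate of the angle map at `θ`. -/
def angProd (θ : ℝ) : ℕ → ℝ
  | 0 => 1
  | k + 1 => (1 - angleMap^[k] θ / Real.pi) * angProd θ k

/-- `∑_{i < k} (sin θ_i / π) ∏_{i < j < k} (1 - θ_j / π)`, where `θ_j` is the `j`-th iterate of the
angle map at `θ`. -/
def angSum (θ : ℝ) : ℕ → ℝ
  | 0 => 0
  | k + 1 => (1 - angleMap^[k] θ / Real.pi) * angSum θ k + Real.sin (angleMap^[k] θ) / Real.pi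

lemma one_sub_div_pi_nonneg {θ : ℝ} (h : θ ∈ Set.Icc 0 Real.pi) : 0 ≤ 1 - θ / Real.pi := by
  have : θ / Real.pi ≤ 1 := (div_le_one Real.pi_pos).2 h.2
  linarith

lemma angProd_nonneg {θ : ℝ} (h : θ ∈ Set.Icc 0 Real.pi) (k : ℕ) : 0 ≤ angProd θ k := by
  induction k with
  | zero => simp [angProd]
  | succ k ih => exact mul_nonneg (one_sub_div_pi_nonneg (iterate_angleMap_mem h k)) ih

lemma angSum_nonneg {θ : ℝ} (h : θ ∈ Set.Icc 0 Real.pi) (k : ℕ) : 0 ≤ angSum θ k := by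
  induction k with
  | zero => simp [angSum]
  | succ k ih =>
    have hm := iterate_angleMap_mem h k
    have := Real.sin_nonneg_of_nonneg_of_le_pi hm.1 hm.2
    have := one_sub_div_pi_nonneg hm
    unfold angSum
    positivity

lemma angProd_mul_cos_add_angSum {θ : ℝ} (h : θ ∈ Set.Icc 0 Real.pi) (k : ℕ) :
    angProd θ k * Real.cos θ + angSum θ k = Real.cos (angleMap^[k] θ) := by
  induction k with
  | zero => simp [angProd, angSum]
  | succ k ih =>
    have hm := iterate_angleMap_mem h k
    rw [Function.iterate_succ_apply', cos_angleMap hm.1 hm.2, cosAngleMap, ← ih, angProd, angSum]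
    ring

lemma angProd_add_angSum_le_one {θ : ℝ} (h : θ ∈ Set.Icc 0 Real.pi) (k : ℕ) :
    angProd θ k + angSum θ k ≤ 1 := by
  induction k with
  | zero => simp [angProd, angSum]
  | succ k ih =>
    have hm := iterate_angleMap_mem h k
    have h1 := one_sub_div_pi_nonneg hm
    have h2 : Real.sin (angleMap^[k] θ) / Real.pi ≤ angleMap^[k] θ / Real.pi := by
      gcongr
      exact Real.sin_le hm.1
    unfold angProd angSum
    nlinarith

/-- The product of the factors `1 - θ_j / π` decays only polynomially in the depth. -/
lemma angProd_ge {θ : ℝ} (h : θ ∈ Set.Icc 0 Real.pi) {k : ℕ} (hk : 1 ≤ k) :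
    (1 - θ / Real.pi) * (1 / (k : ℝ)) ^ 5 ≤ angProd θ k := by
  have hpi := Real.pi_pos
  have hpi3 := Real.pi_gt_three
  have h0 := one_sub_div_pi_nonneg h
  induction k, hk using Nat.le_induction with
  | base => simp [angProd]
  | succ k hk ih =>
    have hm := iterate_angleMap_mem h k
    have hk1 : (1 : ℝ) ≤ k := by exact_mod_cast hk
    have hd := iterate_angleMap_le_div h hk
    have h1 : (k / ((k : ℝ) + 1)) ^ 5 ≤ 1 - angleMap^[k] θ / Real.pi := by
      have a1 : angleMap^[k] θ / Real.pi ≤ 5 / (k + 7) := by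
        rw [div_le_iff₀ hpi]
        refine hd.trans ?_
        rw [div_mul_eq_mul_div]
        gcongr
        linarith
      have a2 : (k / ((k : ℝ) + 1)) ^ 5 ≤ 1 - 5 / (k + 7) := by
        have e : (1 : ℝ) - 5 / (k + 7) = (k + 2) / (k + 7) := by field_simp; ring
        rw [e, div_pow, div_le_div_iff₀ (by positivity) (by positivity)]
        nlinarith [pow_pos (lt_of_lt_of_le one_pos hk1) 2, pow_pos (lt_of_lt_of_le one_pos hk1) 3,
          pow_pos (lt_of_lt_of_le one_pos hk1) 4, pow_pos (lt_of_lt_of_le one_pos hk1) 5]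
      linarith
    have e : (1 - θ / Real.pi) * (1 / ((k + 1 : ℕ) : ℝ)) ^ 5
        = (k / ((k : ℝ) + 1)) ^ 5 * ((1 - θ / Real.pi) * (1 / (k : ℝ)) ^ 5) := by
      push_cast
      field_simp
    rw [e, angProd]
    exact mul_le_mul h1 ih (by positivity) (one_sub_div_pi_nonneg hm)

open Real in
/-- Hölder continuity of `arccos`. -/
lemma abs_arccos_sub_arccos_le {s t : ℝ} (hs : |s| ≤ 1) (ht : |t| ≤ 1) :
    |arccos s - arccos t| ≤ 3 * √|s - t| := by
  wlog hab : arccos t ≤ arccos s generalizing s t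
  · rw [abs_sub_comm, abs_sub_comm s]
    exact this ht hs (le_of_not_ge hab)
  rw [abs_le] at hs ht
  set a := arccos s with ha
  set b := arccos t with hb
  have hsa : s = cos a := (cos_arccos hs.1 hs.2).symm
  have htb : t = cos b := (cos_arccos ht.1 ht.2).symm
  have hb0 : 0 ≤ b := arccos_nonneg _
  have hapi : a ≤ π := arccos_le_pi _
  have hpi := pi_pos
  rw [abs_of_nonneg (by linarith)]
  have hx0 : 0 ≤ (a - b) / 2 := by linarith
  have hx1 : (a - b) / 2 ≤ π / 2 := by linarith
  have hsin : 2 / π * ((a - b) / 2) ≤ sin ((a - b) / 2) := mul_le_sin hx0 hx1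
  have hsin0 : 0 ≤ sin ((a - b) / 2) :=
    sin_nonneg_of_nonneg_of_le_pi hx0 (by linarith)
  have hsum : sin ((a - b) / 2) ≤ sin ((a + b) / 2) := by
    rw [← cos_pi_div_two_sub, ← cos_pi_div_two_sub, ← cos_abs (π / 2 - (a + b) / 2)]
    apply cos_le_cos_of_nonneg_of_le_pi (abs_nonneg _) (by linarith)
    rw [abs_le]
    constructor <;> linarith
  have hst : 2 * ((a - b) / π) ^ 2 ≤ |s - t| := by
    have : t - s = 2 * (sin ((a + b) / 2) * sin ((a - b) / 2)) := by
      rw [hsa, htb, cos_sub_cos]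
      have : (b - a) / 2 = -((a - b) / 2) := by ring
      rw [this, sin_neg, add_comm b a]
      ring
    rw [abs_sub_comm, this, abs_of_nonneg (by nlinarith)]
    have h2 : (a - b) / π = 2 / π * ((a - b) / 2) := by field_simp
    have h3 : 0 ≤ 2 / π * ((a - b) / 2) := by positivity
    rw [h2]
    nlinarith
  have h4 : (a - b) ^ 2 ≤ 3 ^ 2 * |s - t| := by
    have : (a - b) ^ 2 = π ^ 2 * ((a - b) / π) ^ 2 := by field_simp
    rw [this]
    have hp : π ^ 2 ≤ 10 := by nlinarith [pi_lt_d2]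
    nlinarith [sq_nonneg ((a - b) / π)]
  calc a - b = √((a - b) ^ 2) := (sqrt_sq (by linarith)).symm
    _ ≤ √(3 ^ 2 * |s - t|) := sqrt_le_sqrt h4
    _ = 3 * √|s - t| := by rw [sqrt_mul (by norm_num), sqrt_sq (by norm_num)]

/-! ### Piecewise linear maps and germs along rays -/

/-- The filter of pairs `(δ, t)` of positive numbers where `δ` is small, and `t` is small depending
on `δ`. -/
def rayFilter : Filter (ℝ × ℝ) := (𝓝[>] (0 : ℝ)).curry (𝓝[>] (0 : ℝ))

instance : rayFilter.NeBot := by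
  rw [neBot_iff]
  intro h
  have h1 : ∀ᶠ q in rayFilter, False := by rw [h]; exact eventually_bot
  rw [rayFilter, eventually_curry_iff] at h1
  obtain ⟨δ, hδ⟩ := h1.exists
  exact hδ.exists.elim fun _ h => h

lemma rayFilter_le : rayFilter ≤ 𝓝 ((0, 0) : ℝ × ℝ) := by
  rw [nhds_prod_eq]
  exact curry_le_prod.trans (Filter.prod_mono nhdsWithin_le_nhds nhdsWithin_le_nhds)

lemma tendsto_ray {E : Type*} [NormedAddCommGroup E] [NormedSpace ℝ E] (z w v : E) :
    Tendsto (fun q : ℝ × ℝ => z + q.1 • w + q.2 • v) rayFilter (𝓝 z) := by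
  have h : Continuous (fun q : ℝ × ℝ => z + q.1 • w + q.2 • v) := by fun_prop
  have h2 := (h.tendsto (0, 0)).mono_left rayFilter_le
  simpa using h2

/-- Along a ray germ the sign of an affine function is eventually constant. -/
lemma eventually_sign_ray (A B C : ℝ) :
    (∀ᶠ q in rayFilter, 0 < A + q.1 * B + q.2 * C) ∨
      (∀ᶠ q in rayFilter, ¬ 0 < A + q.1 * B + q.2 * C) := by
  have key : ∀ A B : ℝ, 0 < A → ∀ᶠ t in 𝓝[>] (0 : ℝ), 0 < A + t * B := by
    intro A B hA
    have h : Tendsto (fun t : ℝ => A + t * B) (𝓝 0) (𝓝 A) := by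
      have : Continuous (fun t : ℝ => A + t * B) := by fun_prop
      simpa using this.tendsto 0
    exact (h.eventually (lt_mem_nhds hA)).filter_mono nhdsWithin_le_nhds
  have key' : ∀ A B : ℝ, A < 0 → ∀ᶠ t in 𝓝[>] (0 : ℝ), A + t * B < 0 := by
    intro A B hA
    filter_upwards [key (-A) (-B) (by linarith)] with t ht
    linarith
  simp only [rayFilter, eventually_curry_iff, not_lt]
  have hpos : ∀ᶠ t in 𝓝[>] (0 : ℝ), 0 < t := self_mem_nhdsWithin
  rcases lt_trichotomy A 0 with hA | rfl | hA
  · right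
    filter_upwards [key' A B hA] with δ hδ
    filter_upwards [key' _ C hδ] with t ht using ht.le
  · rcases lt_trichotomy B 0 with hB | rfl | hB
    · right
      filter_upwards [hpos] with δ hδ
      filter_upwards [key' (0 + δ * B) C (by nlinarith)] with t ht using ht.le
    · rcases le_or_gt C 0 with hC | hC
      · right
        filter_upwards with δ
        filter_upwards [hpos] with t ht
        nlinarith
      · left
        filter_upwards with δ
        filter_upwards [hpos] with t ht
        simp only [mul_zero, add_zero, zero_add]
        positivity
    · left
      filter_upwards [hpos] with δ hδ
      exact key (0 + δ * B) C (by positivity)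
  · left
    filter_upwards [key A B hA] with δ hδ
    exact key _ _ hδ

/-- `Λ` is a choice of linear pieces of a nonnegative, continuous, piecewise linear map `G`:
`G h = Λ_h h`, the piece is eventually constant along ray germs, and it is locally constant off
finitely many hyperplanes. -/
structure IsPiecewiseLinear {a ℓ : ℕ} (G : Vec a → Vec ℓ) (Λ : Vec a → (Vec a →ₗ[ℝ] Vec ℓ)) :
    Prop where
  apply_self : ∀ h, Λ h h = G h
  cont : Continuous G
  nonneg : ∀ h j, 0 ≤ G h j
  bound : ∃ C : ℝ, ∀ h, ‖G h‖ ≤ C * ‖h‖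
  germ : ∀ z w v : Vec a, ∃ M, ∀ᶠ q in rayFilter, Λ (z + q.1 • w + q.2 • v) = M
  generic : ∃ F : Set (Module.Dual ℝ (Vec a)), F.Finite ∧ (∀ φ ∈ F, φ ≠ 0) ∧
    ∀ y, (∀ φ ∈ F, φ y ≠ 0) → ∃ M, ∀ᶠ y' in 𝓝 y, Λ y' = M

/-! ### Networks are piecewise linear -/

/-- The linear map `v ↦ W v`, with the rows `i ∉ s` of `W` replaced by zero. -/
def maskLayer {a b : ℕ} (W : Matrix (Fin a) (Fin b) ℝ) (s : Set (Fin a)) : Vec b →ₗ[ℝ] Vec a :=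
  open Classical in
  { toFun := fun v => WithLp.toLp 2 fun i => if i ∈ s then W.mulVec v.ofLp i else 0
    map_add' := fun v v' => by
      ext i
      simp only [WithLp.ofLp_add, Matrix.mulVec_add, Pi.add_apply, PiLp.add_apply]
      split_ifs <;> simp
    map_smul' := fun c v => by
      ext i
      simp only [WithLp.ofLp_smul, Matrix.mulVec_smul, Pi.smul_apply, PiLp.smul_apply,
        RingHom.id_apply]
      split_ifs <;> simp }

/-- The linear map `v ↦ 1_{W x > 0} ⊙ (W v)`: the layer `relu(W ·)` linearized at `x`. -/
def selLayer {a b : ℕ} (W : Matrix (Fin a) (Fin b) ℝ) (x : Vec b) : Vec b →ₗ[ℝ] Vec a :=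
  maskLayer W {i | 0 < W.mulVec x.ofLp i}

lemma selLayer_apply {a b : ℕ} (W : Matrix (Fin a) (Fin b) ℝ) (x v : Vec b) (i : Fin a) :
    selLayer W x v i = if 0 < W.mulVec x.ofLp i then W.mulVec v.ofLp i else 0 := by
  simp [selLayer, maskLayer]

lemma layer_apply {a b : ℕ} (W : Matrix (Fin a) (Fin b) ℝ) (x : Vec b) (i : Fin a) :
    layer W x i = max (W.mulVec x.ofLp i) 0 := rfl

lemma selLayer_self {a b : ℕ} (W : Matrix (Fin a) (Fin b) ℝ) (x : Vec b) :
    selLayer W x x = layer W x := by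
  ext i
  rw [selLayer_apply, layer_apply]
  split_ifs with h
  · rw [max_eq_left h.le]
  · rw [max_eq_right (not_lt.1 h)]

lemma finite_range_selLayer {a b : ℕ} (W : Matrix (Fin a) (Fin b) ℝ) :
    (Set.range (selLayer W)).Finite := by
  refine (Set.finite_range (maskLayer W)).subset ?_
  rintro _ ⟨x, rfl⟩
  exact ⟨_, rfl⟩

/-- The first `k` layers linearized at `h`. -/
def selInner (n : ℕ → ℕ) (W : (i : ℕ) → Matrix (Fin (n (i + 1))) (Fin (n i)) ℝ) :
    (k : ℕ) → Vec (n 0) → (Vec (n 0) →ₗ[ℝ] Vec (n k))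
  | 0, _ => LinearMap.id
  | k + 1, h => selLayer (W k) (innerNet n W k h) ∘ₗ selInner n W k h

/-- The network linearized at `h`. -/
def selNet (n : ℕ → ℕ) (d ℓ : ℕ) (W : (i : ℕ) → Matrix (Fin (n (i + 1))) (Fin (n i)) ℝ)
    (L : Matrix (Fin ℓ) (Fin (n (d - 1))) ℝ) (h : Vec (n 0)) : Vec (n 0) →ₗ[ℝ] Vec ℓ :=
  selLayer L (innerNet n W (d - 1) h) ∘ₗ selInner n W (d - 1) h

section Net

variable {n : ℕ → ℕ} {d ℓ : ℕ} (W : (i : ℕ) → Matrix (Fin (n (i + 1))) (Fin (n i)) ℝ)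
  (L : Matrix (Fin ℓ) (Fin (n (d - 1))) ℝ)

lemma selInner_self (k : ℕ) (h : Vec (n 0)) : selInner n W k h h = innerNet n W k h := by
  induction k with
  | zero => rfl
  | succ k ih =>
    rw [selInner, LinearMap.comp_apply, ih, selLayer_self]
    rfl

lemma selNet_self (h : Vec (n 0)) : selNet n d ℓ W L h h = net n d ℓ W L h := by
  rw [selNet, LinearMap.comp_apply, selInner_self, selLayer_self]
  rfl

lemma finite_range_comp_selLayer {a b c : ℕ} (M : Matrix (Fin c) (Fin b) ℝ) (x : Vec a → Vec b)
    {Λ : Vec a → (Vec a →ₗ[ℝ] Vec b)} (h : (Set.range Λ).Finite) :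
    (Set.range fun y => selLayer M (x y) ∘ₗ Λ y).Finite := by
  refine ((finite_range_selLayer M).image2 (fun A B => A ∘ₗ B) h).subset ?_
  rintro _ ⟨y, rfl⟩
  exact ⟨_, ⟨x y, rfl⟩, _, ⟨y, rfl⟩, rfl⟩

lemma finite_range_selInner (k : ℕ) : (Set.range (selInner n W k)).Finite := by
  induction k with
  | zero =>
    refine (Set.finite_singleton LinearMap.id).subset ?_
    rintro _ ⟨y, rfl⟩
    rfl
  | succ k ih => exact finite_range_comp_selLayer (W k) (innerNet n W k) ih

/-- The `i`-th row of `M`, as a linear functional. -/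
def rowDual {a b : ℕ} (M : Matrix (Fin a) (Fin b) ℝ) (i : Fin a) : Module.Dual ℝ (Vec b) :=
  LinearMap.proj i ∘ₗ M.mulVecLin ∘ₗ (WithLp.linearEquiv 2 ℝ (Fin b → ℝ)).toLinearMap

/-- If the signs of the functionals that a layer evaluates are eventually constant along a filter,
then so is the linearization of the layer. -/
lemma eventually_selLayer_eq {α : Type*} {l : Filter α} {a b c : ℕ} {y : α → Vec a}
    {x : Vec a → Vec b} {Λ : Vec a → (Vec a →ₗ[ℝ] Vec b)} (hx : ∀ h, Λ h h = x h)
    (M : Matrix (Fin c) (Fin b) ℝ)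
    (hs : ∀ i, ∀ Λ' ∈ Set.range Λ, (∀ᶠ q in l, 0 < (rowDual M i ∘ₗ Λ') (y q)) ∨
      (∀ᶠ q in l, ¬ 0 < (rowDual M i ∘ₗ Λ') (y q)))
    (h : ∃ N, ∀ᶠ q in l, Λ (y q) = N) :
    ∃ N, ∀ᶠ q in l, selLayer M (x (y q)) ∘ₗ Λ (y q) = N := by
  obtain ⟨N, hN⟩ := h
  by_cases hbot : l = ⊥
  · exact ⟨0, by simp [hbot]⟩
  have : l.NeBot := ⟨hbot⟩
  have hNr : N ∈ Set.range Λ := by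
    obtain ⟨q, hq⟩ := hN.exists
    exact ⟨_, hq⟩
  refine ⟨maskLayer M {i | ∀ᶠ q in l, 0 < (rowDual M i ∘ₗ N) (y q)} ∘ₗ N, ?_⟩
  have hall : ∀ᶠ q in l, ∀ i : Fin c,
      (0 < (rowDual M i ∘ₗ N) (y q) ↔ ∀ᶠ q in l, 0 < (rowDual M i ∘ₗ N) (y q)) := by
    rw [eventually_all]
    intro i
    rcases hs i N hNr with h1 | h1
    · filter_upwards [h1] with q hq
      exact ⟨fun _ => h1, fun _ => hq⟩
    · filter_upwards [h1] with q hq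
      refine ⟨fun h => absurd h hq, fun h2 => ?_⟩
      obtain ⟨q', hq', hq''⟩ := (h1.and h2).exists
      exact absurd hq'' hq'
  filter_upwards [hN, hall] with q hq hq2
  rw [hq, selLayer]
  congr 2
  ext i
  rw [Set.mem_ofPred_eq, Set.mem_ofPred_eq, ← hq2 i, ← hx, hq]
  rfl

/-- The linear functionals whose signs the network with linearizations `selNet` may evaluate. -/
def netDuals : Set (Module.Dual ℝ (Vec (n 0))) :=
  (⋃ k ∈ Set.Iio (d - 1), Set.image2 (fun i Λ => rowDual (W k) i ∘ₗ Λ) Set.univ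
    (Set.range (selInner n W k))) ∪
  Set.image2 (fun i Λ => rowDual L i ∘ₗ Λ) Set.univ (Set.range (selInner n W (d - 1)))

lemma finite_netDuals : (netDuals W L).Finite := by
  refine Set.Finite.union ?_ ?_
  · exact (Set.finite_Iio _).biUnion fun k _ =>
      Set.Finite.image2 _ Set.finite_univ (finite_range_selInner W k)
  · exact Set.Finite.image2 _ Set.finite_univ (finite_range_selInner W _)

lemma eventually_selNet_eq {α : Type*} {l : Filter α} {y : α → Vec (n 0)}
    (hs : ∀ φ ∈ netDuals W L, (∀ᶠ q in l, 0 < φ (y q)) ∨ (∀ᶠ q in l, ¬ 0 < φ (y q))) :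
    ∃ N, ∀ᶠ q in l, selNet n d ℓ W L (y q) = N := by
  have hin : ∀ k ≤ d - 1, ∃ N, ∀ᶠ q in l, selInner n W k (y q) = N := by
    intro k hk
    induction k with
    | zero => exact ⟨LinearMap.id, Eventually.of_forall fun _ => rfl⟩
    | succ k ih =>
      refine eventually_selLayer_eq (selInner_self W k) (W k) (fun i Λ' hΛ' => hs _ (Or.inl ?_))
        (ih (by omega))
      exact Set.mem_biUnion (show k ∈ Set.Iio (d - 1) from hk) ⟨i, trivial, Λ', hΛ', rfl⟩
  exact eventually_selLayer_eq (selInner_self W (d - 1)) L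
    (fun i Λ' hΛ' => hs _ (Or.inr ⟨i, trivial, Λ', hΛ', rfl⟩)) (hin _ le_rfl)

lemma continuous_layer {a b : ℕ} (M : Matrix (Fin a) (Fin b) ℝ) : Continuous (layer M) := by
  refine (PiLp.continuous_toLp 2 _).comp (continuous_pi fun i => ?_)
  have h : Continuous (rowDual M i) := LinearMap.continuous_of_finiteDimensional _
  exact h.max continuous_const

lemma continuous_innerNet (k : ℕ) : Continuous (innerNet n W k) := by
  induction k with
  | zero => exact continuous_id
  | succ k ih => exact (continuous_layer _).comp ih

lemma exists_norm_layer_le {a b : ℕ} (M : Matrix (Fin a) (Fin b) ℝ) :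
    ∃ C : ℝ, 0 ≤ C ∧ ∀ x, ‖layer M x‖ ≤ C * ‖x‖ := by
  refine ⟨‖LinearMap.toContinuousLinearMap (Matrix.toEuclideanLin M)‖, norm_nonneg _,
    fun x => le_trans ?_ (ContinuousLinearMap.le_opNorm _ x)⟩
  rw [← sq_le_sq₀ (norm_nonneg _) (norm_nonneg _), EuclideanSpace.real_norm_sq_eq,
    EuclideanSpace.real_norm_sq_eq]
  refine Finset.sum_le_sum fun i _ => ?_
  rw [layer_apply]
  change max (M.mulVec x.ofLp i) 0 ^ 2 ≤ (M.mulVec x.ofLp i) ^ 2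
  rcases max_cases (M.mulVec x.ofLp i) 0 with ⟨h, _⟩ | ⟨h, _⟩ <;> rw [h]
  rw [zero_pow two_ne_zero]
  positivity

lemma exists_norm_innerNet_le (k : ℕ) :
    ∃ C : ℝ, 0 ≤ C ∧ ∀ x, ‖innerNet n W k x‖ ≤ C * ‖x‖ := by
  induction k with
  | zero => exact ⟨1, zero_le_one, fun x => by simp [innerNet]⟩
  | succ k ih =>
    obtain ⟨C, hC, h⟩ := ih
    obtain ⟨C', hC', h'⟩ := exists_norm_layer_le (W k)
    refine ⟨C' * C, by positivity, fun x => (h' _).trans ?_⟩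
    rw [mul_assoc]
    exact mul_le_mul_of_nonneg_left (h x) hC'

lemma isPiecewiseLinear_net :
    IsPiecewiseLinear (net n d ℓ W L) (selNet n d ℓ W L) where
  apply_self := selNet_self W L
  cont := (continuous_layer _).comp (continuous_innerNet W _)
  nonneg := fun _ _ => le_max_right _ _
  bound := by
    obtain ⟨C, _, h⟩ := exists_norm_innerNet_le W (d - 1)
    obtain ⟨C', hC', h'⟩ := exists_norm_layer_le L
    refine ⟨C' * C, fun x => (h' _).trans ?_⟩
    rw [mul_assoc]
    exact mul_le_mul_of_nonneg_left (h x) hC'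
  germ := fun z w v => by
    refine eventually_selNet_eq W L (y := fun q : ℝ × ℝ => z + q.1 • w + q.2 • v) fun φ _ => ?_
    simpa using eventually_sign_ray (φ z) (φ w) (φ v)
  generic := by
    refine ⟨netDuals W L \ {0}, (finite_netDuals W L).sdiff, fun φ hφ => hφ.2, fun y hy => ?_⟩
    refine eventually_selNet_eq W L (y := id) fun φ hφ => ?_
    by_cases h0 : φ = 0
    · right
      simp [h0]
    have hc : Continuous φ := LinearMap.continuous_of_finiteDimensional _
    rcases lt_or_gt_of_ne (hy φ ⟨hφ, h0⟩) with h | h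
    · right
      filter_upwards [hc.continuousAt.eventually (gt_mem_nhds h)] with y' hy'
      exact not_lt.2 (le_of_lt hy')
    · left
      exact hc.continuousAt.eventually (lt_mem_nhds h)

end Net

/-! ### One-sided derivatives of the risk -/

section Risk

variable {a b ℓ : ℕ}

/-- The derivative at `z` in the direction `v` of the risk in which the networks are replaced by the
linear maps `M₁` and `M₂`, and the observation is `y₀`. -/
def riskDeriv (M₁ : Vec a →ₗ[ℝ] Vec ℓ) (M₂ : Vec b →ₗ[ℝ] Vec ℓ) (y₀ : Fin ℓ → ℝ)
    (z v : Vec a × Vec b) : ℝ :=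
  ∑ j, (M₁ v.1 j * M₂ z.2 j + M₁ z.1 j * M₂ v.2 j) * (M₁ z.1 j * M₂ z.2 j - y₀ j)

lemma risk_eq (G₁ : Vec a → Vec ℓ) (G₂ : Vec b → Vec ℓ) (h₀ : Vec a) (m₀ : Vec b)
    (z : Vec a × Vec b) :
    risk G₁ G₂ h₀ m₀ z = 1 / 2 * ∑ j, (G₁ h₀ j * G₂ m₀ j - G₁ z.1 j * G₂ z.2 j) ^ 2 := by
  rw [risk, EuclideanSpace.real_norm_sq_eq]

lemma continuous_apply_linear {c : ℕ} (M : Vec c →ₗ[ℝ] Vec ℓ) (j : Fin ℓ) :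
    Continuous fun x => M x j := by
  have h : Continuous M := LinearMap.continuous_of_finiteDimensional _
  exact (EuclideanSpace.proj (𝕜 := ℝ) j).continuous.comp h

lemma differentiable_apply_linear {c : ℕ} (M : Vec c →ₗ[ℝ] Vec ℓ) (j : Fin ℓ) :
    Differentiable ℝ fun x => M x j :=
  ((EuclideanSpace.proj (𝕜 := ℝ) j).comp (LinearMap.toContinuousLinearMap M)).differentiable

lemma continuous_riskDeriv (M₁ : Vec a →ₗ[ℝ] Vec ℓ) (M₂ : Vec b →ₗ[ℝ] Vec ℓ) (y₀ : Fin ℓ → ℝ)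
    (v : Vec a × Vec b) : Continuous fun z => riskDeriv M₁ M₂ y₀ z v := by
  unfold riskDeriv
  have h1 := fun j => (continuous_apply_linear M₁ j).comp (continuous_fst (X := Vec a) (Y := Vec b))
  have h2 := fun j => (continuous_apply_linear M₂ j).comp (continuous_snd (X := Vec a) (Y := Vec b))
  simp only [Function.comp_def] at h1 h2
  fun_prop

variable {G₁ : Vec a → Vec ℓ} {G₂ : Vec b → Vec ℓ} {Λ₁ : Vec a → (Vec a →ₗ[ℝ] Vec ℓ)}
  {Λ₂ : Vec b → (Vec b →ₗ[ℝ] Vec ℓ)}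

/-- A piecewise linear map agrees with the linear piece of a ray at the start of the ray. -/
lemma IsPiecewiseLinear.eq_of_eventually {c : ℕ} {G : Vec c → Vec ℓ}
    {Λ : Vec c → (Vec c →ₗ[ℝ] Vec ℓ)} (hG : IsPiecewiseLinear G Λ) {z v : Vec c}
    {M : Vec c →ₗ[ℝ] Vec ℓ} (h : ∀ᶠ t : ℝ in 𝓝[>] 0, Λ (z + t • v) = M) : G z = M z := by
  have ht : Tendsto (fun t : ℝ => z + t • v) (𝓝[>] 0) (𝓝 z) := by
    have : Continuous (fun t : ℝ => z + t • v) := by fun_prop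
    simpa using (this.tendsto 0).mono_left nhdsWithin_le_nhds
  have hM : Continuous M := LinearMap.continuous_of_finiteDimensional _
  refine tendsto_nhds_unique ((hG.cont.tendsto z).comp ht)
    (((hM.tendsto z).comp ht).congr' ?_)
  filter_upwards [h] with t ht
  simp only [Function.comp_apply]
  rw [← hG.apply_self, ht]

lemma hasOneSidedDeriv_risk (hG₁ : IsPiecewiseLinear G₁ Λ₁) (hG₂ : IsPiecewiseLinear G₂ Λ₂)
    (h₀ : Vec a) (m₀ : Vec b) {z v : Vec a × Vec b} {M₁ : Vec a →ₗ[ℝ] Vec ℓ}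
    {M₂ : Vec b →ₗ[ℝ] Vec ℓ} (h1 : ∀ᶠ t : ℝ in 𝓝[>] 0, Λ₁ (z.1 + t • v.1) = M₁)
    (h2 : ∀ᶠ t : ℝ in 𝓝[>] 0, Λ₂ (z.2 + t • v.2) = M₂) :
    HasOneSidedDeriv (risk G₁ G₂ h₀ m₀) z v
      (riskDeriv M₁ M₂ (fun j => G₁ h₀ j * G₂ m₀ j) z v) := by
  set y₀ : Fin ℓ → ℝ := fun j => G₁ h₀ j * G₂ m₀ j with hy₀
  have e1 := hG₁.eq_of_eventually h1
  have e2 := hG₂.eq_of_eventually h2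
  have hd : HasDerivAt (fun t : ℝ => 1 / 2 * ∑ j, (y₀ j - (M₁ z.1 j + t * M₁ v.1 j) *
      (M₂ z.2 j + t * M₂ v.2 j)) ^ 2) (riskDeriv M₁ M₂ y₀ z v) 0 := by
    have hj : ∀ j ∈ Finset.univ, HasDerivAt (fun t : ℝ => (y₀ j - (M₁ z.1 j + t * M₁ v.1 j) *
        (M₂ z.2 j + t * M₂ v.2 j)) ^ 2) (2 * ((M₁ v.1 j * M₂ z.2 j + M₁ z.1 j * M₂ v.2 j) *
          (M₁ z.1 j * M₂ z.2 j - y₀ j))) 0 := by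
      intro j _
      have a1 : HasDerivAt (fun t : ℝ => M₁ z.1 j + t * M₁ v.1 j) (1 * M₁ v.1 j) 0 :=
        ((hasDerivAt_id (0 : ℝ)).mul_const _).const_add _
      have a2 : HasDerivAt (fun t : ℝ => M₂ z.2 j + t * M₂ v.2 j) (1 * M₂ v.2 j) 0 :=
        ((hasDerivAt_id (0 : ℝ)).mul_const _).const_add _
      refine (((a1.mul a2).const_sub (y₀ j)).pow 2).congr_deriv ?_
      simp
      ring
    have hsum := HasDerivAt.fun_sum hj
    refine (hsum.const_mul (1 / 2 : ℝ)).congr_deriv ?_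
    rw [riskDeriv, ← Finset.mul_sum]
    ring
  refine hd.tendsto_slope_zero_right.congr' ?_
  filter_upwards [h1, h2] with t ht1 ht2
  rw [risk_eq, risk_eq, e1, e2, smul_eq_mul]
  have b1 : G₁ (z + t • v).1 = M₁ z.1 + t • M₁ v.1 := by
    rw [← hG₁.apply_self, Prod.fst_add, Prod.smul_fst, ht1, map_add, map_smul]
  have b2 : G₂ (z + t • v).2 = M₂ z.2 + t • M₂ v.2 := by
    rw [← hG₂.apply_self, Prod.snd_add, Prod.smul_snd, ht2, map_add, map_smul]
  simp only [zero_add, zero_mul, add_zero, b1, b2, PiLp.add_apply, PiLp.smul_apply, smul_eq_mul,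
    hy₀]
  ring

lemma exists_germ (hG₁ : IsPiecewiseLinear G₁ Λ₁) (hG₂ : IsPiecewiseLinear G₂ Λ₂)
    (z w v : Vec a × Vec b) : ∃ M₁ M₂, ∀ᶠ q in rayFilter,
      Λ₁ (z + q.1 • w + q.2 • v).1 = M₁ ∧ Λ₂ (z + q.1 • w + q.2 • v).2 = M₂ := by
  obtain ⟨M₁, h1⟩ := hG₁.germ z.1 w.1 v.1
  obtain ⟨M₂, h2⟩ := hG₂.germ z.2 w.2 v.2
  exact ⟨M₁, M₂, h1.and h2⟩

lemma eventually_hasOneSidedDeriv_risk (hG₁ : IsPiecewiseLinear G₁ Λ₁)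
    (hG₂ : IsPiecewiseLinear G₂ Λ₂) (h₀ : Vec a) (m₀ : Vec b) {z w v : Vec a × Vec b}
    {M₁ : Vec a →ₗ[ℝ] Vec ℓ} {M₂ : Vec b →ₗ[ℝ] Vec ℓ} (h : ∀ᶠ q in rayFilter,
      Λ₁ (z + q.1 • w + q.2 • v).1 = M₁ ∧ Λ₂ (z + q.1 • w + q.2 • v).2 = M₂) :
    ∀ᶠ δ : ℝ in 𝓝[>] 0, HasOneSidedDeriv (risk G₁ G₂ h₀ m₀) (z + δ • w) v
      (riskDeriv M₁ M₂ (fun j => G₁ h₀ j * G₂ m₀ j) (z + δ • w) v) := by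
  rw [rayFilter, eventually_curry_iff] at h
  filter_upwards [h] with δ hδ
  exact hasOneSidedDeriv_risk hG₁ hG₂ h₀ m₀ (hδ.mono fun _ h => h.1) (hδ.mono fun _ h => h.2)

/-- At `z` itself, the derivative in the direction `v`, with the linear pieces of the germ that
starts in the direction `v`. -/
lemma exists_germ_hasOneSidedDeriv (hG₁ : IsPiecewiseLinear G₁ Λ₁)
    (hG₂ : IsPiecewiseLinear G₂ Λ₂) (h₀ : Vec a) (m₀ : Vec b) (z v : Vec a × Vec b) :
    ∃ M₁ M₂, (∀ᶠ q in rayFilter,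
        Λ₁ (z + q.1 • v + q.2 • (0 : Vec a × Vec b)).1 = M₁ ∧
        Λ₂ (z + q.1 • v + q.2 • (0 : Vec a × Vec b)).2 = M₂) ∧
      M₁ z.1 = G₁ z.1 ∧ M₂ z.2 = G₂ z.2 ∧
      (∀ᶠ t : ℝ in 𝓝[>] 0, G₁ (z.1 + t • v.1) = M₁ (z.1 + t • v.1) ∧
        G₂ (z.2 + t • v.2) = M₂ (z.2 + t • v.2)) ∧
      HasOneSidedDeriv (risk G₁ G₂ h₀ m₀) z v
        (riskDeriv M₁ M₂ (fun j => G₁ h₀ j * G₂ m₀ j) z v) := by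
  obtain ⟨M₁, M₂, h⟩ := exists_germ hG₁ hG₂ z v 0
  have h' := h
  rw [rayFilter, eventually_curry_iff] at h'
  have h1 : ∀ᶠ t : ℝ in 𝓝[>] 0, Λ₁ (z.1 + t • v.1) = M₁ := by
    filter_upwards [h'] with t ht
    obtain ⟨s, hs⟩ := ht.exists
    simpa using hs.1
  have h2 : ∀ᶠ t : ℝ in 𝓝[>] 0, Λ₂ (z.2 + t • v.2) = M₂ := by
    filter_upwards [h'] with t ht
    obtain ⟨s, hs⟩ := ht.exists
    simpa using hs.2
  refine ⟨M₁, M₂, h, (hG₁.eq_of_eventually h1).symm, (hG₂.eq_of_eventually h2).symm, ?_,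
    hasOneSidedDeriv_risk hG₁ hG₂ h₀ m₀ h1 h2⟩
  filter_upwards [h1, h2] with t ht1 ht2
  rw [← hG₁.apply_self, ← hG₂.apply_self, ht1, ht2]
  exact ⟨rfl, rfl⟩

/-- A direction off finitely many hyperplanes is admissible at every point. -/
lemma exists_differentiableAlong_risk (hG₁ : IsPiecewiseLinear G₁ Λ₁)
    (hG₂ : IsPiecewiseLinear G₂ Λ₂) (h₀ : Vec a) (m₀ : Vec b) :
    ∃ w, ∀ z, DifferentiableAlong (risk G₁ G₂ h₀ m₀) z w := by
  have gen : ∀ {c : ℕ} {G : Vec c → Vec ℓ} {Λ : Vec c → (Vec c →ₗ[ℝ] Vec ℓ)},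
      IsPiecewiseLinear G Λ → ∃ w : Vec c, ∀ z, ∀ᶠ δ : ℝ in 𝓝[>] 0,
        ∃ M : Vec c →ₗ[ℝ] Vec ℓ, ∀ᶠ y in 𝓝 (z + δ • w), G y = M y := by
    intro c G Λ hG
    obtain ⟨F, hF, hF0, hFM⟩ := hG.generic
    have := hF.to_subtype
    obtain ⟨w, hw⟩ := Module.Dual.exists_forall_ne_zero_of_forall_exists
      (fun φ : F => (φ : Module.Dual ℝ (Vec c))) (fun φ => by
        by_contra! h
        exact hF0 φ φ.2 (LinearMap.ext h))
    refine ⟨w, fun z => ?_⟩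
    have hall : ∀ᶠ δ : ℝ in 𝓝[>] 0, ∀ φ : F, (φ : Module.Dual ℝ (Vec c)) (z + δ • w) ≠ 0 := by
      rw [eventually_all]
      intro φ
      have hne := hw φ
      -- an affine function with nonzero slope has at most one zero
      have h1 : ∀ᶠ δ : ℝ in 𝓝[≠] 0, (φ : Module.Dual ℝ (Vec c)) (z + δ • w) ≠ 0 := by
        simp only [map_add, map_smul, smul_eq_mul]
        by_cases hz : (φ : Module.Dual ℝ (Vec c)) z = 0
        · filter_upwards [self_mem_nhdsWithin] with δ hδ
          rw [hz, zero_add]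
          exact mul_ne_zero hδ hne
        · have hc : Continuous fun δ : ℝ => (φ : Module.Dual ℝ (Vec c)) z +
            δ * (φ : Module.Dual ℝ (Vec c)) w := by fun_prop
          have := hc.tendsto 0
          simp only [zero_mul, add_zero] at this
          exact (this.eventually_ne hz).filter_mono nhdsWithin_le_nhds
      exact h1.filter_mono (nhdsWithin_mono _ fun x hx => ne_of_gt hx)
    filter_upwards [hall] with δ hδ
    obtain ⟨M, hM⟩ := hFM _ fun φ hφ => hδ ⟨φ, hφ⟩
    exact ⟨M, hM.mono fun y hy => by rw [← hG.apply_self, hy]⟩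
  obtain ⟨w₁, hw₁⟩ := gen hG₁
  obtain ⟨w₂, hw₂⟩ := gen hG₂
  refine ⟨(w₁, w₂), fun z => ?_⟩
  filter_upwards [hw₁ z.1, hw₂ z.2] with δ ⟨M₁, h1⟩ ⟨M₂, h2⟩
  have hd : Differentiable ℝ fun y : Vec a × Vec b =>
      1 / 2 * ∑ j, (G₁ h₀ j * G₂ m₀ j - M₁ y.1 j * M₂ y.2 j) ^ 2 := by
    have h1 := fun j => (differentiable_apply_linear M₁ j).comp
      (differentiable_fst (𝕜 := ℝ) (E := Vec a) (F := Vec b))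
    have h2 := fun j => (differentiable_apply_linear M₂ j).comp
      (differentiable_snd (𝕜 := ℝ) (E := Vec a) (F := Vec b))
    simp only [Function.comp_def] at h1 h2
    fun_prop
  refine (hd _).congr_of_eventuallyEq ?_
  have e1 : ∀ᶠ y : Vec a × Vec b in 𝓝 (z + δ • (w₁, w₂)), G₁ y.1 = M₁ y.1 :=
    (continuous_fst.tendsto (z + δ • (w₁, w₂))).eventually h1
  have e2 : ∀ᶠ y : Vec a × Vec b in 𝓝 (z + δ • (w₁, w₂)), G₂ y.2 = M₂ y.2 :=
    (continuous_snd.tendsto (z + δ • (w₁, w₂))).eventually h2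
  filter_upwards [e1, e2] with y hy1 hy2
  rw [risk_eq, hy1, hy2]

lemma HasOneSidedDeriv.eq_fderiv {f : Vec a × Vec b → ℝ} {z v : Vec a × Vec b} {D : ℝ}
    (h : HasOneSidedDeriv f z v D) (hf : DifferentiableAt ℝ f z) : fderiv ℝ f z v = D := by
  have h1 : HasDerivAt (fun t : ℝ => f (z + t • v)) (fderiv ℝ f z v) 0 := by
    have h2 : HasDerivAt (fun t : ℝ => z + t • v) v 0 := by
      simpa using ((hasDerivAt_id (0 : ℝ)).smul_const v).const_add z
    have h3 : HasFDerivAt f (fderiv ℝ f z) (z + (0 : ℝ) • v) := by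
      simpa using hf.hasFDerivAt
    exact h3.comp_hasDerivAt 0 h2
  refine tendsto_nhds_unique (h1.tendsto_slope_zero_right.congr fun t => ?_) h
  simp [div_eq_inv_mul]

lemma inner_grad₁ {f : Vec a × Vec b → ℝ} {z : Vec a × Vec b} (hf : DifferentiableAt ℝ f z)
    (x : Vec a) : ⟪grad₁ f z, x⟫ = fderiv ℝ f z (x, 0) := by
  rw [grad₁, inner_gradient_left]
  have h1 : HasFDerivAt (fun h : Vec a => (h, z.2)) (ContinuousLinearMap.inl ℝ (Vec a) (Vec b))
      z.1 := hasFDerivAt_prodMk_left _ _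
  have h2 : HasFDerivAt f (fderiv ℝ f z) (z.1, z.2) := hf.hasFDerivAt
  have h3 := (h2.comp z.1 h1).fderiv
  change fderiv ℝ (f ∘ fun h => (h, z.2)) z.1 x = _
  rw [h3]
  simp

lemma inner_grad₂ {f : Vec a × Vec b → ℝ} {z : Vec a × Vec b} (hf : DifferentiableAt ℝ f z)
    (x : Vec b) : ⟪grad₂ f z, x⟫ = fderiv ℝ f z (0, x) := by
  rw [grad₂, inner_gradient_left]
  have h1 : HasFDerivAt (fun m : Vec b => (z.1, m)) (ContinuousLinearMap.inr ℝ (Vec a) (Vec b))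
      z.2 := hasFDerivAt_prodMk_right _ _
  have h2 : HasFDerivAt f (fderiv ℝ f z) (z.1, z.2) := hf.hasFDerivAt
  have h3 := (h2.comp z.2 h1).fderiv
  change fderiv ℝ (f ∘ fun m => (z.1, m)) z.2 x = _
  rw [h3]
  simp

/-- Let `γ δ` be the gradient of the risk at `z + δ w` along a subspace of directions, embedded by
`ι`. It converges as `δ → 0⁺`, and the limit pairs with a direction `x` as the derivative for the
linear pieces of a ray germ. -/
lemma exists_tendsto_grad (hG₁ : IsPiecewiseLinear G₁ Λ₁) (hG₂ : IsPiecewiseLinear G₂ Λ₂)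
    (h₀ : Vec a) (m₀ : Vec b) {c : ℕ} (ι : Vec c → Vec a × Vec b) {z w : Vec a × Vec b}
    (hw : DifferentiableAlong (risk G₁ G₂ h₀ m₀) z w) (γ : ℝ → Vec c)
    (hγ : ∀ δ, DifferentiableAt ℝ (risk G₁ G₂ h₀ m₀) (z + δ • w) →
      ∀ x, ⟪γ δ, x⟫ = fderiv ℝ (risk G₁ G₂ h₀ m₀) (z + δ • w) (ι x)) :
    ∃ v, Tendsto γ (𝓝[>] 0) (𝓝 v) ∧ ∀ x, ∃ M₁ M₂, (∀ᶠ q in rayFilter,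
      Λ₁ (z + q.1 • w + q.2 • ι x).1 = M₁ ∧ Λ₂ (z + q.1 • w + q.2 • ι x).2 = M₂) ∧
      ⟪v, x⟫ = riskDeriv M₁ M₂ (fun j => G₁ h₀ j * G₂ m₀ j) z (ι x) := by
  have key : ∀ x, ∃ M₁ M₂, (∀ᶠ q in rayFilter,
      Λ₁ (z + q.1 • w + q.2 • ι x).1 = M₁ ∧ Λ₂ (z + q.1 • w + q.2 • ι x).2 = M₂) ∧
      Tendsto (fun δ => ⟪γ δ, x⟫) (𝓝[>] 0)
        (𝓝 (riskDeriv M₁ M₂ (fun j => G₁ h₀ j * G₂ m₀ j) z (ι x))) := by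
    intro x
    obtain ⟨M₁, M₂, h⟩ := exists_germ hG₁ hG₂ z w (ι x)
    refine ⟨M₁, M₂, h, ?_⟩
    have ht : Tendsto (fun δ : ℝ => z + δ • w) (𝓝[>] 0) (𝓝 z) := by
      have : Continuous (fun δ : ℝ => z + δ • w) := by fun_prop
      simpa using (this.tendsto 0).mono_left nhdsWithin_le_nhds
    refine (((continuous_riskDeriv M₁ M₂ _ (ι x)).tendsto z).comp ht).congr' ?_
    filter_upwards [hw, eventually_hasOneSidedDeriv_risk hG₁ hG₂ h₀ m₀ h] with δ hδ hδ2
    rw [hγ δ hδ, hδ2.eq_fderiv hδ]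
    rfl
  choose M₁ M₂ hM ht using key
  set v : Vec c := WithLp.toLp 2 fun j => riskDeriv (M₁ (EuclideanSpace.single j 1))
    (M₂ (EuclideanSpace.single j 1)) (fun j => G₁ h₀ j * G₂ m₀ j) z (ι (EuclideanSpace.single j 1))
    with hv
  have hlim : Tendsto γ (𝓝[>] 0) (𝓝 v) := by
    have h1 : Tendsto (fun δ => (γ δ).ofLp) (𝓝[>] 0) (𝓝 v.ofLp) := by
      rw [tendsto_pi_nhds]
      intro j
      have := ht (EuclideanSpace.single j 1)
      simpa [EuclideanSpace.inner_single_right] using this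
    exact ((PiLp.continuous_toLp 2 _).tendsto v.ofLp).comp h1
  refine ⟨v, hlim, fun x => ⟨M₁ x, M₂ x, hM x, ?_⟩⟩
  have h1 : Tendsto (fun δ => ⟪γ δ, x⟫) (𝓝[>] 0) (𝓝 ⟪v, x⟫) := hlim.inner tendsto_const_nhds
  exact tendsto_nhds_unique h1 (ht x)

/-- A bound on `riskDeriv` that holds for the linear pieces at nearby points passes to the linear
pieces of ray germs. -/
lemma abs_riskDeriv_sub_le_of_germ {c : ℕ} {ι : Vec c → Vec a × Vec b} {y₀ : Fin ℓ → ℝ}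
    {T : Vec a × Vec b → Vec c} {r : Vec a × Vec b → ℝ} {z w v : Vec a × Vec b} {x : Vec c}
    (hT : ContinuousAt T z) (hr : ContinuousAt r z)
    (hb : ∀ᶠ y in 𝓝 z, |riskDeriv (Λ₁ y.1) (Λ₂ y.2) y₀ y (ι x) - ⟪T y, x⟫| ≤ r y * ‖x‖)
    {M₁ : Vec a →ₗ[ℝ] Vec ℓ} {M₂ : Vec b →ₗ[ℝ] Vec ℓ} (h : ∀ᶠ q in rayFilter,
      Λ₁ (z + q.1 • w + q.2 • v).1 = M₁ ∧ Λ₂ (z + q.1 • w + q.2 • v).2 = M₂) :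
    |riskDeriv M₁ M₂ y₀ z (ι x) - ⟪T z, x⟫| ≤ r z * ‖x‖ := by
  have ht := tendsto_ray z w v
  have h1 : Tendsto (fun q : ℝ × ℝ => |riskDeriv M₁ M₂ y₀ (z + q.1 • w + q.2 • v) (ι x)
      - ⟪T (z + q.1 • w + q.2 • v), x⟫|) rayFilter (𝓝 |riskDeriv M₁ M₂ y₀ z (ι x) - ⟪T z, x⟫|) := by
    refine Tendsto.abs (Tendsto.sub ?_ ?_)
    · exact ((continuous_riskDeriv M₁ M₂ y₀ (ι x)).tendsto z).comp ht
    · exact (hT.tendsto.comp ht).inner tendsto_const_nhds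
  have h2 : Tendsto (fun q : ℝ × ℝ => r (z + q.1 • w + q.2 • v) * ‖x‖) rayFilter
      (𝓝 (r z * ‖x‖)) := (hr.tendsto.comp ht).mul_const _
  refine le_of_tendsto_of_tendsto h1 h2 ?_
  filter_upwards [h, ht.eventually hb] with q hq hq2
  rwa [hq.1, hq.2] at hq2

/-- If the derivatives of the risk near `z` in the directions `ι x` are within `r ‖x‖` of `⟪T, x⟫`,
and `T` dominates `r`, then the limit of the gradients along `w` is a strict ascent direction. -/
lemma exists_descent (hG₁ : IsPiecewiseLinear G₁ Λ₁) (hG₂ : IsPiecewiseLinear G₂ Λ₂)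
    (h₀ : Vec a) (m₀ : Vec b) {c : ℕ} {ι : Vec c → Vec a × Vec b}
    {T : Vec a × Vec b → Vec c} {r : Vec a × Vec b → ℝ} {z w : Vec a × Vec b}
    (hT : ContinuousAt T z) (hr : ContinuousAt r z)
    (hb : ∀ᶠ y in 𝓝 z, ∀ x, |riskDeriv (Λ₁ y.1) (Λ₂ y.2) (fun j => G₁ h₀ j * G₂ m₀ j) y (ι x)
      - ⟪T y, x⟫| ≤ r y * ‖x‖) (hr0 : 0 < r z) (hTr : 3 * r z ≤ ‖T z‖) {v : Vec c}
    (hv : ∀ x, ∃ M₁ M₂, (∀ᶠ q in rayFilter,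
      Λ₁ (z + q.1 • w + q.2 • ι x).1 = M₁ ∧ Λ₂ (z + q.1 • w + q.2 • ι x).2 = M₂) ∧
      ⟪v, x⟫ = riskDeriv M₁ M₂ (fun j => G₁ h₀ j * G₂ m₀ j) z (ι x)) :
    ∃ D < 0, HasOneSidedDeriv (risk G₁ G₂ h₀ m₀) z (ι (-v)) D := by
  obtain ⟨M₁, M₂, hM, -, -, -, hD⟩ :=
    exists_germ_hasOneSidedDeriv hG₁ hG₂ h₀ m₀ z (ι (-v))
  refine ⟨_, ?_, hD⟩
  have b1 := abs_riskDeriv_sub_le_of_germ hT hr (hb.mono fun y hy => hy (-v)) hM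
  have b2 : ‖v - T z‖ ≤ r z := by
    obtain ⟨N₁, N₂, hN, hNe⟩ := hv (v - T z)
    have b3 := abs_riskDeriv_sub_le_of_germ hT hr (hb.mono fun y hy => hy (v - T z)) hN
    rw [← hNe, ← inner_sub_left, real_inner_self_eq_norm_sq,
      abs_of_nonneg (by positivity)] at b3
    by_contra! hlt
    nlinarith
  have b4 : ‖v‖ ≤ ‖T z‖ + r z := by
    have : v = T z + (v - T z) := by abel
    calc ‖v‖ = ‖T z + (v - T z)‖ := by rw [← this]
      _ ≤ ‖T z‖ + ‖v - T z‖ := norm_add_le _ _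
      _ ≤ _ := by linarith
  have b5 : ‖T z‖ ^ 2 - r z * ‖T z‖ ≤ ⟪T z, v⟫ := by
    have e : ⟪T z, v⟫ = ‖T z‖ ^ 2 + ⟪T z, v - T z⟫ := by
      rw [inner_sub_right, real_inner_self_eq_norm_sq]
      ring
    have := abs_le.1 (abs_real_inner_le_norm (T z) (v - T z))
    have h2 : ‖T z‖ * ‖v - T z‖ ≤ ‖T z‖ * r z := by gcongr
    rw [e]
    linarith [this.1]
  rw [inner_neg_right, norm_neg] at b1
  have b6 := (abs_le.1 b1).2
  nlinarith

/-- The derivatives of the risk on the axes are nonpositive. -/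
lemma exists_hasOneSidedDeriv_nonpos (hG₁ : IsPiecewiseLinear G₁ Λ₁)
    (hG₂ : IsPiecewiseLinear G₂ Λ₂) (h₀ : Vec a) (m₀ : Vec b) {z : Vec a × Vec b}
    (hz : z ∈ axes a b) (v : Vec a × Vec b) :
    ∃ D ≤ 0, HasOneSidedDeriv (risk G₁ G₂ h₀ m₀) z v D := by
  obtain ⟨M₁, M₂, -, e1, e2, hev, hD⟩ := exists_germ_hasOneSidedDeriv hG₁ hG₂ h₀ m₀ z v
  refine ⟨_, ?_, hD⟩
  have hpos : ∀ᶠ t : ℝ in 𝓝[>] 0, 0 < t := self_mem_nhdsWithin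
  obtain ⟨t, ⟨ht1, ht2⟩, ht⟩ := (hev.and hpos).exists
  refine Finset.sum_nonpos fun j _ => ?_
  have hy : 0 ≤ G₁ h₀ j * G₂ m₀ j := mul_nonneg (hG₁.nonneg _ _) (hG₂.nonneg _ _)
  rcases hz with hz | hz
  · have hz2 : z.2 = 0 := hz
    have h3 : 0 ≤ M₂ v.2 j := by
      have h4 := hG₂.nonneg (z.2 + t • v.2) j
      rw [ht2, hz2, zero_add, map_smul] at h4
      exact nonneg_of_mul_nonneg_right h4 ht
    have h5 : 0 ≤ M₁ z.1 j := by rw [e1]; exact hG₁.nonneg _ _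
    have h6 := mul_nonneg h5 h3
    rw [hz2, map_zero]
    simp only [PiLp.zero_apply, mul_zero, zero_add, zero_sub]
    nlinarith
  · have hz2 : z.1 = 0 := hz
    have h3 : 0 ≤ M₁ v.1 j := by
      have h4 := hG₁.nonneg (z.1 + t • v.1) j
      rw [ht1, hz2, zero_add, map_smul] at h4
      exact nonneg_of_mul_nonneg_right h4 ht
    have h5 : 0 ≤ M₂ z.2 j := by rw [e2]; exact hG₂.nonneg _ _
    have h6 := mul_nonneg h3 h5
    rw [hz2, map_zero]
    simp only [PiLp.zero_apply, zero_mul, add_zero, zero_sub]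
    nlinarith

/-- If the observation correlates with all outputs, the points of the axes are local maximizers:
near the axes the quadratic term of the risk is dominated by the correlation. -/
lemma isLocalMax_risk (hG₁ : IsPiecewiseLinear G₁ Λ₁) (hG₂ : IsPiecewiseLinear G₂ Λ₂)
    (h₀ : Vec a) (m₀ : Vec b) {α : ℝ} (hα : 0 < α)
    (hc : ∀ h m, α * (‖h‖ * ‖m‖) ≤ ∑ j, (G₁ h₀ j * G₂ m₀ j) * (G₁ h j * G₂ m j))
    {z : Vec a × Vec b} (hz : z ∈ axes a b) : IsLocalMax (risk G₁ G₂ h₀ m₀) z := by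
  obtain ⟨C₁, hC₁⟩ := hG₁.bound
  obtain ⟨C₂, hC₂⟩ := hG₂.bound
  have e1 : ∀ y : Vec a × Vec b, ∑ j, (G₁ y.1 j * G₂ y.2 j) ^ 2
      ≤ (C₁ * C₂ * (‖y.1‖ * ‖y.2‖)) ^ 2 := by
    intro y
    have h1 : ∀ j ∈ Finset.univ, (G₁ y.1 j * G₂ y.2 j) ^ 2 ≤ ‖G₁ y.1‖ ^ 2 * G₂ y.2 j ^ 2 := by
      intro j _
      rw [mul_pow]
      refine mul_le_mul_of_nonneg_right ?_ (sq_nonneg _)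
      rw [EuclideanSpace.real_norm_sq_eq]
      exact Finset.single_le_sum (f := fun j => G₁ y.1 j ^ 2) (fun i _ => sq_nonneg _)
        (Finset.mem_univ j)
    refine (Finset.sum_le_sum h1).trans ?_
    rw [← Finset.mul_sum, ← EuclideanSpace.real_norm_sq_eq]
    have h2 := pow_le_pow_left₀ (norm_nonneg _) (hC₁ y.1) 2
    have h3 := pow_le_pow_left₀ (norm_nonneg _) (hC₂ y.2) 2
    calc ‖G₁ y.1‖ ^ 2 * ‖G₂ y.2‖ ^ 2 ≤ (C₁ * ‖y.1‖) ^ 2 * (C₂ * ‖y.2‖) ^ 2 := by gcongr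
      _ = _ := by ring
  have hz0 : ‖z.1‖ * ‖z.2‖ = 0 := by
    rcases hz with hz | hz
    · have : z.2 = 0 := hz
      simp [this]
    · have : z.1 = 0 := hz
      simp [this]
  have hcont : Continuous fun y : Vec a × Vec b => (C₁ * C₂) ^ 2 * (‖y.1‖ * ‖y.2‖) := by fun_prop
  have hlt : ∀ᶠ y in 𝓝 z, (C₁ * C₂) ^ 2 * (‖y.1‖ * ‖y.2‖) < α := by
    refine hcont.continuousAt.eventually (gt_mem_nhds ?_)
    change (C₁ * C₂) ^ 2 * (‖z.1‖ * ‖z.2‖) < α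
    rw [hz0, mul_zero]
    exact hα
  filter_upwards [hlt] with y hy
  have hsplit : ∀ y : Vec a × Vec b, risk G₁ G₂ h₀ m₀ y
      = 1 / 2 * ∑ j, (G₁ h₀ j * G₂ m₀ j) ^ 2
        - ∑ j, (G₁ h₀ j * G₂ m₀ j) * (G₁ y.1 j * G₂ y.2 j)
        + 1 / 2 * ∑ j, (G₁ y.1 j * G₂ y.2 j) ^ 2 := by
    intro y
    rw [risk_eq, Finset.mul_sum, Finset.mul_sum, Finset.mul_sum, ← Finset.sum_sub_distrib,
      ← Finset.sum_add_distrib]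
    exact Finset.sum_congr rfl fun j _ => by ring
  have hzv : risk G₁ G₂ h₀ m₀ z = 1 / 2 * ∑ j, (G₁ h₀ j * G₂ m₀ j) ^ 2 := by
    have h1 := e1 z
    rw [hz0, mul_zero, zero_pow two_ne_zero] at h1
    have h2 := (Finset.sum_eq_zero_iff_of_nonneg (fun j _ => sq_nonneg _)).1
      (le_antisymm h1 (Finset.sum_nonneg fun j _ => sq_nonneg (G₁ z.1 j * G₂ z.2 j)))
    have h3 : ∀ j, G₁ z.1 j * G₂ z.2 j = 0 := fun j => by
      simpa using h2 j (Finset.mem_univ j)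
    rw [risk_eq]
    simp only [h3, sub_zero]
  rw [hzv, hsplit]
  have h1 := e1 y
  have h2 := hc y.1 y.2
  have h3 : (C₁ * C₂ * (‖y.1‖ * ‖y.2‖)) ^ 2 ≤ α * (‖y.1‖ * ‖y.2‖) := by
    have h4 : 0 ≤ ‖y.1‖ * ‖y.2‖ := by positivity
    nlinarith
  have h5 : 0 ≤ α * (‖y.1‖ * ‖y.2‖) := by positivity
  linarith

end Risk

/-! ### The weight distribution condition -/

section ArcVec

variable {V : Type*} [NormedAddCommGroup V] [InnerProductSpace ℝ V]

/-- The vector `2 𝔼[1_{⟪a, x⟫ > 0} max(⟪a, y⟫, 0) a]` for a standard Gaussian vector `a`, in closed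
form: with `θ` the angle between `x` and `y`, it is
`(1 - θ / π) y + (sin θ / π) (‖y‖ / ‖x‖) x`. -/
def arcVec (x y : V) : V :=
  (1 - InnerProductGeometry.angle x y / Real.pi) • y +
    (Real.sin (InnerProductGeometry.angle x y) / Real.pi * (‖y‖ / ‖x‖)) • x

lemma angle_mem_Icc (x y : V) : InnerProductGeometry.angle x y ∈ Set.Icc 0 Real.pi :=
  ⟨InnerProductGeometry.angle_nonneg x y, InnerProductGeometry.angle_le_pi x y⟩

lemma arcVec_zero_right (x : V) : arcVec x 0 = 0 := by simp [arcVec]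

lemma arcVec_self {x : V} (hx : x ≠ 0) : arcVec x x = x := by
  simp [arcVec, InnerProductGeometry.angle_self hx]

lemma arcVec_sub_arcVec_neg (x y : V) : arcVec x y - arcVec x (-y) = y := by
  have hpi := Real.pi_ne_zero
  rw [arcVec, arcVec, InnerProductGeometry.angle_neg_right, Real.sin_pi_sub, norm_neg, sub_div,
    div_self hpi]
  module

lemma inner_self_arcVec {x : V} (hx : x ≠ 0) (y : V) :
    ⟪x, arcVec x y⟫ = ‖x‖ * ‖y‖ * cosAngleMap (InnerProductGeometry.angle x y) := by
  have hx' : ‖x‖ ≠ 0 := norm_ne_zero_iff.2 hx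
  rw [arcVec, inner_add_right, inner_smul_right, inner_smul_right, real_inner_self_eq_norm_sq,
    ← InnerProductGeometry.cos_angle_mul_norm_mul_norm x y, cosAngleMap]
  field_simp

lemma abs_cosAngleMap_sub_le {x y : ℝ} (hx : x ∈ Set.Icc 0 Real.pi) (hy : y ∈ Set.Icc 0 Real.pi) :
    |cosAngleMap x - cosAngleMap y| ≤ |x - y| := by
  rw [← cos_angleMap hx.1 hx.2, ← cos_angleMap hy.1 hy.2]
  exact (Real.abs_cos_sub_cos_le _ _).trans (abs_angleMap_sub_le hx hy)

end ArcVec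

/-- The weight distribution condition: the layer behaves on average over its rows, uniformly in the
directions, like a Gaussian layer. -/
def WDC {a b : ℕ} (δ : ℝ) (W : Matrix (Fin a) (Fin b) ℝ) : Prop :=
  ∀ x v y : Vec b, x ≠ 0 → |2 * ⟪selLayer W x v, layer W y⟫ - ⟪v, arcVec x y⟫| ≤ δ * (‖v‖ * ‖y‖)

/-- The joint weight distribution condition for the two last layers. -/
def JointWDC {ℓ a b : ℕ} (δ : ℝ) (A : Matrix (Fin ℓ) (Fin a) ℝ) (B : Matrix (Fin ℓ) (Fin b) ℝ) :
    Prop :=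
  ∀ x v x' : Vec a, x ≠ 0 → ∀ y y' : Vec b,
    |4 * ℓ * ∑ j, selLayer A x v j * layer A x' j * (layer B y j * layer B y' j)
      - ⟪v, arcVec x x'⟫ * ⟪y, arcVec y y'⟫| ≤ δ * (‖v‖ * ‖x'‖ * (‖y‖ * ‖y'‖))

lemma layer_smul {a b : ℕ} (W : Matrix (Fin a) (Fin b) ℝ) {c : ℝ} (hc : 0 ≤ c) (x : Vec b) :
    layer W (c • x) = c • layer W x := by
  ext i
  simp only [layer_apply, PiLp.smul_apply, smul_eq_mul, WithLp.ofLp_smul, Matrix.mulVec_smul,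
    Pi.smul_apply]
  rw [mul_max_of_nonneg _ _ hc, mul_zero]

lemma selLayer_smul_left {a b : ℕ} (W : Matrix (Fin a) (Fin b) ℝ) {c : ℝ} (hc : 0 < c)
    (x : Vec b) : selLayer W (c • x) = selLayer W x := by
  ext v i
  simp only [selLayer_apply, WithLp.ofLp_smul, Matrix.mulVec_smul, Pi.smul_apply, smul_eq_mul,
    mul_pos_iff_of_pos_left hc]

lemma two_mul_norm_selLayer_sq_le {a b : ℕ} {δ : ℝ} {W : Matrix (Fin a) (Fin b) ℝ} (hW : WDC δ W)
    {x : Vec b} (hx : x ≠ 0) (v : Vec b) :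
    2 * ‖selLayer W x v‖ ^ 2 ≤ (1 + 2 * δ) * ‖v‖ ^ 2 := by
  have h1 := (abs_le.1 (hW x v v hx)).2
  have h2 := (abs_le.1 (hW x v (-v) hx)).1
  -- `t = max(t, 0) - max(-t, 0)` turns the vector condition into a bound on the operator norm
  have e : ‖selLayer W x v‖ ^ 2
      = ⟪selLayer W x v, layer W v⟫ - ⟪selLayer W x v, layer W (-v)⟫ := by
    rw [← inner_sub_right, EuclideanSpace.real_norm_sq_eq, PiLp.inner_apply]
    refine Finset.sum_congr rfl fun i _ => ?_
    have hmax : ∀ t : ℝ, max t 0 - max (-t) 0 = t := fun t => max_zero_sub_max_neg_zero_eq_self t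
    simp only [selLayer_apply, PiLp.sub_apply, layer_apply, WithLp.ofLp_neg, Matrix.mulVec_neg,
      Pi.neg_apply, hmax, RCLike.inner_apply, conj_trivial]
    split_ifs <;> ring
  have e2 : ⟪v, arcVec x v⟫ - ⟪v, arcVec x (-v)⟫ = ‖v‖ ^ 2 := by
    rw [← inner_sub_right, arcVec_sub_arcVec_neg, real_inner_self_eq_norm_sq]
  rw [norm_neg] at h2
  nlinarith

/-! ### Propagation through the inner layers -/

section Inner

variable {n : ℕ → ℕ} (W : (i : ℕ) → Matrix (Fin (n (i + 1))) (Fin (n i)) ℝ)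

/-- The output of the first `k` layers, normalized by `√2 ^ k`. -/
def nInner (k : ℕ) (h : Vec (n 0)) : Vec (n k) := (√2) ^ k • innerNet n W k h

/-- The linearization at `h` of the first `k` layers, normalized by `√2 ^ k`, applied to `v`. -/
def nSel (k : ℕ) (h v : Vec (n 0)) : Vec (n k) := (√2) ^ k • selInner n W k h v

lemma nSel_self (k : ℕ) (h : Vec (n 0)) : nSel W k h h = nInner W k h := by
  rw [nSel, selInner_self, nInner]

lemma innerNet_zero_right (k : ℕ) : innerNet n W k 0 = 0 := by
  rw [← selInner_self, map_zero]

lemma nInner_zero_right (k : ℕ) : nInner W k 0 = 0 := by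
  rw [nInner, innerNet_zero_right, smul_zero]

lemma sqrt_two_pow_pos (k : ℕ) : 0 < √2 ^ k := by positivity

variable {W} {δ : ℝ} {K : ℕ}

lemma abs_inner_nSel_succ_sub_le {k : ℕ} (hW : WDC δ (W k)) {h : Vec (n 0)}
    (hX : nInner W k h ≠ 0) (v h' : Vec (n 0)) :
    |⟪nSel W (k + 1) h v, nInner W (k + 1) h'⟫
      - ⟪nSel W k h v, arcVec (nInner W k h) (nInner W k h')⟫|
      ≤ δ * (‖nSel W k h v‖ * ‖nInner W k h'‖) := by
  have hs := sqrt_two_pow_pos k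
  have h1 := hW _ (nSel W k h v) (nInner W k h') hX
  convert h1 using 3
  rw [nInner, nInner, nSel, nSel, nInner, selLayer_smul_left _ hs, layer_smul _ hs.le, map_smul,
    selInner, LinearMap.comp_apply]
  rw [show innerNet n W (k + 1) h' = layer (W k) (innerNet n W k h') from rfl]
  simp only [inner_smul_left, inner_smul_right, conj_trivial]
  have : √2 ^ (k + 1) * (√2 ^ (k + 1)) = 2 * (√2 ^ k * √2 ^ k) := by
    have := Real.mul_self_sqrt (show (0 : ℝ) ≤ 2 by norm_num)
    rw [pow_succ]
    linear_combination (√2 ^ k * √2 ^ k) * this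
  rw [← mul_assoc, this]
  ring

lemma norm_nSel_succ_sq_le {k : ℕ} (hW : WDC δ (W k)) {h : Vec (n 0)}
    (hX : nInner W k h ≠ 0) (v : Vec (n 0)) :
    ‖nSel W (k + 1) h v‖ ^ 2 ≤ (1 + 2 * δ) * ‖nSel W k h v‖ ^ 2 := by
  refine le_trans (le_of_eq ?_) (two_mul_norm_selLayer_sq_le hW hX (nSel W k h v))
  have e : (√2 ^ (k + 1)) ^ 2 = 2 * (√2 ^ k) ^ 2 := by
    rw [pow_succ √2 k, mul_pow, Real.sq_sqrt (by norm_num)]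
    ring
  rw [nInner, selLayer_smul_left _ (sqrt_two_pow_pos k), nSel, nSel, map_smul, selInner,
    LinearMap.comp_apply, norm_smul, norm_smul, mul_pow, mul_pow, Real.norm_eq_abs,
    Real.norm_eq_abs, sq_abs, sq_abs, e]
  ring

variable (hW : ∀ k < K, WDC δ (W k)) (hδ : 0 ≤ δ) (hKδ : K * δ ≤ 1 / 4)

include hW hδ hKδ

lemma abs_norm_nInner_sq_sub_le {k : ℕ} (hk : k ≤ K) (h : Vec (n 0)) :
    |‖nInner W k h‖ ^ 2 - ‖h‖ ^ 2| ≤ 2 * k * δ * ‖h‖ ^ 2 := by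
  by_cases h0 : h = 0
  · simp [h0, nInner_zero_right]
  have hh : 0 < ‖h‖ := norm_pos_iff.2 h0
  induction k with
  | zero => simp [nInner, innerNet]
  | succ k ih =>
    have ih := ih (by omega)
    have hkK : ((k : ℝ) + 1) * δ ≤ 1 / 4 := by
      refine le_trans ?_ hKδ
      gcongr
      exact_mod_cast hk
    have hX2 : ‖h‖ ^ 2 / 2 ≤ ‖nInner W k h‖ ^ 2 ∧ ‖nInner W k h‖ ^ 2 ≤ 2 * ‖h‖ ^ 2 := by
      have := abs_le.1 ih
      have h2 : 2 * k * δ * ‖h‖ ^ 2 ≤ 1 / 2 * ‖h‖ ^ 2 := by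
        gcongr
        linarith
      constructor <;> linarith
    have hX : nInner W k h ≠ 0 := by
      intro hX
      rw [hX, norm_zero] at hX2
      have : 0 < ‖h‖ ^ 2 := by positivity
      linarith [hX2.1]
    have h1 := abs_inner_nSel_succ_sub_le (hW k hk) hX h h
    rw [nSel_self, nSel_self, arcVec_self hX, real_inner_self_eq_norm_sq,
      real_inner_self_eq_norm_sq, ← pow_two] at h1
    have h2 : δ * ‖nInner W k h‖ ^ 2 ≤ 2 * δ * ‖h‖ ^ 2 := by nlinarith [hX2.2]
    have h3 := abs_le.1 (h1.trans h2)
    have h4 := abs_le.1 ih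
    push_cast
    rw [abs_le]
    constructor <;> nlinarith

lemma nInner_bounds {k : ℕ} (hk : k ≤ K) (h : Vec (n 0)) :
    |‖nInner W k h‖ - ‖h‖| ≤ 2 * k * δ * ‖h‖ ∧ ‖h‖ / 2 ≤ ‖nInner W k h‖ ∧
      ‖nInner W k h‖ ≤ 3 / 2 * ‖h‖ ∧ ‖nInner W k h‖ ^ 2 ≤ 3 / 2 * ‖h‖ ^ 2 := by
  have h1 := abs_norm_nInner_sq_sub_le hW hδ hKδ hk h
  have hkK : (k : ℝ) * δ ≤ 1 / 4 := by
    refine le_trans ?_ hKδ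
    gcongr
  have h2 : |‖nInner W k h‖ - ‖h‖| ≤ 2 * k * δ * ‖h‖ := by
    rcases eq_or_ne h 0 with rfl | h0
    · simp [nInner_zero_right]
    have hh : 0 < ‖h‖ := norm_pos_iff.2 h0
    have e : ‖nInner W k h‖ ^ 2 - ‖h‖ ^ 2
        = (‖nInner W k h‖ - ‖h‖) * (‖nInner W k h‖ + ‖h‖) := by ring
    have hp : 0 < ‖nInner W k h‖ + ‖h‖ := by positivity
    rw [e, abs_mul, abs_of_pos hp] at h1
    have h3 : |‖nInner W k h‖ - ‖h‖| * ‖h‖ ≤ 2 * k * δ * ‖h‖ * ‖h‖ := by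
      have : |‖nInner W k h‖ - ‖h‖| * ‖h‖
          ≤ |‖nInner W k h‖ - ‖h‖| * (‖nInner W k h‖ + ‖h‖) := by
        gcongr
        linarith [norm_nonneg (nInner W k h)]
      nlinarith
    exact le_of_mul_le_mul_right h3 hh
  have h3 := abs_le.1 h2
  have h4 := abs_le.1 h1
  have hn := norm_nonneg h
  refine ⟨h2, by nlinarith, by nlinarith, by nlinarith⟩

lemma nInner_ne_zero {k : ℕ} (hk : k ≤ K) {h : Vec (n 0)} (h0 : h ≠ 0) : nInner W k h ≠ 0 := by
  have h1 := (nInner_bounds hW hδ hKδ hk h).2.1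
  have hh : 0 < ‖h‖ := norm_pos_iff.2 h0
  exact norm_pos_iff.1 (by linarith)

lemma norm_nSel_sq_le {k : ℕ} (hk : k ≤ K) {h : Vec (n 0)} (h0 : h ≠ 0) (v : Vec (n 0)) :
    ‖nSel W k h v‖ ^ 2 ≤ 2 * ‖v‖ ^ 2 := by
  have key : ‖nSel W k h v‖ ^ 2 ≤ (1 + 4 * k * δ) * ‖v‖ ^ 2 := by
    induction k with
    | zero => simp [nSel, selInner]
    | succ k ih =>
      have ih := ih (by omega)
      have h1 := norm_nSel_succ_sq_le (hW k hk) (nInner_ne_zero hW hδ hKδ (by omega) h0) v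
      have hkK : (k : ℝ) * δ ≤ 1 / 4 := by
        refine le_trans ?_ hKδ
        gcongr
        omega
      refine h1.trans ?_
      calc (1 + 2 * δ) * ‖nSel W k h v‖ ^ 2 ≤ (1 + 2 * δ) * ((1 + 4 * k * δ) * ‖v‖ ^ 2) := by gcongr
        _ = ((1 + 2 * δ) * (1 + 4 * k * δ)) * ‖v‖ ^ 2 := by ring
        _ ≤ (1 + 4 * (k + 1 : ℕ) * δ) * ‖v‖ ^ 2 := by
          gcongr
          push_cast
          nlinarith
  have hkK : (k : ℝ) * δ ≤ 1 / 4 := by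
    refine le_trans ?_ hKδ
    gcongr
  refine key.trans ?_
  gcongr
  linarith

lemma norm_nSel_mul_norm_nInner_le {k : ℕ} (hk : k ≤ K) {h : Vec (n 0)} (h0 : h ≠ 0)
    (v h' : Vec (n 0)) : ‖nSel W k h v‖ * ‖nInner W k h'‖ ≤ 2 * (‖v‖ * ‖h'‖) := by
  have h1 := norm_nSel_sq_le hW hδ hKδ hk h0 v
  have h2 := (nInner_bounds hW hδ hKδ hk h').2.2.2
  refine le_of_sq_le_sq ?_ (by positivity)
  calc (‖nSel W k h v‖ * ‖nInner W k h'‖) ^ 2 = ‖nSel W k h v‖ ^ 2 * ‖nInner W k h'‖ ^ 2 := by ring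
    _ ≤ (2 * ‖v‖ ^ 2) * (3 / 2 * ‖h'‖ ^ 2) := by gcongr
    _ ≤ (2 * (‖v‖ * ‖h'‖)) ^ 2 := by nlinarith [sq_nonneg (‖v‖ * ‖h'‖)]

lemma abs_inner_nSel_nInner_sub_le {k : ℕ} (hk : k ≤ K) {h : Vec (n 0)} (h0 : h ≠ 0)
    (v : Vec (n 0)) :
    |⟪nSel W k h v, nInner W k h⟫ - ⟪v, h⟫| ≤ 2 * k * δ * (‖v‖ * ‖h‖) := by
  induction k with
  | zero => simp [nSel, selInner, nInner, innerNet]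
  | succ k ih =>
    have hX := nInner_ne_zero hW hδ hKδ (show k ≤ K by omega) h0
    have h1 := abs_inner_nSel_succ_sub_le (hW k hk) hX v h
    rw [arcVec_self hX] at h1
    have h2 := norm_nSel_mul_norm_nInner_le hW hδ hKδ (show k ≤ K by omega) h0 v h
    have h3 := abs_le.1 (h1.trans (mul_le_mul_of_nonneg_left h2 hδ))
    have h4 := abs_le.1 (ih (by omega))
    push_cast
    rw [abs_le]
    constructor <;> nlinarith

/-- The angles between the outputs of the layers follow the iterates of the angle map. -/
lemma abs_angle_nInner_sub_le {k : ℕ} (hk : k ≤ K) {h h' : Vec (n 0)} (h0 : h ≠ 0) (h0' : h' ≠ 0) :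
    |InnerProductGeometry.angle (nInner W k h) (nInner W k h')
      - angleMap^[k] (InnerProductGeometry.angle h h')| ≤ 5 * k * √δ := by
  induction k with
  | zero => simp [nInner, innerNet]
  | succ k ih =>
    have ih := ih (by omega)
    have hX := nInner_ne_zero hW hδ hKδ (show k ≤ K by omega) h0
    have hX' := nInner_ne_zero hW hδ hKδ (show k ≤ K by omega) h0'
    have hY := nInner_ne_zero hW hδ hKδ hk h0
    have hY' := nInner_ne_zero hW hδ hKδ hk h0'
    set θ := InnerProductGeometry.angle (nInner W k h) (nInner W k h') with hθ
    set θ' := InnerProductGeometry.angle (nInner W (k + 1) h) (nInner W (k + 1) h') with hθ'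
    set p := ‖nInner W k h‖ * ‖nInner W k h'‖ with hp
    set p' := ‖nInner W (k + 1) h‖ * ‖nInner W (k + 1) h'‖ with hp'
    have hp0 : 0 < p := mul_pos (norm_pos_iff.2 hX) (norm_pos_iff.2 hX')
    have hp0' : 0 < p' := mul_pos (norm_pos_iff.2 hY) (norm_pos_iff.2 hY')
    have hδ4 : δ ≤ 1 / 4 := by
      refine le_trans ?_ hKδ
      have : (1 : ℝ) ≤ K := by exact_mod_cast (show 1 ≤ K by omega)
      nlinarith
    have h1 : |p' * Real.cos θ' - p * cosAngleMap θ| ≤ δ * p := by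
      have := abs_inner_nSel_succ_sub_le (hW k hk) hX h h'
      rw [nSel_self, nSel_self, inner_self_arcVec hX,
        ← InnerProductGeometry.cos_angle_mul_norm_mul_norm] at this
      rwa [mul_comm p']
    have hsq : ∀ g : Vec (n 0), nInner W k g ≠ 0 →
        |‖nInner W (k + 1) g‖ ^ 2 - ‖nInner W k g‖ ^ 2| ≤ δ * ‖nInner W k g‖ ^ 2 := by
      intro g hg
      have h1 := abs_inner_nSel_succ_sub_le (hW k hk) hg g g
      rwa [nSel_self, nSel_self, arcVec_self hg, real_inner_self_eq_norm_sq,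
        real_inner_self_eq_norm_sq, ← pow_two] at h1
    have h2 : |p' - p| ≤ δ * p := by
      have a1 := abs_le.1 (hsq h hX)
      have a2 := abs_le.1 (hsq h' hX')
      have e' : p' ^ 2 = ‖nInner W (k + 1) h‖ ^ 2 * ‖nInner W (k + 1) h'‖ ^ 2 := by
        rw [hp', mul_pow]
      have e : p ^ 2 = ‖nInner W k h‖ ^ 2 * ‖nInner W k h'‖ ^ 2 := by
        rw [hp, mul_pow]
      have up : p' ≤ (1 + δ) * p := by
        refine le_of_sq_le_sq ?_ (by positivity)
        rw [mul_pow (1 + δ) p, e, e']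
        calc ‖nInner W (k + 1) h‖ ^ 2 * ‖nInner W (k + 1) h'‖ ^ 2
            ≤ ((1 + δ) * ‖nInner W k h‖ ^ 2) * ((1 + δ) * ‖nInner W k h'‖ ^ 2) := by
              gcongr
              · linarith
              · linarith
          _ = _ := by ring
      have lo : (1 - δ) * p ≤ p' := by
        refine le_of_sq_le_sq ?_ hp0'.le
        rw [mul_pow (1 - δ) p, e, e']
        have h1δ : 0 ≤ 1 - δ := by linarith
        calc (1 - δ) ^ 2 * (‖nInner W k h‖ ^ 2 * ‖nInner W k h'‖ ^ 2)
            = ((1 - δ) * ‖nInner W k h‖ ^ 2) * ((1 - δ) * ‖nInner W k h'‖ ^ 2) := by ring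
          _ ≤ _ := by
              gcongr
              · linarith
              · linarith
      rw [abs_le]
      constructor <;> linarith
    have h3 : |Real.cos θ' - cosAngleMap θ| ≤ 2 * δ := by
      have e : p * (Real.cos θ' - cosAngleMap θ)
          = (p' * Real.cos θ' - p * cosAngleMap θ) - Real.cos θ' * (p' - p) := by ring
      have a1 : p * |Real.cos θ' - cosAngleMap θ| ≤ p * (2 * δ) := by
        rw [← abs_of_pos hp0, ← abs_mul, e, abs_of_pos hp0]
        refine (abs_sub _ _).trans ?_
        rw [abs_mul]
        have := Real.abs_cos_le_one θ'
        nlinarith [abs_nonneg (p' - p)]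
      exact le_of_mul_le_mul_left a1 hp0
    have hθm : θ ∈ Set.Icc 0 Real.pi := angle_mem_Icc _ _
    have hθm' : θ' ∈ Set.Icc 0 Real.pi := angle_mem_Icc _ _
    have h4 : |θ' - angleMap θ| ≤ 5 * √δ := by
      rw [← Real.arccos_cos hθm'.1 hθm'.2, angleMap_eq]
      refine (abs_arccos_sub_arccos_le (Real.abs_cos_le_one _)
        (abs_cosAngleMap_le hθm.1 hθm.2)).trans ?_
      have : √|Real.cos θ' - cosAngleMap θ| ≤ 5 / 3 * √δ := by
        rw [Real.sqrt_le_left (by positivity), mul_pow, Real.sq_sqrt hδ]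
        refine h3.trans ?_
        nlinarith
      linarith
    have h5 := abs_angleMap_sub_le hθm
      (iterate_angleMap_mem (angle_mem_Icc h h') k)
    rw [Function.iterate_succ_apply']
    push_cast
    have h6 := abs_le.1 h4
    have h7 := abs_le.1 (h5.trans ih)
    rw [abs_le]
    constructor <;> linarith

end Inner

lemma abs_add_four_le (a b c d : ℝ) : |a + b + c + d| ≤ |a| + |b| + |c| + |d| := by
  refine (abs_add_le _ _).trans (add_le_add_left ?_ _)
  exact (abs_add_le _ _).trans (add_le_add_left (abs_add_le _ _) _)

/-- The limiting value of `2 ^ k Λ_hᵀ Λ_{h'} h'` for `k` layers. -/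
def arcNet {a : ℕ} (k : ℕ) (h h' : Vec a) : Vec a :=
  angProd (InnerProductGeometry.angle h h') k • h' +
    (angSum (InnerProductGeometry.angle h h') k * (‖h'‖ / ‖h‖)) • h

lemma norm_arcNet_le {a : ℕ} (k : ℕ) {h : Vec a} (h0 : h ≠ 0) (h' : Vec a) :
    ‖arcNet k h h'‖ ≤ ‖h'‖ := by
  have hm := angle_mem_Icc h h'
  have h1 := angProd_nonneg hm k
  have h2 := angSum_nonneg hm k
  have hh : ‖h‖ ≠ 0 := norm_ne_zero_iff.2 h0
  refine (norm_add_le _ _).trans ?_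
  rw [norm_smul, norm_smul, Real.norm_of_nonneg h1, Real.norm_of_nonneg (by positivity), mul_assoc,
    div_mul_cancel₀ _ hh, ← add_mul]
  exact mul_le_of_le_one_left (norm_nonneg _) (angProd_add_angSum_le_one hm k)

lemma arcNet_zero_right {a : ℕ} (k : ℕ) (h : Vec a) : arcNet k h 0 = 0 := by
  simp [arcNet]

lemma inner_arcNet_succ {a : ℕ} (k : ℕ) (v h h' : Vec a) :
    ⟪v, arcNet (k + 1) h h'⟫
      = (1 - angleMap^[k] (InnerProductGeometry.angle h h') / Real.pi) * ⟪v, arcNet k h h'⟫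
        + Real.sin (angleMap^[k] (InnerProductGeometry.angle h h')) / Real.pi
          * (‖h'‖ / ‖h‖ * ⟪v, h⟫) := by
  simp only [arcNet, angProd, angSum, inner_add_right, inner_smul_right]
  ring

section Inner

variable {n : ℕ → ℕ} {W : (i : ℕ) → Matrix (Fin (n (i + 1))) (Fin (n i)) ℝ} {δ : ℝ} {K : ℕ}
  (hW : ∀ k < K, WDC δ (W k)) (hδ : 0 ≤ δ) (hKδ : K * δ ≤ 1 / 4)

include hW hδ hKδ

set_option maxHeartbeats 1000000 in
/-- One step of the recursion for `arcNet`. -/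
lemma abs_inner_nSel_arcVec_sub_le {k : ℕ} (hk : k ≤ K) (hK : 1 ≤ K) {h h' : Vec (n 0)} (h0 : h ≠ 0)
    (v : Vec (n 0)) {α : ℝ} (hα : |⟪nSel W k h v, nInner W k h'⟫ - ⟪v, arcNet k h h'⟫|
      ≤ α * (‖v‖ * ‖h'‖)) :
    |⟪nSel W k h v, arcVec (nInner W k h) (nInner W k h')⟫ - ⟪v, arcNet (k + 1) h h'⟫|
      ≤ (α + 10 * K * √δ) * (‖v‖ * ‖h'‖) := by
  rcases eq_or_ne h' 0 with rfl | h0'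
  · simp [nInner_zero_right, arcVec_zero_right, arcNet_zero_right]
  have hpi := Real.pi_pos
  have hpi3 := Real.pi_gt_three
  have hX := nInner_ne_zero hW hδ hKδ hk h0
  have hXp : 0 < ‖nInner W k h‖ := norm_pos_iff.2 hX
  have hhp : 0 < ‖h‖ := norm_pos_iff.2 h0
  have hhp' : 0 < ‖h'‖ := norm_pos_iff.2 h0'
  have hang := abs_angle_nInner_sub_le hW hδ hKδ hk h0 h0'
  have hB := abs_inner_nSel_nInner_sub_le hW hδ hKδ hk h0 v
  have hb := nInner_bounds hW hδ hKδ hk h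
  have hb' := nInner_bounds hW hδ hKδ hk h'
  have hkK : (k : ℝ) ≤ K := by exact_mod_cast hk
  have hK1 : (1 : ℝ) ≤ K := by exact_mod_cast hK
  have hδ4 : δ ≤ 1 / 4 := by nlinarith
  have hδs : δ ≤ √δ / 2 := by
    have h1 : √δ ≤ 1 / 2 := by
      rw [Real.sqrt_le_left (by norm_num)]
      linarith
    nlinarith [Real.mul_self_sqrt hδ, Real.sqrt_nonneg δ]
  have hkδ : k * δ ≤ K * √δ / 2 := by nlinarith [Real.sqrt_nonneg δ]
  have hks : (k : ℝ) * √δ ≤ K * √δ := by gcongr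
  rw [inner_arcNet_succ, arcVec, inner_add_right, inner_smul_right, inner_smul_right]
  set θ := InnerProductGeometry.angle (nInner W k h) (nInner W k h') with hθ
  set θb := angleMap^[k] (InnerProductGeometry.angle h h') with hθb
  have hθm : θ ∈ Set.Icc 0 Real.pi := angle_mem_Icc _ _
  set A := ⟪nSel W k h v, nInner W k h'⟫ with hA
  set Ab := ⟪v, arcNet k h h'⟫ with hAb
  set u := ⟪nSel W k h v, nInner W k h⟫ / ‖nInner W k h‖ with hu
  set ub := ⟪v, h⟫ / ‖h‖ with hub
  have e : (1 - θ / Real.pi) * A + Real.sin θ / Real.pi * (‖nInner W k h'‖ / ‖nInner W k h‖)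
        * ⟪nSel W k h v, nInner W k h⟫
        - ((1 - θb / Real.pi) * Ab + Real.sin θb / Real.pi * (‖h'‖ / ‖h‖ * ⟪v, h⟫))
      = (1 - θ / Real.pi) * (A - Ab) + (θb - θ) / Real.pi * Ab
        + Real.sin θ / Real.pi * (‖nInner W k h'‖ * u - ‖h'‖ * ub)
        + (Real.sin θ - Real.sin θb) / Real.pi * (‖h'‖ * ub) := by
    rw [hu, hub]
    field_simp
    ring
  rw [e]
  have hubb : |ub| ≤ ‖v‖ := by
    rw [hub, abs_div, abs_of_pos hhp, div_le_iff₀ hhp]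
    exact abs_real_inner_le_norm v h
  have t1 : |(1 - θ / Real.pi) * (A - Ab)| ≤ α * (‖v‖ * ‖h'‖) := by
    rw [abs_mul]
    have h1 : |1 - θ / Real.pi| ≤ 1 := by
      rw [abs_of_nonneg (one_sub_div_pi_nonneg hθm)]
      have : 0 ≤ θ / Real.pi := div_nonneg hθm.1 hpi.le
      linarith
    calc _ ≤ 1 * (α * (‖v‖ * ‖h'‖)) := by gcongr
      _ = _ := one_mul _
  have hang' : |θb - θ| / Real.pi ≤ 5 / 3 * K * √δ := by
    rw [abs_sub_comm, div_le_iff₀ hpi]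
    refine hang.trans ?_
    have : 0 ≤ K * √δ := by positivity
    nlinarith
  have t2 : |(θb - θ) / Real.pi * Ab| ≤ 5 / 3 * K * √δ * (‖v‖ * ‖h'‖) := by
    rw [abs_mul, abs_div, abs_of_pos hpi]
    have h1 : |Ab| ≤ ‖v‖ * ‖h'‖ :=
      (abs_real_inner_le_norm _ _).trans (by gcongr; exact norm_arcNet_le k h0 h')
    gcongr
  have t4 : |(Real.sin θ - Real.sin θb) / Real.pi * (‖h'‖ * ub)|
      ≤ 5 / 3 * K * √δ * (‖v‖ * ‖h'‖) := by
    rw [abs_mul, abs_div, abs_of_pos hpi, abs_mul, abs_of_pos hhp']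
    have h1 : |Real.sin θ - Real.sin θb| / Real.pi ≤ 5 / 3 * K * √δ := by
      refine le_trans (div_le_div_of_nonneg_right ?_ hpi.le) hang'
      rw [abs_sub_comm θb]
      exact Real.abs_sin_sub_sin_le _ _
    calc _ ≤ 5 / 3 * K * √δ * (‖h'‖ * ‖v‖) := by gcongr
      _ = _ := by ring
  have hudiff : |u - ub| ≤ 8 * k * δ * ‖v‖ := by
    have e2 : u - ub = ((⟪nSel W k h v, nInner W k h⟫ - ⟪v, h⟫)
        - ub * (‖nInner W k h‖ - ‖h‖)) / ‖nInner W k h‖ := by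
      rw [hu, hub]
      field_simp
      ring
    rw [e2, abs_div, abs_of_pos hXp, div_le_iff₀ hXp]
    refine (abs_sub _ _).trans ?_
    rw [abs_mul]
    have h1 : |ub| * |‖nInner W k h‖ - ‖h‖| ≤ ‖v‖ * (2 * k * δ * ‖h‖) := by
      gcongr
      exact hb.1
    have h2 : 8 * k * δ * ‖v‖ * (‖h‖ / 2) ≤ 8 * k * δ * ‖v‖ * ‖nInner W k h‖ := by
      gcongr
      exact hb.2.1
    linarith
  have t3 : |Real.sin θ / Real.pi * (‖nInner W k h'‖ * u - ‖h'‖ * ub)|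
      ≤ 14 / 3 * (k * δ) * (‖v‖ * ‖h'‖) := by
    have e2 : ‖nInner W k h'‖ * u - ‖h'‖ * ub
        = ‖nInner W k h'‖ * (u - ub) + (‖nInner W k h'‖ - ‖h'‖) * ub := by ring
    have h1 : |‖nInner W k h'‖ * u - ‖h'‖ * ub| ≤ 14 * (k * δ) * (‖v‖ * ‖h'‖) := by
      rw [e2]
      refine (abs_add_le _ _).trans ?_
      rw [abs_mul, abs_mul, abs_norm]
      have a1 : ‖nInner W k h'‖ * |u - ub| ≤ (3 / 2 * ‖h'‖) * (8 * k * δ * ‖v‖) := by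
        gcongr
        exact hb'.2.2.1
      have a2 : |‖nInner W k h'‖ - ‖h'‖| * |ub| ≤ (2 * k * δ * ‖h'‖) * ‖v‖ := by
        gcongr
        exact hb'.1
      linarith
    rw [abs_mul, abs_div, abs_of_pos hpi]
    have h2 : |Real.sin θ| / Real.pi ≤ 1 / 3 :=
      div_le_div₀ zero_le_one (Real.abs_sin_le_one θ) (by norm_num) hpi3.le
    calc _ ≤ 1 / 3 * (14 * (k * δ) * (‖v‖ * ‖h'‖)) := by gcongr
      _ = _ := by ring
  have t5 : 14 / 3 * (k * δ) * (‖v‖ * ‖h'‖) ≤ 7 / 3 * K * √δ * (‖v‖ * ‖h'‖) := by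
    refine mul_le_mul_of_nonneg_right ?_ (by positivity)
    linarith
  have hpos : 0 ≤ K * √δ * (‖v‖ * ‖h'‖) := by positivity
  refine (abs_add_four_le _ _ _ _).trans ?_
  linarith

lemma abs_inner_nSel_nInner_sub_arcNet_le {k : ℕ} (hk : k ≤ K) (hK : 1 ≤ K) {h : Vec (n 0)}
    (h0 : h ≠ 0) (v h' : Vec (n 0)) :
    |⟪nSel W k h v, nInner W k h'⟫ - ⟪v, arcNet k h h'⟫|
      ≤ 12 * k * K * √δ * (‖v‖ * ‖h'‖) := by
  induction k with
  | zero => simp [nSel, selInner, nInner, innerNet, arcNet, angProd, angSum]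
  | succ k ih =>
    have hX := nInner_ne_zero hW hδ hKδ (show k ≤ K by omega) h0
    have h1 := abs_inner_nSel_arcVec_sub_le hW hδ hKδ (show k ≤ K by omega) hK h0 v (ih (by omega))
    have h2 := abs_inner_nSel_succ_sub_le (hW k hk) hX v h'
    have h3 := norm_nSel_mul_norm_nInner_le hW hδ hKδ (show k ≤ K by omega) h0 v h'
    have h4 := abs_le.1 h1
    have h5 := abs_le.1 (h2.trans (mul_le_mul_of_nonneg_left h3 hδ))
    have hK1 : (1 : ℝ) ≤ K := by exact_mod_cast hK
    have hδs : δ ≤ K * √δ := by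
      have h1 : √δ ≤ 1 := by
        rw [Real.sqrt_le_left (by norm_num)]
        nlinarith
      nlinarith [Real.mul_self_sqrt hδ, Real.sqrt_nonneg δ]
    have h6 : δ * (‖v‖ * ‖h'‖) ≤ K * √δ * (‖v‖ * ‖h'‖) := by gcongr
    push_cast
    rw [abs_le]
    constructor <;> nlinarith

end Inner

/-! ### The limiting gradient -/

/-- The limiting direction of the partial gradient of the risk in the first variable, for networks
of depths `d` and `s`. -/
def gradLim {a b : ℕ} (d s : ℕ) (h₀ : Vec a) (m₀ : Vec b) (z : Vec a × Vec b) : Vec a :=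
  ‖z.2‖ ^ 2 • z.1 - (‖z.2‖ * ‖m₀‖ *
    Real.cos (angleMap^[s] (InnerProductGeometry.angle z.2 m₀))) • arcNet d z.1 h₀

lemma continuous_iterate_angleMap (k : ℕ) : Continuous (angleMap^[k]) :=
  continuous_angleMap.iterate k

lemma continuous_angProd (k : ℕ) : Continuous fun θ => angProd θ k := by
  induction k with
  | zero => exact continuous_const
  | succ k ih =>
    have := continuous_iterate_angleMap k
    unfold angProd
    fun_prop

lemma continuous_angSum (k : ℕ) : Continuous fun θ => angSum θ k := by
  induction k with
  | zero => exact continuous_const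
  | succ k ih =>
    have := continuous_iterate_angleMap k
    unfold angSum
    fun_prop

lemma continuousAt_angle_left {a : ℕ} {h : Vec a} (h0 : h ≠ 0) (h' : Vec a) :
    ContinuousAt (fun y => InnerProductGeometry.angle y h') h := by
  rcases eq_or_ne h' 0 with rfl | h0'
  · simp only [InnerProductGeometry.angle_zero_right]
    exact continuousAt_const
  · exact ContinuousAt.comp (f := fun y : Vec a => (y, h')) (x := h)
      (InnerProductGeometry.continuousAt_angle (x := (h, h')) h0 h0') (by fun_prop)

lemma continuousAt_gradLim {a b : ℕ} (d s : ℕ) (h₀ : Vec a) (m₀ : Vec b) {z : Vec a × Vec b}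
    (h1 : z.1 ≠ 0) (h2 : z.2 ≠ 0) : ContinuousAt (gradLim d s h₀ m₀) z := by
  have a1 : ContinuousAt (fun y : Vec a × Vec b => InnerProductGeometry.angle y.1 h₀) z :=
    ContinuousAt.comp (f := Prod.fst) (continuousAt_angle_left h1 h₀) continuousAt_fst
  have a2 : ContinuousAt (fun y : Vec a × Vec b => InnerProductGeometry.angle y.2 m₀) z :=
    ContinuousAt.comp (f := Prod.snd) (continuousAt_angle_left h2 m₀) continuousAt_snd
  have b1 : ContinuousAt (fun y : Vec a × Vec b =>
      angProd (InnerProductGeometry.angle y.1 h₀) d) z :=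
    ContinuousAt.comp (g := fun θ => angProd θ d) (continuous_angProd d).continuousAt a1
  have b2 : ContinuousAt (fun y : Vec a × Vec b =>
      angSum (InnerProductGeometry.angle y.1 h₀) d) z :=
    ContinuousAt.comp (g := fun θ => angSum θ d) (continuous_angSum d).continuousAt a1
  have b3 : ContinuousAt (fun y : Vec a × Vec b =>
      Real.cos (angleMap^[s] (InnerProductGeometry.angle y.2 m₀))) z :=
    ContinuousAt.comp (g := fun θ => Real.cos (angleMap^[s] θ))
      (Real.continuous_cos.comp (continuous_iterate_angleMap s)).continuousAt a2
  have b4 : ContinuousAt (fun y : Vec a × Vec b => ‖h₀‖ / ‖y.1‖) z :=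
    ContinuousAt.div continuousAt_const continuousAt_fst.norm (norm_ne_zero_iff.2 h1)
  have c1 : ContinuousAt (fun y : Vec a × Vec b => y.1) z := continuousAt_fst
  have c2 : ContinuousAt (fun y : Vec a × Vec b => ‖y.2‖) z := continuousAt_snd.norm
  unfold gradLim arcNet
  exact ((c2.pow 2).smul c1).sub (((c2.mul continuousAt_const).mul b3).smul
    ((b1.smul continuousAt_const).add ((b2.mul b4).smul c1)))

/-! ### The gradient of the risk is close to the limiting gradient -/

section Master

variable {n p : ℕ → ℕ} {d s ℓ : ℕ} {W₁ : (i : ℕ) → Matrix (Fin (n (i + 1))) (Fin (n i)) ℝ}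
  {L₁ : Matrix (Fin ℓ) (Fin (n (d - 1))) ℝ} {W₂ : (i : ℕ) → Matrix (Fin (p (i + 1))) (Fin (p i)) ℝ}
  {L₂ : Matrix (Fin ℓ) (Fin (p (s - 1))) ℝ} {δ : ℝ} {K : ℕ}

variable (W₁ L₁) in
lemma sqrt_two_pow_mul_selNet (h v : Vec (n 0)) (j : Fin ℓ) :
    √2 ^ (d - 1) * selNet n d ℓ W₁ L₁ h v j
      = selLayer L₁ (nInner W₁ (d - 1) h) (nSel W₁ (d - 1) h v) j := by
  rw [nInner, selLayer_smul_left _ (sqrt_two_pow_pos _), nSel, map_smul]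
  rfl

variable (W₁ L₁) in
lemma sqrt_two_pow_mul_net (h : Vec (n 0)) (j : Fin ℓ) :
    √2 ^ (d - 1) * net n d ℓ W₁ L₁ h j = layer L₁ (nInner W₁ (d - 1) h) j := by
  rw [nInner, layer_smul _ (sqrt_two_pow_pos _).le]
  rfl

/-- The positive factor between the risk and its normalization. -/
def riskScale (d s ℓ : ℕ) : ℝ := (4 * ℓ * ((√2 ^ (d - 1)) ^ 2 * (√2 ^ (s - 1)) ^ 2))⁻¹

lemma riskScale_pos (d s : ℕ) (hℓ : 0 < ℓ) : 0 < riskScale d s ℓ := by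
  have : (0 : ℝ) < ℓ := by exact_mod_cast hℓ
  unfold riskScale
  positivity

/-- The quantities that a joint weight distribution condition compares, for normalized networks. -/
def jointSum (L₁ : Matrix (Fin ℓ) (Fin (n (d - 1))) ℝ) (L₂ : Matrix (Fin ℓ) (Fin (p (s - 1))) ℝ)
    (x v x' : Vec (n (d - 1))) (y y' : Vec (p (s - 1))) : ℝ :=
  4 * ℓ * ∑ j, selLayer L₁ x v j * layer L₁ x' j * (layer L₂ y j * layer L₂ y' j)

lemma riskDeriv_eq_jointSum (hℓ : 0 < ℓ) (h₀ h v : Vec (n 0)) (m₀ m : Vec (p 0)) :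
    riskDeriv (selNet n d ℓ W₁ L₁ h) (selNet p s ℓ W₂ L₂ m)
        (fun j => net n d ℓ W₁ L₁ h₀ j * net p s ℓ W₂ L₂ m₀ j) (h, m) (v, 0)
      = riskScale d s ℓ *
        (jointSum L₁ L₂ (nInner W₁ (d - 1) h) (nSel W₁ (d - 1) h v) (nInner W₁ (d - 1) h)
            (nInner W₂ (s - 1) m) (nInner W₂ (s - 1) m) -
          jointSum L₁ L₂ (nInner W₁ (d - 1) h) (nSel W₁ (d - 1) h v) (nInner W₁ (d - 1) h₀)
            (nInner W₂ (s - 1) m) (nInner W₂ (s - 1) m₀)) := by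
  have hℓ' : (ℓ : ℝ) ≠ 0 := by exact_mod_cast hℓ.ne'
  unfold jointSum riskScale riskDeriv
  rw [← mul_sub, ← Finset.sum_sub_distrib, Finset.mul_sum, Finset.mul_sum]
  refine Finset.sum_congr rfl fun j _ => ?_
  have h1 := (sqrt_two_pow_pos (d - 1)).ne'
  have h2 := (sqrt_two_pow_pos (s - 1)).ne'
  simp only [← sqrt_two_pow_mul_selNet, ← sqrt_two_pow_mul_net, selNet_self, map_zero,
    PiLp.zero_apply, mul_zero, add_zero]
  field_simp

/-- Real arithmetic behind `abs_riskDeriv_sub_gradLim_le`: two approximate products, and a joint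
error term. -/
lemma abs_prod_sub_prod_le {A A' C C' η α γ : ℝ} (h1 : |A - A'| ≤ η * α) (h2 : |C| ≤ 9 / 4 * γ)
    (h3 : |A'| ≤ α) (h4 : |C - C'| ≤ η * γ) : |A * C - A' * C'| ≤ 13 / 4 * η * (α * γ) := by
  have hα : 0 ≤ α := (abs_nonneg _).trans h3
  have hη : 0 ≤ η * α := (abs_nonneg _).trans h1
  have e : A * C - A' * C' = (A - A') * C + A' * (C - C') := by ring
  rw [e]
  refine (abs_add_le _ _).trans ?_
  rw [abs_mul, abs_mul]
  have a1 := mul_le_mul h1 h2 (abs_nonneg _) hη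
  have a2 := mul_le_mul h3 h4 (abs_nonneg _) hα
  linarith

set_option maxHeartbeats 1600000 in
/-- The derivative of the risk in the first variable is close to the pairing with the limiting
gradient, with an error of the order of `√δ` relative to the natural size of the gradient. -/
lemma abs_riskDeriv_sub_gradLim_le (hd : 2 ≤ d) (hs : 2 ≤ s) (hℓ : 0 < ℓ) (hdK : d - 1 ≤ K)
    (hsK : s - 1 ≤ K) (hδ : 0 ≤ δ) (hKδ : K * δ ≤ 1 / 4) (hW₁ : ∀ k < d - 1, WDC δ (W₁ k))
    (hW₂ : ∀ k < s - 1, WDC δ (W₂ k)) (hL : JointWDC δ L₁ L₂) {h : Vec (n 0)} {m : Vec (p 0)}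
    (h0 : h ≠ 0) (m0 : m ≠ 0) (h₀ v : Vec (n 0)) (m₀ : Vec (p 0)) :
    |riskDeriv (selNet n d ℓ W₁ L₁ h) (selNet p s ℓ W₂ L₂ m)
        (fun j => net n d ℓ W₁ L₁ h₀ j * net p s ℓ W₂ L₂ m₀ j) (h, m) (v, 0)
      - ⟪riskScale d s ℓ • gradLim d s h₀ m₀ (h, m), v⟫|
      ≤ riskScale d s ℓ * (100 * K ^ 2 * √δ) * (‖m‖ * (‖h‖ * ‖m‖ + ‖h₀‖ * ‖m₀‖)) * ‖v‖ := by
  have hκ := riskScale_pos d s hℓ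
  have hK1 : 1 ≤ K := by omega
  have hK1' : (1 : ℝ) ≤ K := by exact_mod_cast hK1
  have hdK' : ((d - 1 : ℕ) : ℝ) ≤ K := by exact_mod_cast hdK
  have hsK' : ((s - 1 : ℕ) : ℝ) ≤ K := by exact_mod_cast hsK
  have hδ4 : δ ≤ 1 / 4 := by nlinarith
  have hdδ : ((d - 1 : ℕ) : ℝ) * δ ≤ 1 / 4 := le_trans (by gcongr) hKδ
  have hsδ : ((s - 1 : ℕ) : ℝ) * δ ≤ 1 / 4 := le_trans (by gcongr) hKδ
  have hs1 : √δ ≤ 1 / 2 := by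
    rw [Real.sqrt_le_left (by norm_num)]
    linarith
  have hs0 := Real.sqrt_nonneg δ
  have hδs : δ ≤ √δ / 2 := by nlinarith [Real.mul_self_sqrt hδ]
  set E : ℝ := K ^ 2 * √δ with hE
  have hE0 : 0 ≤ E := by positivity
  have hKs : K * √δ ≤ E := by rw [hE]; nlinarith
  have hKδE : K * δ ≤ E / 2 := by nlinarith
  have hδE : δ ≤ E / 2 := by nlinarith
  set X := nInner W₁ (d - 1) h with hX
  set X₀ := nInner W₁ (d - 1) h₀ with hX₀
  set V := nSel W₁ (d - 1) h v with hV
  set Y := nInner W₂ (s - 1) m with hY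
  set Y₀ := nInner W₂ (s - 1) m₀ with hY₀
  have hXne : X ≠ 0 := nInner_ne_zero hW₁ hδ hdδ le_rfl h0
  have hYne : Y ≠ 0 := nInner_ne_zero hW₂ hδ hsδ le_rfl m0
  have hYb := nInner_bounds hW₂ hδ hsδ le_rfl m
  have hY₀b := nInner_bounds hW₂ hδ hsδ le_rfl m₀
  -- the four ingredients
  have j1 := hL X V X hXne Y Y
  have j2 := hL X V X₀ hXne Y Y₀
  have hVX : ‖V‖ * ‖X‖ ≤ 2 * (‖v‖ * ‖h‖) :=
    norm_nSel_mul_norm_nInner_le hW₁ hδ hdδ le_rfl h0 v h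
  have hVX₀ : ‖V‖ * ‖X₀‖ ≤ 2 * (‖v‖ * ‖h₀‖) :=
    norm_nSel_mul_norm_nInner_le hW₁ hδ hdδ le_rfl h0 v h₀
  have hYY : ‖Y‖ * ‖Y‖ ≤ 9 / 4 * (‖m‖ * ‖m‖) := by
    have := mul_self_le_mul_self (norm_nonneg _) hYb.2.2.1
    linarith
  have hYY₀ : ‖Y‖ * ‖Y₀‖ ≤ 9 / 4 * (‖m‖ * ‖m₀‖) := by
    have := mul_le_mul hYb.2.2.1 hY₀b.2.2.1 (norm_nonneg _) (by positivity)
    linarith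
  have iA : |⟪V, arcVec X X⟫ - ⟪v, h⟫| ≤ 22 * E * (‖v‖ * ‖h‖) := by
    rw [arcVec_self hXne]
    refine (abs_inner_nSel_nInner_sub_le hW₁ hδ hdδ le_rfl h0 v).trans ?_
    refine mul_le_mul_of_nonneg_right ?_ (by positivity)
    have hdE : ((d - 1 : ℕ) : ℝ) * δ ≤ E / 2 := le_trans (by gcongr) hKδE
    linarith
  have iB : |⟪V, arcVec X X₀⟫ - ⟪v, arcNet d h h₀⟫| ≤ 22 * E * (‖v‖ * ‖h₀‖) := by
    have h1 := abs_inner_nSel_arcVec_sub_le hW₁ hδ hdδ le_rfl (by omega) h0 v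
      (abs_inner_nSel_nInner_sub_arcNet_le hW₁ hδ hdδ le_rfl (by omega) h0 v h₀)
    rw [show d - 1 + 1 = d by omega] at h1
    refine h1.trans ?_
    refine mul_le_mul_of_nonneg_right ?_ (by positivity)
    have a1 : 12 * ((d - 1 : ℕ) : ℝ) * ((d - 1 : ℕ) : ℝ) * √δ ≤ 12 * K * K * √δ := by gcongr
    have a2 : 10 * ((d - 1 : ℕ) : ℝ) * √δ ≤ 10 * K * √δ := by gcongr
    have a3 : 12 * (K : ℝ) * K * √δ = 12 * E := by rw [hE]; ring
    have a4 : 10 * (K : ℝ) * √δ ≤ 10 * E := by linarith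
    linarith
  have iC : |⟪Y, arcVec Y Y⟫ - ‖m‖ ^ 2| ≤ 22 * E * (‖m‖ * ‖m‖) := by
    rw [arcVec_self hYne, real_inner_self_eq_norm_sq, ← pow_two]
    refine (abs_norm_nInner_sq_sub_le hW₂ hδ hsδ le_rfl m).trans ?_
    refine mul_le_mul_of_nonneg_right ?_ (by positivity)
    have hsE : ((s - 1 : ℕ) : ℝ) * δ ≤ E / 2 := le_trans (by gcongr) hKδE
    linarith
  have iD : |⟪Y, arcVec Y Y₀⟫
      - ‖m‖ * ‖m₀‖ * Real.cos (angleMap^[s] (InnerProductGeometry.angle m m₀))|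
      ≤ 22 * E * (‖m‖ * ‖m₀‖) := by
    rcases eq_or_ne m₀ 0 with rfl | m0'
    · rw [hY₀, nInner_zero_right, arcVec_zero_right]
      simp
    rw [inner_self_arcVec hYne]
    have hm := angle_mem_Icc m m₀
    have hmi := iterate_angleMap_mem hm (s - 1)
    have e : angleMap^[s] (InnerProductGeometry.angle m m₀)
        = angleMap (angleMap^[s - 1] (InnerProductGeometry.angle m m₀)) := by
      rw [← Function.iterate_succ_apply' angleMap, show (s - 1).succ = s by omega]
    rw [e, cos_angleMap hmi.1 hmi.2]
    set c := cosAngleMap (InnerProductGeometry.angle Y Y₀) with hc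
    set c' := cosAngleMap (angleMap^[s - 1] (InnerProductGeometry.angle m m₀)) with hc'
    have hcc : |c - c'| ≤ 5 * E := by
      refine (abs_cosAngleMap_sub_le (angle_mem_Icc _ _) hmi).trans ?_
      refine (abs_angle_nInner_sub_le hW₂ hδ hsδ le_rfl m0 m0').trans ?_
      have : 5 * ((s - 1 : ℕ) : ℝ) * √δ ≤ 5 * K * √δ := by gcongr
      linarith
    have hc1 : |c| ≤ 1 := abs_cosAngleMap_le (angle_mem_Icc _ _).1 (angle_mem_Icc _ _).2
    have e2 : ‖Y‖ * ‖Y₀‖ * c - ‖m‖ * ‖m₀‖ * c'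
        = (‖Y‖ - ‖m‖) * (‖Y₀‖ * c) + ‖m‖ * ((‖Y₀‖ - ‖m₀‖) * c) + ‖m‖ * ‖m₀‖ * (c - c') + 0 := by
      ring
    rw [e2]
    refine (abs_add_four_le _ _ _ _).trans ?_
    rw [abs_mul, abs_mul, abs_mul, abs_mul, abs_mul, abs_mul, abs_norm, abs_norm, abs_norm,
      abs_zero]
    have hsE : ((s - 1 : ℕ) : ℝ) * δ ≤ E / 2 := le_trans (by gcongr) hKδE
    have b1 : |‖Y‖ - ‖m‖| ≤ E * ‖m‖ := by
      refine hYb.1.trans ?_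
      gcongr
      linarith
    have b2 : |‖Y₀‖ - ‖m₀‖| ≤ E * ‖m₀‖ := by
      refine hY₀b.1.trans ?_
      gcongr
      linarith
    have c1 : |‖Y‖ - ‖m‖| * (‖Y₀‖ * |c|) ≤ (E * ‖m‖) * ((3 / 2 * ‖m₀‖) * 1) := by
      gcongr
      exact hY₀b.2.2.1
    have c2 : ‖m‖ * (|‖Y₀‖ - ‖m₀‖| * |c|) ≤ ‖m‖ * ((E * ‖m₀‖) * 1) := by gcongr
    have c3 : ‖m‖ * ‖m₀‖ * |c - c'| ≤ ‖m‖ * ‖m₀‖ * (5 * E) := by gcongr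
    have hpos : 0 ≤ E * (‖m‖ * ‖m₀‖) := by positivity
    linarith
  have p1 := abs_prod_sub_prod_le (γ := ‖m‖ * ‖m‖) iA (by
    rw [arcVec_self hYne, real_inner_self_eq_norm_sq, abs_of_nonneg (by positivity), pow_two]
    exact hYY) (abs_real_inner_le_norm v h) iC
  have p2 := abs_prod_sub_prod_le (γ := ‖m‖ * ‖m₀‖) iB (by
    rw [inner_self_arcVec hYne, abs_mul, abs_of_nonneg (by positivity)]
    have := abs_cosAngleMap_le (angle_mem_Icc Y Y₀).1 (angle_mem_Icc Y Y₀).2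
    have h5 : 0 ≤ ‖Y‖ * ‖Y₀‖ := by positivity
    nlinarith) ((abs_real_inner_le_norm v _).trans (by gcongr; exact norm_arcNet_le d h0 h₀)) iD
  have q1 : δ * (‖V‖ * ‖X‖ * (‖Y‖ * ‖Y‖)) ≤ 9 / 4 * E * ((‖v‖ * ‖h‖) * (‖m‖ * ‖m‖)) := by
    have := mul_le_mul hδE (mul_le_mul hVX hYY (by positivity) (by positivity)) (by positivity)
      (by positivity)
    linarith
  have q2 : δ * (‖V‖ * ‖X₀‖ * (‖Y‖ * ‖Y₀‖)) ≤ 9 / 4 * E * ((‖v‖ * ‖h₀‖) * (‖m‖ * ‖m₀‖)) := by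
    have := mul_le_mul hδE (mul_le_mul hVX₀ hYY₀ (by positivity) (by positivity)) (by positivity)
      (by positivity)
    linarith
  rw [riskDeriv_eq_jointSum hℓ, inner_smul_left, conj_trivial, ← mul_sub, abs_mul, abs_of_pos hκ,
    mul_assoc, mul_assoc]
  refine mul_le_mul_of_nonneg_left ?_ hκ.le
  have egrad : ⟪gradLim d s h₀ m₀ (h, m), v⟫ = ⟪v, h⟫ * ‖m‖ ^ 2 - ⟪v, arcNet d h h₀⟫ *
      (‖m‖ * ‖m₀‖ * Real.cos (angleMap^[s] (InnerProductGeometry.angle m m₀))) := by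
    rw [gradLim, inner_sub_left, inner_smul_left, inner_smul_left, real_inner_comm v,
      real_inner_comm v]
    simp only [conj_trivial]
    ring
  rw [egrad]
  unfold jointSum
  set S1 := 4 * (ℓ : ℝ) * ∑ j, selLayer L₁ X V j * layer L₁ X j * (layer L₂ Y j * layer L₂ Y j)
  set S2 := 4 * (ℓ : ℝ) * ∑ j, selLayer L₁ X V j * layer L₁ X₀ j * (layer L₂ Y j * layer L₂ Y₀ j)
  have u1 := abs_le.1 (j1.trans q1)
  have u2 := abs_le.1 (j2.trans q2)
  have u3 := abs_le.1 p1
  have u4 := abs_le.1 p2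
  have w1 : 0 ≤ E * ((‖v‖ * ‖h‖) * (‖m‖ * ‖m‖)) := by positivity
  have w2 : 0 ≤ E * ((‖v‖ * ‖h₀‖) * (‖m‖ * ‖m₀‖)) := by positivity
  have efin : 100 * (K : ℝ) ^ 2 * √δ * (‖m‖ * (‖h‖ * ‖m‖ + ‖h₀‖ * ‖m₀‖) * ‖v‖)
      = 100 * (E * ((‖v‖ * ‖h‖) * (‖m‖ * ‖m‖))) + 100 * (E * ((‖v‖ * ‖h₀‖) * (‖m‖ * ‖m₀‖))) := by
    rw [hE]
    ring
  rw [efin, abs_le]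
  constructor <;> linarith

/-- The outputs of two networks whose inner layers end with a rectification have positive
correlations. -/
lemma exists_le_sum_net (hd : 2 ≤ d) (hs : 2 ≤ s) (hℓ : 0 < ℓ) (hδ : 0 ≤ δ) (hδ1 : δ ≤ 1 / 20)
    (hdδ : ((d - 1 : ℕ) : ℝ) * δ ≤ 1 / 4) (hsδ : ((s - 1 : ℕ) : ℝ) * δ ≤ 1 / 4)
    (hW₁ : ∀ k < d - 1, WDC δ (W₁ k)) (hW₂ : ∀ k < s - 1, WDC δ (W₂ k)) (hL : JointWDC δ L₁ L₂)
    {h₀ : Vec (n 0)} {m₀ : Vec (p 0)} (h0 : h₀ ≠ 0) (m0 : m₀ ≠ 0) :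
    ∃ α : ℝ, 0 < α ∧ ∀ h m, α * (‖h‖ * ‖m‖) ≤ ∑ j,
      (net n d ℓ W₁ L₁ h₀ j * net p s ℓ W₂ L₂ m₀ j) *
        (net n d ℓ W₁ L₁ h j * net p s ℓ W₂ L₂ m j) := by
  have hκ := riskScale_pos d s hℓ
  have hh₀ : 0 < ‖h₀‖ := norm_pos_iff.2 h0
  have hm₀ : 0 < ‖m₀‖ := norm_pos_iff.2 m0
  refine ⟨riskScale d s ℓ * (1 / 20) * (‖h₀‖ / 2 * (‖m₀‖ / 2)) * (1 / 4), by positivity,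
    fun h m => ?_⟩
  have hnn : 0 ≤ ∑ j, (net n d ℓ W₁ L₁ h₀ j * net p s ℓ W₂ L₂ m₀ j) *
        (net n d ℓ W₁ L₁ h j * net p s ℓ W₂ L₂ m j) := by
    refine Finset.sum_nonneg fun j _ => ?_
    exact mul_nonneg (mul_nonneg (le_max_right _ _) (le_max_right _ _))
      (mul_nonneg (le_max_right _ _) (le_max_right _ _))
  rcases eq_or_ne h 0 with rfl | hne
  · simpa using hnn
  rcases eq_or_ne m 0 with rfl | mne
  · simpa using hnn
  set X := nInner W₁ (d - 1) h with hX
  set X₀ := nInner W₁ (d - 1) h₀ with hX₀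
  set Y := nInner W₂ (s - 1) m with hY
  set Y₀ := nInner W₂ (s - 1) m₀ with hY₀
  have hXne : X ≠ 0 := nInner_ne_zero hW₁ hδ hdδ le_rfl hne
  have hYne : Y ≠ 0 := nInner_ne_zero hW₂ hδ hsδ le_rfl mne
  have hXb := (nInner_bounds hW₁ hδ hdδ le_rfl h).2.1
  have hX₀b := (nInner_bounds hW₁ hδ hdδ le_rfl h₀).2.1
  have hYb := (nInner_bounds hW₂ hδ hsδ le_rfl m).2.1
  have hY₀b := (nInner_bounds hW₂ hδ hsδ le_rfl m₀).2.1
  have hcos : ∀ {q : ℕ → ℕ} (W : (i : ℕ) → Matrix (Fin (q (i + 1))) (Fin (q i)) ℝ) {k : ℕ}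
      (_ : 1 ≤ k) (x x' : Vec (q 0)),
      1 / Real.pi ≤ cosAngleMap (InnerProductGeometry.angle (nInner W k x) (nInner W k x')) := by
    intro q W k hk x x'
    have hin : 0 ≤ ⟪nInner W k x, nInner W k x'⟫ := by
      rw [PiLp.inner_apply]
      refine Finset.sum_nonneg fun i _ => ?_
      have hp : ∀ y : Vec (q 0), 0 ≤ nInner W k y i := by
        intro y
        obtain ⟨k', rfl⟩ : ∃ k', k = k' + 1 := ⟨k - 1, by omega⟩
        exact mul_nonneg (sqrt_two_pow_pos _).le (le_max_right _ _)
      simpa using mul_nonneg (hp x') (hp x)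
    have hle : InnerProductGeometry.angle (nInner W k x) (nInner W k x') ≤ Real.pi / 2 :=
      Real.arccos_le_pi_div_two.2 (by positivity)
    have h2 : cosAngleMap (Real.pi / 2) = 1 / Real.pi := by simp [cosAngleMap]
    rw [← h2]
    exact cosAngleMap_antitoneOn (angle_mem_Icc _ _)
      ⟨by positivity, by linarith [Real.pi_pos]⟩ hle
  have c1 := hcos W₁ (show 1 ≤ d - 1 by omega) h h₀
  have c2 := hcos W₂ (show 1 ≤ s - 1 by omega) m m₀
  have j1 := (abs_le.1 (hL X X X₀ hXne Y Y₀)).1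
  rw [inner_self_arcVec hXne, inner_self_arcVec hYne] at j1
  have hpi10 : 1 / 10 ≤ 1 / Real.pi * (1 / Real.pi) := by
    rw [one_div_mul_one_div, one_div_le_one_div (by norm_num) (by positivity)]
    nlinarith [Real.pi_lt_d2, Real.pi_pos]
  have c3 : 1 / 10 ≤ cosAngleMap (InnerProductGeometry.angle X X₀)
      * cosAngleMap (InnerProductGeometry.angle Y Y₀) :=
    hpi10.trans (mul_le_mul c1 c2 (by positivity) (le_trans (by positivity) c1))
  have hQ : 0 ≤ ‖X‖ * ‖X₀‖ * (‖Y‖ * ‖Y₀‖) := by positivity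
  have j2 : 1 / 20 * (‖X‖ * ‖X₀‖ * (‖Y‖ * ‖Y₀‖)) ≤ 4 * ↑ℓ * ∑ j, selLayer L₁ X X j *
      layer L₁ X₀ j * (layer L₂ Y j * layer L₂ Y₀ j) := by
    have a1 := mul_le_mul_of_nonneg_left c3 hQ
    have a2 := mul_le_mul_of_nonneg_right hδ1 hQ
    linarith
  have hℓ' : (ℓ : ℝ) ≠ 0 := by exact_mod_cast hℓ.ne'
  have e : ∑ j, (net n d ℓ W₁ L₁ h₀ j * net p s ℓ W₂ L₂ m₀ j) *
        (net n d ℓ W₁ L₁ h j * net p s ℓ W₂ L₂ m j)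
      = riskScale d s ℓ * (4 * ↑ℓ * ∑ j, selLayer L₁ X X j *
      layer L₁ X₀ j * (layer L₂ Y j * layer L₂ Y₀ j)) := by
    rw [selLayer_self, riskScale, Finset.mul_sum, Finset.mul_sum]
    refine Finset.sum_congr rfl fun j _ => ?_
    have h1 := (sqrt_two_pow_pos (d - 1)).ne'
    have h2 := (sqrt_two_pow_pos (s - 1)).ne'
    simp only [hX, hX₀, hY, hY₀, ← sqrt_two_pow_mul_net]
    field_simp
  rw [e, mul_assoc, mul_assoc, mul_assoc]
  refine mul_le_mul_of_nonneg_left (le_trans ?_ j2) hκ.le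
  have q : (‖h‖ / 2) * (‖h₀‖ / 2) * ((‖m‖ / 2) * (‖m₀‖ / 2)) ≤ ‖X‖ * ‖X₀‖ * (‖Y‖ * ‖Y₀‖) := by
    gcongr
  linarith

end Master

/-! ### Approximate zeros of the limiting gradient -/

lemma inner_self_arcNet {a : ℕ} (k : ℕ) {h : Vec a} (h0 : h ≠ 0) (h' : Vec a) :
    ⟪h, arcNet k h h'⟫
      = ‖h‖ * ‖h'‖ * Real.cos (angleMap^[k] (InnerProductGeometry.angle h h')) := by
  have hh : ‖h‖ ≠ 0 := norm_ne_zero_iff.2 h0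
  rw [← angProd_mul_cos_add_angSum (angle_mem_Icc h h'), arcNet, inner_add_right,
    inner_smul_right, inner_smul_right, real_inner_self_eq_norm_sq,
    ← InnerProductGeometry.cos_angle_mul_norm_mul_norm h h']
  field_simp

lemma inner_gradLim_self {a b : ℕ} (d s : ℕ) (h₀ : Vec a) (m₀ : Vec b) {h : Vec a} (h0 : h ≠ 0)
    (m : Vec b) : ⟪h, gradLim d s h₀ m₀ (h, m)⟫ = ‖h‖ * ‖m‖ * (‖h‖ * ‖m‖ - ‖h₀‖ * ‖m₀‖ *
      (Real.cos (angleMap^[d] (InnerProductGeometry.angle h h₀)) *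
        Real.cos (angleMap^[s] (InnerProductGeometry.angle m m₀)))) := by
  rw [gradLim, inner_sub_right, inner_smul_right, inner_smul_right, inner_self_arcNet _ h0,
    real_inner_self_eq_norm_sq]
  ring

/-- The component of the limiting gradient orthogonal to `h` controls `sin θ`. -/
lemma cos_mul_angProd_mul_sin_le {a b : ℕ} (d s : ℕ) (h₀ : Vec a) (m₀ : Vec b) {h : Vec a}
    {m : Vec b} (h0 : h ≠ 0) (m0 : m ≠ 0) {R : ℝ}
    (hR : ‖gradLim d s h₀ m₀ (h, m)‖ ≤ ‖m‖ * R) :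
    ‖h₀‖ * ‖m₀‖ * (Real.cos (angleMap^[s] (InnerProductGeometry.angle m m₀)) *
      (angProd (InnerProductGeometry.angle h h₀) d *
        Real.sin (InnerProductGeometry.angle h h₀))) ≤ R := by
  have hh : 0 < ‖h‖ := norm_pos_iff.2 h0
  have hm : 0 < ‖m‖ := norm_pos_iff.2 m0
  set θ := InnerProductGeometry.angle h h₀ with hθ
  set c := Real.cos (angleMap^[s] (InnerProductGeometry.angle m m₀)) with hc
  have hR0 : 0 ≤ R := by
    by_contra hneg
    have := (norm_nonneg _).trans hR
    nlinarith
  have hsin : 0 ≤ Real.sin θ := InnerProductGeometry.sin_angle_nonneg _ _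
  -- `w` is the component of `h₀` orthogonal to `h`; its norm is `‖h₀‖ sin θ`
  set w := h₀ - (⟪h, h₀⟫ / ‖h‖ ^ 2) • h with hw
  have hcos : ⟪h, h₀⟫ = Real.cos θ * (‖h‖ * ‖h₀‖) :=
    (InnerProductGeometry.cos_angle_mul_norm_mul_norm h h₀).symm
  have hwh : ⟪w, h⟫ = 0 := by
    rw [hw, inner_sub_left, inner_smul_left, real_inner_self_eq_norm_sq, real_inner_comm]
    simp only [conj_trivial]
    field_simp
    ring
  have hwh₀ : ⟪w, h₀⟫ = (‖h₀‖ * Real.sin θ) ^ 2 := by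
    rw [hw, inner_sub_left, inner_smul_left, real_inner_self_eq_norm_sq, hcos, mul_pow,
      Real.sin_sq]
    simp only [conj_trivial]
    field_simp
  have hww : ‖w‖ = ‖h₀‖ * Real.sin θ := by
    have h1 : ‖w‖ ^ 2 = (‖h₀‖ * Real.sin θ) ^ 2 := by
      rw [← hwh₀, ← real_inner_self_eq_norm_sq]
      conv_lhs => rw [hw, inner_sub_right, ← hw, inner_smul_right, hwh, mul_zero, sub_zero]
    exact (pow_left_inj₀ (norm_nonneg _) (by positivity) two_ne_zero).1 h1
  have hgw : ⟪w, gradLim d s h₀ m₀ (h, m)⟫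
      = -(‖m‖ * ‖m₀‖ * c * angProd θ d * (‖h₀‖ * Real.sin θ) ^ 2) := by
    rw [gradLim, arcNet, inner_sub_right, inner_smul_right, inner_smul_right, inner_add_right,
      inner_smul_right, inner_smul_right, hwh, hwh₀]
    ring
  have hle := (abs_real_inner_le_norm w (gradLim d s h₀ m₀ (h, m))).trans
    (mul_le_mul_of_nonneg_left hR (norm_nonneg _))
  rw [hgw, hww, abs_neg] at hle
  have hle2 := (le_abs_self _).trans hle
  rcases (mul_nonneg (norm_nonneg h₀) hsin).eq_or_lt with h1 | h1
  · have : ‖h₀‖ * ‖m₀‖ * (c * (angProd θ d * Real.sin θ))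
        = ‖m₀‖ * c * angProd θ d * (‖h₀‖ * Real.sin θ) := by ring
    rw [this, ← h1, mul_zero]
    exact hR0
  · have h2 : ‖m‖ * (‖h₀‖ * Real.sin θ) *
        (‖h₀‖ * ‖m₀‖ * (c * (angProd θ d * Real.sin θ))) ≤ ‖m‖ * (‖h₀‖ * Real.sin θ) * R := by
      linarith
    exact le_of_mul_le_mul_left h2 (by positivity)

lemma le_or_pi_sub_le_of_mul_sin_le {θ b : ℝ} (h : θ ∈ Set.Icc 0 Real.pi) {ω : ℝ} (hω0 : 0 ≤ ω)
    (hω : ω ≤ 1) (hb : b ≤ (ω / 4) ^ 2) (hs : (1 - θ / Real.pi) * Real.sin θ ≤ b) :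
    θ ≤ ω ∨ Real.pi - θ ≤ ω := by
  have hpi := Real.pi_pos
  have hpi4 := Real.pi_lt_d2
  have hpi3 := Real.pi_gt_three
  rcases le_total θ (Real.pi / 2) with h1 | h1
  · left
    have h2 := Real.mul_le_sin h.1 h1
    have h3 : 1 / 2 ≤ 1 - θ / Real.pi := by
      rw [le_sub_comm, div_le_iff₀ hpi]
      linarith
    have h4 : 1 / 2 * (2 / Real.pi * θ) ≤ (ω / 4) ^ 2 :=
      (mul_le_mul h3 h2 (by have := h.1; positivity) (by linarith)).trans (hs.trans hb)
    have h5 : θ ≤ Real.pi * (ω / 4) ^ 2 := by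
      have := mul_le_mul_of_nonneg_left h4 hpi.le
      field_simp at this
      nlinarith
    nlinarith
  · right
    have h2 := Real.mul_le_sin (x := Real.pi - θ) (by linarith [h.2]) (by linarith)
    rw [Real.sin_pi_sub] at h2
    have h3 : 1 - θ / Real.pi = (Real.pi - θ) / Real.pi := by field_simp
    rw [h3] at hs
    have h30 : 0 ≤ (Real.pi - θ) / Real.pi := div_nonneg (by linarith [h.2]) hpi.le
    have h4 := (mul_le_mul_of_nonneg_left h2 h30).trans (hs.trans hb)
    have h5 : 2 * ((Real.pi - θ) / Real.pi) ^ 2 ≤ (ω / 4) ^ 2 := by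
      refine le_trans (le_of_eq ?_) h4
      field_simp
    have h6 : (Real.pi - θ) / Real.pi ≤ ω / 4 := by
      refine le_of_sq_le_sq ?_ (by positivity)
      nlinarith [sq_nonneg ((Real.pi - θ) / Real.pi)]
    rw [div_le_iff₀ hpi] at h6
    nlinarith

lemma norm_sub_smul_le_of_angle_le {a : ℕ} {x y : Vec a} (y0 : y ≠ 0) {ω : ℝ}
    (h : InnerProductGeometry.angle x y ≤ ω) : ‖x - (‖x‖ / ‖y‖) • y‖ ≤ ω * ‖x‖ := by
  have hy : 0 < ‖y‖ := norm_pos_iff.2 y0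
  have h0 := InnerProductGeometry.angle_nonneg x y
  refine le_of_sq_le_sq ?_ (mul_nonneg (h0.trans h) (norm_nonneg _))
  rw [norm_sub_sq_real, inner_smul_right, ← InnerProductGeometry.cos_angle_mul_norm_mul_norm x y,
    norm_smul, Real.norm_eq_abs, abs_of_nonneg (by positivity)]
  have h1 := Real.one_sub_sq_div_two_le_cos (x := InnerProductGeometry.angle x y)
  have h2 : InnerProductGeometry.angle x y ^ 2 ≤ ω ^ 2 := by gcongr
  have e : ‖x‖ ^ 2 - 2 * (‖x‖ / ‖y‖ * (Real.cos (InnerProductGeometry.angle x y) * (‖x‖ * ‖y‖)))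
      + (‖x‖ / ‖y‖ * ‖y‖) ^ 2 = (2 - 2 * Real.cos (InnerProductGeometry.angle x y)) * ‖x‖ ^ 2 := by
    field_simp
    ring
  rw [e, mul_pow]
  refine mul_le_mul_of_nonneg_right ?_ (sq_nonneg _)
  linarith

/-- Sufficient conditions for membership in a hyperbolic neighborhood in terms of angles and of the
products of the norms. -/
lemma mem_hyperbolicNhd {a b : ℕ} {h h' : Vec a} {m m' : Vec b} (h0 : h ≠ 0)
    (h0' : h' ≠ 0) (m0' : m' ≠ 0) {ω r : ℝ} (hω0 : 0 ≤ ω) (hω : ω ≤ 1)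
    (hr : 64 * ω ≤ r) (hh : InnerProductGeometry.angle h h' ≤ ω)
    (hm : InnerProductGeometry.angle m m' ≤ ω)
    (hN : |‖h‖ * ‖m‖ - ‖h'‖ * ‖m'‖| ≤ 30 * ω * (‖h'‖ * ‖m'‖)) :
    (h, m) ∈ hyperbolicNhd r h' m' := by
  have p1 : 0 < ‖h‖ := norm_pos_iff.2 h0
  have p3 : 0 < ‖h'‖ := norm_pos_iff.2 h0'
  have p4 : 0 < ‖m'‖ := norm_pos_iff.2 m0'
  refine ⟨‖h‖ / ‖h'‖, by positivity, ?_⟩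
  set B := ‖h'‖ * ‖m'‖ / ‖h‖ with hB
  have hB0 : 0 < B := by positivity
  have n1 : ‖(‖h‖ / ‖h'‖) • h'‖ = ‖h‖ := by
    rw [norm_smul, Real.norm_eq_abs, abs_of_nonneg (by positivity)]
    field_simp
  have n2 : ‖(‖h‖ / ‖h'‖)⁻¹ • m'‖ = B := by
    rw [norm_smul, Real.norm_eq_abs, abs_of_nonneg (by positivity), hB]
    field_simp
  have q1 := norm_sub_smul_le_of_angle_le h0' hh
  have q2 := norm_sub_smul_le_of_angle_le m0' hm
  have q3 : |‖m‖ - B| ≤ 30 * ω * B := by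
    have e : ‖m‖ - B = (‖h‖ * ‖m‖ - ‖h'‖ * ‖m'‖) / ‖h‖ := by rw [hB]; field_simp
    rw [e, abs_div, abs_of_pos p1, div_le_iff₀ p1]
    refine hN.trans (le_of_eq ?_)
    rw [hB]
    field_simp
  have q4 : ‖m - (‖h‖ / ‖h'‖)⁻¹ • m'‖ ≤ 61 * ω * B := by
    have e : m - (‖h‖ / ‖h'‖)⁻¹ • m'
        = (m - (‖m‖ / ‖m'‖) • m') + ((‖m‖ - B) / ‖m'‖) • m' := by
      rw [sub_div, sub_smul, hB]
      have : ‖h'‖ * ‖m'‖ / ‖h‖ / ‖m'‖ = (‖h‖ / ‖h'‖)⁻¹ := by field_simp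
      rw [this]
      abel
    have e2 : ‖((‖m‖ - B) / ‖m'‖) • m'‖ = |‖m‖ - B| := by
      rw [norm_smul, Real.norm_eq_abs, abs_div, abs_of_pos p4]
      field_simp
    rw [e]
    refine (norm_add_le _ _).trans ?_
    rw [e2]
    have q5 := (abs_le.1 q3).2
    have q6 : ω * ‖m‖ ≤ ω * (31 * B) := by
      refine mul_le_mul_of_nonneg_left ?_ hω0
      nlinarith
    linarith
  have hr0 : 0 ≤ r := by linarith
  rw [WithLp.prod_norm_eq_of_L2, WithLp.prod_norm_eq_of_L2]
  rw [← Real.sqrt_sq hr0, ← Real.sqrt_mul (sq_nonneg r)]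
  refine Real.sqrt_le_sqrt ?_
  change ‖h - (‖h‖ / ‖h'‖) • h'‖ ^ 2 + ‖m - (‖h‖ / ‖h'‖)⁻¹ • m'‖ ^ 2
    ≤ r ^ 2 * (‖(‖h‖ / ‖h'‖) • h'‖ ^ 2 + ‖(‖h‖ / ‖h'‖)⁻¹ • m'‖ ^ 2)
  rw [n1, n2]
  have s1 : ‖h - (‖h‖ / ‖h'‖) • h'‖ ≤ r * ‖h‖ := by
    refine q1.trans ?_
    gcongr
    linarith
  have s2 : ‖m - (‖h‖ / ‖h'‖)⁻¹ • m'‖ ≤ r * B := by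
    refine q4.trans ?_
    gcongr
    linarith
  have t1 := pow_le_pow_left₀ (norm_nonneg _) s1 2
  have t2 := pow_le_pow_left₀ (norm_nonneg _) s2 2
  rw [mul_add, ← mul_pow, ← mul_pow]
  exact add_le_add t1 t2

/-- If the component of the limiting gradient is small, then the angle is close to `0` or to `π`. -/
lemma angle_close_of_norm_gradLim_le {a b : ℕ} {d s : ℕ} (hd : 2 ≤ d) (hs : 2 ≤ s) {h h₀ : Vec a}
    {m m₀ : Vec b} (h0 : h ≠ 0) (m0 : m ≠ 0) (h₀0 : h₀ ≠ 0) (m₀0 : m₀ ≠ 0) {β ω : ℝ}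
    (hβ : 0 ≤ β) (hω0 : 0 ≤ ω) (hω : ω ≤ 1) (hβω : 10 * β * d ^ 5 ≤ (ω / 4) ^ 2)
    (hR : ‖gradLim d s h₀ m₀ (h, m)‖ ≤ ‖m‖ * (β * (‖h‖ * ‖m‖ + ‖h₀‖ * ‖m₀‖))) :
    |‖h‖ * ‖m‖ - ‖h₀‖ * ‖m₀‖ *
      (Real.cos (angleMap^[d] (InnerProductGeometry.angle h h₀)) *
        Real.cos (angleMap^[s] (InnerProductGeometry.angle m m₀)))| ≤ ω * (‖h₀‖ * ‖m₀‖) ∧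
    (InnerProductGeometry.angle h h₀ ≤ ω ∨ Real.pi - InnerProductGeometry.angle h h₀ ≤ ω) := by
  have p1 : 0 < ‖h‖ := norm_pos_iff.2 h0
  have p2 : 0 < ‖m‖ := norm_pos_iff.2 m0
  have p3 : 0 < ‖h₀‖ := norm_pos_iff.2 h₀0
  have p4 : 0 < ‖m₀‖ := norm_pos_iff.2 m₀0
  set θ := InnerProductGeometry.angle h h₀ with hθ
  set φ := InnerProductGeometry.angle m m₀ with hφ
  have hd1 : (2 : ℝ) ≤ d := by exact_mod_cast hd
  have hd5 : (1 : ℝ) ≤ (d : ℝ) ^ 5 := one_le_pow₀ (by linarith)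
  have hβ16 : 160 * β ≤ ω ^ 2 := by nlinarith
  have hωsq : ω ^ 2 ≤ ω := by nlinarith
  have hβ1 : 160 * β ≤ ω := by linarith
  set N := ‖h‖ * ‖m‖ with hN
  set N₀ := ‖h₀‖ * ‖m₀‖ with hN₀
  have hNp : 0 < N := by positivity
  have hN₀p : 0 < N₀ := by positivity
  have hc1 := cos_iterate_angleMap_ge (angle_mem_Icc h h₀) hd
  have hc2 := cos_iterate_angleMap_ge (angle_mem_Icc m m₀) hs
  rw [← hθ] at hc1
  rw [← hφ] at hc2
  have hpi := Real.pi_pos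
  have hpi4 := Real.pi_lt_d2
  set C := Real.cos (angleMap^[d] θ) * Real.cos (angleMap^[s] φ) with hC
  have hpi1 : 0 < 1 / Real.pi := by positivity
  have hC1 : C ≤ 1 := mul_le_one₀ (Real.cos_le_one _) (by linarith) (Real.cos_le_one _)
  have hself := inner_gradLim_self d s h₀ m₀ h0 m
  have hle := (abs_real_inner_le_norm h (gradLim d s h₀ m₀ (h, m))).trans
    (mul_le_mul_of_nonneg_left hR (norm_nonneg _))
  rw [hself, abs_mul, abs_of_pos (by positivity), ← mul_assoc ‖h‖ ‖m‖ (β * _)] at hle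
  have hle2 : |N - N₀ * C| ≤ β * (N + N₀) := le_of_mul_le_mul_left hle hNp
  have hN2 : N ≤ 2 * N₀ := by
    have := (abs_le.1 hle2).2
    nlinarith
  refine ⟨hle2.trans ?_, ?_⟩
  · have : β * (N + N₀) ≤ β * (3 * N₀) := by gcongr; linarith
    nlinarith
  have hsin := cos_mul_angProd_mul_sin_le d s h₀ m₀ h0 m0 hR
  rw [← hθ, ← hφ, ← hN₀] at hsin
  have hsn : 0 ≤ Real.sin θ := InnerProductGeometry.sin_angle_nonneg _ _
  have hPge := angProd_ge (angle_mem_Icc h h₀) (show 1 ≤ d by omega)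
  rw [← hθ] at hPge
  have h1θ := one_sub_div_pi_nonneg (angle_mem_Icc h h₀)
  rw [← hθ] at h1θ
  have hP0 : 0 ≤ angProd θ d * Real.sin θ :=
    mul_nonneg (le_trans (by positivity) hPge) hsn
  have k1 : Real.cos (angleMap^[s] φ) * (angProd θ d * Real.sin θ) ≤ 3 * β := by
    refine le_of_mul_le_mul_left (a := N₀) ?_ hN₀p
    refine hsin.trans ?_
    have : β * (N + N₀) ≤ β * (3 * N₀) := by gcongr; linarith
    linarith
  have k2 : 1 / Real.pi * (angProd θ d * Real.sin θ) ≤ 3 * β :=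
    (mul_le_mul_of_nonneg_right hc2 hP0).trans k1
  have k3 : angProd θ d * Real.sin θ ≤ 10 * β := by
    have := mul_le_mul_of_nonneg_left k2 hpi.le
    rw [← mul_assoc, mul_one_div_cancel hpi.ne', one_mul] at this
    nlinarith
  have k4 : (1 - θ / Real.pi) * Real.sin θ ≤ 10 * β * d ^ 5 := by
    have k5 := (mul_le_mul_of_nonneg_right hPge hsn).trans k3
    have k6 := mul_le_mul_of_nonneg_right k5 (show (0 : ℝ) ≤ (d : ℝ) ^ 5 by positivity)
    refine le_trans (le_of_eq ?_) k6
    field_simp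
  exact le_or_pi_sub_le_of_mul_sin_le (angle_mem_Icc h h₀) hω0 hω hβω k4

lemma abs_cos_iterate_angleMap_sub_le {x y ω : ℝ} (hx : x ∈ Set.Icc 0 Real.pi)
    (hy : y ∈ Set.Icc 0 Real.pi) (h : |x - y| ≤ ω) (k : ℕ) :
    |Real.cos (angleMap^[k] x) - Real.cos (angleMap^[k] y)| ≤ ω :=
  (Real.abs_cos_sub_cos_le _ _).trans ((abs_iterate_angleMap_sub_le hx hy k).trans h)

/-- A vector whose angle to `x₀` is almost `0` or `π` almost points in the direction `σ x₀`, and the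
cosine of the iterated angle is close to the limiting value `τ`, which is `1` or `ρ_k`. -/
lemma exists_sign_of_angle_close {a k : ℕ} (hk : 2 ≤ k) (x x₀ : Vec a) {ω : ℝ}
    (h : InnerProductGeometry.angle x x₀ ≤ ω ∨ Real.pi - InnerProductGeometry.angle x x₀ ≤ ω) :
    ∃ σ τ : ℝ, (σ = 1 ∧ τ = 1 ∨ σ = -1 ∧ τ = rho k) ∧
      InnerProductGeometry.angle x (σ • x₀) ≤ ω ∧
      |Real.cos (angleMap^[k] (InnerProductGeometry.angle x x₀)) - τ| ≤ ω := by
  have hm := angle_mem_Icc x x₀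
  have hpi := Real.pi_pos
  rcases h with h | h
  · refine ⟨1, 1, Or.inl ⟨rfl, rfl⟩, by simpa using h, ?_⟩
    have := abs_cos_iterate_angleMap_sub_le (ω := ω) hm (y := 0) ⟨le_rfl, hpi.le⟩
      (by rwa [sub_zero, abs_of_nonneg hm.1]) k
    rwa [iterate_angleMap_zero, Real.cos_zero] at this
  · refine ⟨-1, rho k, Or.inr ⟨rfl, rfl⟩, ?_, ?_⟩
    · rw [neg_smul, one_smul, InnerProductGeometry.angle_neg_right]
      exact h
    · rw [rho_eq_cos (by omega)]
      exact abs_cos_iterate_angleMap_sub_le hm ⟨hpi.le, le_rfl⟩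
        (by rw [abs_sub_comm, abs_of_nonneg (by linarith [hm.2])]; exact h) k

/-- Points where both components of the limiting gradient are small lie in one of the four
hyperbolic neighborhoods. -/
lemma mem_fourNhds_of_norm_gradLim_le {a b : ℕ} {d s : ℕ} (hd : 2 ≤ d) (hs : 2 ≤ s) {h h₀ : Vec a}
    {m m₀ : Vec b} (h0 : h ≠ 0) (m0 : m ≠ 0) (h₀0 : h₀ ≠ 0) (m₀0 : m₀ ≠ 0) {β ε : ℝ}
    (hβ : 0 ≤ β) (hω0 : 0 ≤ ε ^ (1 / 4 : ℝ)) (hω : ε ^ (1 / 4 : ℝ) ≤ 1)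
    (hβd : 10 * β * d ^ 5 ≤ (ε ^ (1 / 4 : ℝ) / 4) ^ 2)
    (hβs : 10 * β * s ^ 5 ≤ (ε ^ (1 / 4 : ℝ) / 4) ^ 2)
    (hR₁ : ‖gradLim d s h₀ m₀ (h, m)‖ ≤ ‖m‖ * (β * (‖h‖ * ‖m‖ + ‖h₀‖ * ‖m₀‖)))
    (hR₂ : ‖gradLim s d m₀ h₀ (m, h)‖ ≤ ‖h‖ * (β * (‖h‖ * ‖m‖ + ‖h₀‖ * ‖m₀‖))) :
    (h, m) ∈ fourNhds 1 ε d s h₀ m₀ := by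
  set ω := ε ^ (1 / 4 : ℝ) with hωdef
  have p3 : 0 < ‖h₀‖ := norm_pos_iff.2 h₀0
  have p4 : 0 < ‖m₀‖ := norm_pos_iff.2 m₀0
  obtain ⟨hN, hang₁⟩ := angle_close_of_norm_gradLim_le hd hs h0 m0 h₀0 m₀0 hβ hω0 hω hβd hR₁
  obtain ⟨-, hang₂⟩ := angle_close_of_norm_gradLim_le hs hd m0 h0 m₀0 h₀0 hβ hω0 hω hβs
    (by rw [mul_comm ‖m‖, mul_comm ‖m₀‖]; exact hR₂)
  obtain ⟨σ₁, τ₁, hστ₁, ha₁, hc₁⟩ := exists_sign_of_angle_close hd h h₀ hang₁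
  obtain ⟨σ₂, τ₂, hστ₂, ha₂, hc₂⟩ := exists_sign_of_angle_close hs m m₀ hang₂
  have hpi4 := Real.pi_lt_d2
  have hpi1 : 1 / 3.15 ≤ 1 / Real.pi := one_div_le_one_div_of_le Real.pi_pos hpi4.le
  have hτ : ∀ {σ τ : ℝ} {k : ℕ}, 2 ≤ k → (σ = 1 ∧ τ = 1 ∨ σ = -1 ∧ τ = rho k) →
      1 / 3.15 ≤ τ ∧ τ ≤ 1 ∧ |σ| = 1 := by
    rintro σ τ k hk (⟨rfl, rfl⟩ | ⟨rfl, rfl⟩)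
    · norm_num
    · exact ⟨hpi1.trans (rho_ge hk), rho_le_one (by omega), by simp⟩
  obtain ⟨t1, t1', e1⟩ := hτ hd hστ₁
  obtain ⟨t2, t2', e2⟩ := hτ hs hστ₂
  have ht10 : 1 / 10 ≤ τ₁ * τ₂ := by
    have := mul_le_mul t1 t2 (by norm_num) (by linarith [show (0 : ℝ) < 1 / 3.15 by norm_num])
    norm_num at this ⊢
    linarith
  have htpos : 0 < τ₁ * τ₂ := by linarith
  have hprod : |Real.cos (angleMap^[d] (InnerProductGeometry.angle h h₀)) *
        Real.cos (angleMap^[s] (InnerProductGeometry.angle m m₀)) - τ₁ * τ₂| ≤ 2 * ω := by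
    set c₁ := Real.cos (angleMap^[d] (InnerProductGeometry.angle h h₀))
    set c₂ := Real.cos (angleMap^[s] (InnerProductGeometry.angle m m₀)) with hc₂'
    have e : c₁ * c₂ - τ₁ * τ₂ = (c₁ - τ₁) * c₂ + τ₁ * (c₂ - τ₂) := by ring
    rw [e]
    refine (abs_add_le _ _).trans ?_
    rw [abs_mul, abs_mul]
    have b1 := mul_le_mul hc₁ (Real.abs_cos_le_one
      (angleMap^[s] (InnerProductGeometry.angle m m₀))) (abs_nonneg _) hω0
    have b2 : |τ₁| ≤ 1 := by
      rw [abs_of_nonneg (by linarith [show (0 : ℝ) < 1 / 3.15 by norm_num])]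
      exact t1'
    have b3 := mul_le_mul b2 hc₂ (abs_nonneg _) zero_le_one
    linarith
  have hN3 : |‖h‖ * ‖m‖ - ‖h₀‖ * ‖m₀‖ * (τ₁ * τ₂)| ≤ 3 * ω * (‖h₀‖ * ‖m₀‖) := by
    have hN₀ : 0 < ‖h₀‖ * ‖m₀‖ := by positivity
    have b := mul_le_mul_of_nonneg_left hprod hN₀.le
    rw [← abs_of_pos hN₀, ← abs_mul, abs_of_pos hN₀, mul_sub] at b
    have b1 := abs_le.1 b
    have b2 := abs_le.1 hN
    rw [abs_le]
    constructor <;> linarith [b1.1, b1.2, b2.1, b2.2]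
  have hmem : ∀ r, 64 * ω ≤ r → (h, m) ∈ hyperbolicNhd r ((σ₁ * (τ₁ * τ₂)) • h₀) (σ₂ • m₀) := by
    intro r hr
    have hσ₁ : σ₁ ≠ 0 := by
      rintro rfl
      simp at e1
    have hσ₂ : σ₂ ≠ 0 := by
      rintro rfl
      simp at e2
    refine mem_hyperbolicNhd h0 (smul_ne_zero (mul_ne_zero hσ₁ htpos.ne') h₀0)
      (smul_ne_zero hσ₂ m₀0) hω0 hω hr ?_ ha₂ ?_
    · rw [mul_comm, mul_smul, InnerProductGeometry.angle_smul_right_of_pos _ _ htpos]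
      exact ha₁
    · rw [norm_smul, norm_smul, Real.norm_eq_abs, Real.norm_eq_abs, abs_mul, e1, e2,
        abs_of_pos htpos]
      have e : 1 * (τ₁ * τ₂) * ‖h₀‖ * (1 * ‖m₀‖) = ‖h₀‖ * ‖m₀‖ * (τ₁ * τ₂) := by ring
      rw [e]
      refine hN3.trans ?_
      have : 0 ≤ ω * (‖h₀‖ * ‖m₀‖) := by positivity
      nlinarith
  have hd1 : (2 : ℝ) ≤ d := by exact_mod_cast hd
  have hs1 : (2 : ℝ) ≤ s := by exact_mod_cast hs
  have hd3 : (8 : ℝ) ≤ (d : ℝ) ^ 3 := by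
    have := pow_le_pow_left₀ (by norm_num) hd1 3
    linarith
  have hs3 : (8 : ℝ) ≤ (s : ℝ) ^ 3 := by
    have := pow_le_pow_left₀ (by norm_num) hs1 3
    linarith
  have hd8 : (8 : ℝ) ≤ (d : ℝ) ^ 8 := by
    have := pow_le_pow_left₀ (by norm_num) hd1 8
    linarith
  have hs8 : (8 : ℝ) ≤ (s : ℝ) ^ 8 := by
    have := pow_le_pow_left₀ (by norm_num) hs1 8
    linarith
  have hrad : ∀ {A B : ℝ}, 8 ≤ A → 8 ≤ B → 64 * ω ≤ 1 * A * B * ω := by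
    intro A B hA hB
    refine mul_le_mul_of_nonneg_right ?_ hω0
    nlinarith
  unfold fourNhds
  rw [← hωdef]
  rcases hστ₁ with ⟨rfl, rfl⟩ | ⟨rfl, rfl⟩ <;> rcases hστ₂ with ⟨rfl, rfl⟩ | ⟨rfl, rfl⟩
  · refine Or.inl (Or.inl (Or.inl ?_))
    simpa using hmem _ (hrad hd3 hs3)
  · refine Or.inl (Or.inr ?_)
    simpa using hmem _ (hrad hd3 hs8)
  · refine Or.inl (Or.inl (Or.inr ?_))
    simpa using hmem _ (hrad hd8 hs3)
  · refine Or.inr ?_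
    simpa using hmem _ (hrad hd8 hs8)

/-! ### The landscape under the weight distribution conditions -/

lemma riskDeriv_comm {a b ℓ : ℕ} (M₁ : Vec a →ₗ[ℝ] Vec ℓ) (M₂ : Vec b →ₗ[ℝ] Vec ℓ)
    (y₁ : Fin ℓ → ℝ) (y₂ : Fin ℓ → ℝ) (z v : Vec a × Vec b) :
    riskDeriv M₁ M₂ (fun j => y₁ j * y₂ j) z v
      = riskDeriv M₂ M₁ (fun j => y₂ j * y₁ j) z.swap v.swap := by
  unfold riskDeriv
  refine Finset.sum_congr rfl fun j _ => ?_
  simp only [Prod.fst_swap, Prod.snd_swap]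
  ring

section Deterministic

variable {n p : ℕ → ℕ} {d s ℓ : ℕ} {W₁ : (i : ℕ) → Matrix (Fin (n (i + 1))) (Fin (n i)) ℝ}
  {L₁ : Matrix (Fin ℓ) (Fin (n (d - 1))) ℝ} {W₂ : (i : ℕ) → Matrix (Fin (p (i + 1))) (Fin (p i)) ℝ}
  {L₂ : Matrix (Fin ℓ) (Fin (p (s - 1))) ℝ} {δ : ℝ} {K : ℕ}

/-- Where the first component of the limiting gradient is large, the risk decreases along the
negative one-sided partial gradient in the first variable. -/
lemma exists_descent_fst (hd : 2 ≤ d) (hs : 2 ≤ s) (hℓ : 0 < ℓ) (hdK : d - 1 ≤ K)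
    (hsK : s - 1 ≤ K) (hδ : 0 < δ) (hKδ : K * δ ≤ 1 / 4) (hW₁ : ∀ k < d - 1, WDC δ (W₁ k))
    (hW₂ : ∀ k < s - 1, WDC δ (W₂ k)) (hL : JointWDC δ L₁ L₂) {h₀ : Vec (n 0)} {m₀ : Vec (p 0)}
    {z w : Vec (n 0) × Vec (p 0)} (hz1 : z.1 ≠ 0) (hz2 : z.2 ≠ 0) {v : Vec (n 0)}
    (hT : ‖z.2‖ * (3 * (100 * K ^ 2 * √δ) * (‖z.1‖ * ‖z.2‖ + ‖h₀‖ * ‖m₀‖))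
      ≤ ‖gradLim d s h₀ m₀ z‖)
    (hv : ∀ x, ∃ M₁ M₂, (∀ᶠ q in rayFilter,
      selNet n d ℓ W₁ L₁ (z + q.1 • w + q.2 • ((x, 0) : Vec (n 0) × Vec (p 0))).1 = M₁ ∧
      selNet p s ℓ W₂ L₂ (z + q.1 • w + q.2 • ((x, 0) : Vec (n 0) × Vec (p 0))).2 = M₂) ∧
      ⟪v, x⟫ = riskDeriv M₁ M₂ (fun j => net n d ℓ W₁ L₁ h₀ j * net p s ℓ W₂ L₂ m₀ j) z (x, 0)) :
    ∃ D < 0, HasOneSidedDeriv (risk (net n d ℓ W₁ L₁) (net p s ℓ W₂ L₂) h₀ m₀) z (-v, 0) D := by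
  have hκ := riskScale_pos d s hℓ
  have hK1 : (1 : ℝ) ≤ K := by exact_mod_cast (show 1 ≤ K by omega)
  have p1 : 0 < ‖z.1‖ := norm_pos_iff.2 hz1
  have p2 : 0 < ‖z.2‖ := norm_pos_iff.2 hz2
  refine exists_descent (isPiecewiseLinear_net W₁ L₁) (isPiecewiseLinear_net W₂ L₂) h₀ m₀
    (ι := fun x => (x, 0)) (T := fun y => riskScale d s ℓ • gradLim d s h₀ m₀ y)
    (r := fun y => riskScale d s ℓ * (100 * K ^ 2 * √δ) *
      (‖y.2‖ * (‖y.1‖ * ‖y.2‖ + ‖h₀‖ * ‖m₀‖)))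
    ((continuousAt_gradLim d s h₀ m₀ hz1 hz2).const_smul (riskScale d s ℓ)) (by fun_prop)
    ?_ ?_ ?_ hv
  · have e1 : ∀ᶠ y in 𝓝 z, y.1 ≠ 0 :=
      continuousAt_fst.eventually_ne hz1
    have e2 : ∀ᶠ y in 𝓝 z, y.2 ≠ 0 :=
      continuousAt_snd.eventually_ne hz2
    filter_upwards [e1, e2] with y h1 h2 x
    exact abs_riskDeriv_sub_gradLim_le hd hs hℓ hdK hsK hδ.le hKδ hW₁ hW₂ hL h1 h2 h₀ x m₀
  · have := Real.sqrt_pos.2 hδ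
    positivity
  · rw [norm_smul, Real.norm_eq_abs, abs_of_pos hκ]
    have := mul_le_mul_of_nonneg_left hT hκ.le
    linarith

/-- The mirror image of `exists_descent_fst`. -/
lemma exists_descent_snd (hd : 2 ≤ d) (hs : 2 ≤ s) (hℓ : 0 < ℓ) (hdK : d - 1 ≤ K)
    (hsK : s - 1 ≤ K) (hδ : 0 < δ) (hKδ : K * δ ≤ 1 / 4) (hW₁ : ∀ k < d - 1, WDC δ (W₁ k))
    (hW₂ : ∀ k < s - 1, WDC δ (W₂ k)) (hL : JointWDC δ L₂ L₁) {h₀ : Vec (n 0)} {m₀ : Vec (p 0)}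
    {z w : Vec (n 0) × Vec (p 0)} (hz1 : z.1 ≠ 0) (hz2 : z.2 ≠ 0) {v : Vec (p 0)}
    (hT : ‖z.1‖ * (3 * (100 * K ^ 2 * √δ) * (‖z.1‖ * ‖z.2‖ + ‖h₀‖ * ‖m₀‖))
      ≤ ‖gradLim s d m₀ h₀ z.swap‖)
    (hv : ∀ x, ∃ M₁ M₂, (∀ᶠ q in rayFilter,
      selNet n d ℓ W₁ L₁ (z + q.1 • w + q.2 • ((0, x) : Vec (n 0) × Vec (p 0))).1 = M₁ ∧
      selNet p s ℓ W₂ L₂ (z + q.1 • w + q.2 • ((0, x) : Vec (n 0) × Vec (p 0))).2 = M₂) ∧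
      ⟪v, x⟫ = riskDeriv M₁ M₂ (fun j => net n d ℓ W₁ L₁ h₀ j * net p s ℓ W₂ L₂ m₀ j) z (0, x)) :
    ∃ D < 0, HasOneSidedDeriv (risk (net n d ℓ W₁ L₁) (net p s ℓ W₂ L₂) h₀ m₀) z (0, -v) D := by
  have hκ := riskScale_pos s d hℓ
  have hK1 : (1 : ℝ) ≤ K := by exact_mod_cast (show 1 ≤ K by omega)
  have p1 : 0 < ‖z.1‖ := norm_pos_iff.2 hz1
  have p2 : 0 < ‖z.2‖ := norm_pos_iff.2 hz2
  refine exists_descent (isPiecewiseLinear_net W₁ L₁) (isPiecewiseLinear_net W₂ L₂) h₀ m₀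
    (ι := fun x => (0, x)) (T := fun y => riskScale s d ℓ • gradLim s d m₀ h₀ y.swap)
    (r := fun y => riskScale s d ℓ * (100 * K ^ 2 * √δ) *
      (‖y.1‖ * (‖y.2‖ * ‖y.1‖ + ‖m₀‖ * ‖h₀‖)))
    ((ContinuousAt.comp (f := Prod.swap) (x := z)
      (continuousAt_gradLim (z := z.swap) s d m₀ h₀ hz2 hz1) (by fun_prop)).const_smul
        (riskScale s d ℓ))
      (by fun_prop)
      ?_ ?_ ?_ hv
  · have e1 : ∀ᶠ y in 𝓝 z, y.1 ≠ 0 :=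
      continuousAt_fst.eventually_ne hz1
    have e2 : ∀ᶠ y in 𝓝 z, y.2 ≠ 0 :=
      continuousAt_snd.eventually_ne hz2
    filter_upwards [e1, e2] with y h1 h2 x
    rw [riskDeriv_comm]
    exact abs_riskDeriv_sub_gradLim_le hs hd hℓ hsK hdK hδ.le hKδ hW₂ hW₁ hL h2 h1 m₀ x h₀
  · have := Real.sqrt_pos.2 hδ
    positivity
  · rw [norm_smul, Real.norm_eq_abs, abs_of_pos hκ]
    have := mul_le_mul_of_nonneg_left hT hκ.le
    linarith

/-- If one of the targets vanishes, the limiting gradient is large at every point outside the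
axes. -/
lemma norm_gradLim_of_eq_zero {a b : ℕ} (d s : ℕ) {h h₀ : Vec a} {m m₀ : Vec b}
    (h0 : h₀ = 0 ∨ m₀ = 0) : ‖gradLim d s h₀ m₀ (h, m)‖ = ‖m‖ * (‖h‖ * ‖m‖) := by
  have e : gradLim d s h₀ m₀ (h, m) = ‖m‖ ^ 2 • h := by
    rcases h0 with rfl | rfl <;> simp [gradLim, arcNet]
  rw [e, norm_smul, Real.norm_eq_abs, abs_of_nonneg (by positivity)]
  ring

/-- The deterministic form of the landscape theorem: with `δ` of the order of `ε⁵`, the weight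
distribution conditions are the only properties of the weights that enter. -/
theorem landscape (hd : 2 ≤ d) (hs : 2 ≤ s) (hℓ : 0 < ℓ) {ε : ℝ} (hε : 0 < ε)
    (hdε : d * ε ^ (1 / 4 : ℝ) ≤ 1) (hsε : s * ε ^ (1 / 4 : ℝ) ≤ 1) (hδ : δ = ε ^ 5 / 10 ^ 10)
    (hW₁ : ∀ k < d - 1, WDC δ (W₁ k)) (hW₂ : ∀ k < s - 1, WDC δ (W₂ k))
    (hL₁ : JointWDC δ L₁ L₂) (hL₂ : JointWDC δ L₂ L₁) (h₀ : Vec (n 0)) (m₀ : Vec (p 0))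
    {f : Vec (n 0) × Vec (p 0) → ℝ}
    (hf : f = risk (net n d ℓ W₁ L₁) (net p s ℓ W₂ L₂) h₀ m₀) :
    (∃ w, ∀ z, DifferentiableAlong f z w) ∧
    (∀ z ∉ fourNhds 1 ε d s h₀ m₀ ∪ axes (n 0) (p 0),
      ∀ w, DifferentiableAlong f z w → HasDescent f z w) ∧
    (∀ z ∈ axes (n 0) (p 0), ∀ v, ∃ D ≤ 0, HasOneSidedDeriv f z v D) ∧
    (h₀ ≠ 0 → m₀ ≠ 0 → ∀ z ∈ axes (n 0) (p 0), IsLocalMax f z) := by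
  subst hf
  have hG₁ := isPiecewiseLinear_net W₁ L₁
  have hG₂ := isPiecewiseLinear_net W₂ L₂
  set e := ε ^ (1 / 4 : ℝ) with he
  have he0 : 0 < e := by positivity
  have he4 : e ^ 4 = ε := by
    rw [he, ← Real.rpow_natCast, ← Real.rpow_mul hε.le]
    norm_num
  have hd2 : (2 : ℝ) ≤ d := by exact_mod_cast hd
  have hs2 : (2 : ℝ) ≤ s := by exact_mod_cast hs
  have he2 : e ≤ 1 / 2 := by nlinarith
  have hδe : δ = (e ^ 10 / 10 ^ 5) ^ 2 := by
    rw [hδ, ← he4]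
    ring
  have hδ0 : 0 < δ := by rw [hδe]; positivity
  have hsqrt : √δ = e ^ 10 / 10 ^ 5 := by
    rw [hδe, Real.sqrt_sq (by positivity)]
  obtain ⟨K, hK⟩ : ∃ K, K = max d s := ⟨_, rfl⟩
  have hdK : d - 1 ≤ K := by omega
  have hsK : s - 1 ≤ K := by omega
  have hK1 : (1 : ℝ) ≤ K := by exact_mod_cast (show 1 ≤ K by omega)
  have hKe : K * e ≤ 1 := by
    rcases le_total d s with h | h
    · rw [hK, max_eq_right h]; exact hsε
    · rw [hK, max_eq_left h]; exact hdε
  have hsmall : ∀ k : ℕ, e ^ k ≤ 1 := fun k => pow_le_one₀ he0.le (by linarith)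
  have hKδ : K * δ ≤ 1 / 4 := by
    have h1 : K * δ = (K * e) * e ^ 19 / 10 ^ 10 := by rw [hδe]; ring
    have h2 : (K * e) * e ^ 19 ≤ 1 := mul_le_one₀ hKe (by positivity) (hsmall 19)
    rw [h1]
    linarith
  have hd1δ : ((d - 1 : ℕ) : ℝ) * δ ≤ 1 / 4 := le_trans (by gcongr) hKδ
  have hs1δ : ((s - 1 : ℕ) : ℝ) * δ ≤ 1 / 4 := le_trans (by gcongr) hKδ
  have hδ20 : δ ≤ 1 / 20 := by
    rw [hδe, div_pow, ← pow_mul]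
    have := hsmall (10 * 2)
    norm_num at this ⊢
    linarith
  set β := 3 * (100 * (K : ℝ) ^ 2 * √δ) with hβ
  have hβ0 : 0 ≤ β := by positivity
  have hβe : β ≤ 3 / 1000 * e ^ 8 := by
    have h1 : β = 3 / 1000 * ((K * e) ^ 2 * e ^ 8) := by rw [hβ, hsqrt]; ring
    rw [h1]
    have h2 : (K * e) ^ 2 ≤ 1 := pow_le_one₀ (by positivity) hKe
    have h3 : 0 ≤ e ^ 8 := by positivity
    nlinarith
  have hβd : ∀ {q : ℕ}, q * e ≤ 1 → 10 * β * q ^ 5 ≤ (e / 4) ^ 2 := by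
    intro q hq
    have h1 : (q * e) ^ 5 ≤ 1 := pow_le_one₀ (by positivity) hq
    have h2 : 10 * β * (q : ℝ) ^ 5 ≤ 3 / 100 * (e * e ^ 2 * (q * e) ^ 5) := by
      have := mul_le_mul_of_nonneg_right hβe (show (0 : ℝ) ≤ 10 * (q : ℝ) ^ 5 by positivity)
      refine le_trans (le_of_eq (by ring)) (this.trans (le_of_eq (by ring)))
    have h3 : e * e ^ 2 * (q * e) ^ 5 ≤ e * e ^ 2 := mul_le_of_le_one_right (by positivity) h1
    have h4 : 0 ≤ e ^ 2 := by positivity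
    nlinarith
  refine ⟨exists_differentiableAlong_risk hG₁ hG₂ h₀ m₀, ?_,
    fun z hz v => exists_hasOneSidedDeriv_nonpos hG₁ hG₂ h₀ m₀ hz v, ?_⟩
  · rintro ⟨h, m⟩ hz w hw
    simp only [Set.mem_union, axes, Set.mem_ofPred_eq, not_or] at hz
    obtain ⟨hz4, hm0, hh0⟩ := hz
    obtain ⟨v₁, hv₁, hv₁'⟩ := exists_tendsto_grad hG₁ hG₂ h₀ m₀ (fun x => (x, 0)) hw
      (fun δ => grad₁ _ ((h, m) + δ • w)) fun δ hδ x => inner_grad₁ hδ x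
    obtain ⟨v₂, hv₂, hv₂'⟩ := exists_tendsto_grad hG₁ hG₂ h₀ m₀ (fun x => (0, x)) hw
      (fun δ => grad₂ _ ((h, m) + δ • w)) fun δ hδ x => inner_grad₂ hδ x
    refine ⟨v₁, v₂, hv₁, hv₂, ?_⟩
    simp only [Prod.neg_mk, neg_zero]
    by_cases hT₁ : ‖m‖ * (β * (‖h‖ * ‖m‖ + ‖h₀‖ * ‖m₀‖)) ≤ ‖gradLim d s h₀ m₀ (h, m)‖
    · exact Or.inl (exists_descent_fst hd hs hℓ hdK hsK hδ0 hKδ hW₁ hW₂ hL₁ (z := (h, m)) (w := w)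
        hh0 hm0 hT₁ hv₁')
    by_cases hT₂ : ‖h‖ * (β * (‖h‖ * ‖m‖ + ‖h₀‖ * ‖m₀‖)) ≤ ‖gradLim s d m₀ h₀ (m, h)‖
    · exact Or.inr (exists_descent_snd hd hs hℓ hdK hsK hδ0 hKδ hW₁ hW₂ hL₂ (z := (h, m)) (w := w)
        hh0 hm0 hT₂ hv₂')
    exfalso
    rw [not_le] at hT₁ hT₂
    by_cases h0 : h₀ = 0 ∨ m₀ = 0
    · rw [norm_gradLim_of_eq_zero d s h0] at hT₁
      have e0 : ‖h₀‖ * ‖m₀‖ = 0 := by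
        rcases h0 with rfl | rfl <;> simp
      rw [e0, add_zero] at hT₁
      have hβ1 : β ≤ 1 := by linarith [hsmall 8]
      have hpos : 0 ≤ ‖m‖ * (‖h‖ * ‖m‖) := by positivity
      nlinarith
    · rw [not_or] at h0
      exact hz4 (mem_fourNhds_of_norm_gradLim_le hd hs hh0 hm0 h0.1 h0.2 hβ0 he0.le
        (he2.trans (by norm_num)) (hβd hdε) (hβd hsε) hT₁.le hT₂.le)
  · intro h0 m0 z hz
    obtain ⟨α, hα, hα'⟩ := exists_le_sum_net hd hs hℓ hδ0.le hδ20 hd1δ hs1δ hW₁ hW₂ hL₁ h0 m0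
    exact isLocalMax_risk hG₁ hG₂ h₀ m₀ hα hα' hz

end Deterministic

/-! ### Gaussian integrals -/

lemma charFunDual_gaussianReal (L : StrongDual ℝ ℝ) :
    charFunDual (gaussianReal 0 1) L = Complex.exp (-((L 1 : ℝ) : ℂ) ^ 2 / 2) := by
  have h : charFunDual (gaussianReal 0 1) L = charFun (gaussianReal 0 1) (L 1) := by
    rw [charFunDual_apply, charFun_apply_real]
    refine integral_congr_ae (Eventually.of_forall fun x => ?_)
    have : L x = L 1 * x := by
      have := L.map_smul x 1
      rw [smul_eq_mul, mul_one, smul_eq_mul] at this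
      rw [this, mul_comm]
    simp only [this, Complex.ofReal_mul]
  rw [h, charFun_gaussianReal]
  simp [neg_div]

/-- Two inner products of a standard Gaussian vector, in terms of two independent standard Gaussian
variables. -/
lemma map_inner_pair_stdGaussian {k : ℕ} (x y : Vec k) :
    (stdGaussian (Vec k)).map (fun a => (⟪x, a⟫, ⟪y, a⟫))
      = ((gaussianReal 0 1).prod (gaussianReal 0 1)).map fun q : ℝ × ℝ => (‖x‖ * q.1,
        ‖y‖ * (Real.cos (InnerProductGeometry.angle x y) * q.1 +
          Real.sin (InnerProductGeometry.angle x y) * q.2)) := by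
  set c := Real.cos (InnerProductGeometry.angle x y) with hc
  set s := Real.sin (InnerProductGeometry.angle x y) with hs
  let T : Vec k →L[ℝ] ℝ × ℝ := (innerSL ℝ x).prod (innerSL ℝ y)
  let S : ℝ × ℝ →L[ℝ] ℝ × ℝ := (‖x‖ • ContinuousLinearMap.fst ℝ ℝ ℝ).prod
    (‖y‖ • (c • ContinuousLinearMap.fst ℝ ℝ ℝ + s • ContinuousLinearMap.snd ℝ ℝ ℝ))
  have hT : (fun a => (⟪x, a⟫, ⟪y, a⟫)) = T := rfl
  have hS : (fun q : ℝ × ℝ => (‖x‖ * q.1, ‖y‖ * (c * q.1 + s * q.2))) = S := rfl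
  rw [hT, hS]
  apply Measure.ext_of_charFunDual
  ext L
  rw [charFunDual_map, charFunDual_map, charFunDual_prod, charFunDual_stdGaussian,
    charFunDual_gaussianReal, charFunDual_gaussianReal, ← Complex.exp_add]
  congr 1
  have hL : ∀ u v : ℝ, L (u, v) = L (1, 0) * u + L (0, 1) * v := by
    intro u v
    have : ((u, v) : ℝ × ℝ) = u • ((1, 0) : ℝ × ℝ) + v • ((0, 1) : ℝ × ℝ) := by
      ext <;> simp
    rw [this, map_add, map_smul, map_smul, smul_eq_mul, smul_eq_mul]
    ring
  set α := L (1, 0)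
  set β := L (0, 1)
  have e1 : L.comp T = innerSL ℝ (α • x + β • y) := by
    ext a
    change L (⟪x, a⟫, ⟪y, a⟫) = ⟪α • x + β • y, a⟫
    rw [hL, inner_add_left, inner_smul_left, inner_smul_left]
    simp
  have e2 : ‖L.comp T‖ ^ 2 = α ^ 2 * ‖x‖ ^ 2 + 2 * α * β * (c * (‖x‖ * ‖y‖)) + β ^ 2 * ‖y‖ ^ 2 := by
    rw [e1, innerSL_apply_norm, norm_add_sq_real, norm_smul, norm_smul, inner_smul_left,
      inner_smul_right, ← InnerProductGeometry.cos_angle_mul_norm_mul_norm x y, mul_pow, mul_pow,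
      Real.norm_eq_abs, Real.norm_eq_abs, sq_abs, sq_abs]
    simp only [conj_trivial]
    ring
  have e3 : (L.comp S).comp (.inl ℝ ℝ ℝ) 1 = α * ‖x‖ + β * (‖y‖ * c) := by
    change L (‖x‖ * 1, ‖y‖ * (c * 1 + s * 0)) = _
    rw [hL]
    ring
  have e4 : (L.comp S).comp (.inr ℝ ℝ ℝ) 1 = β * (‖y‖ * s) := by
    change L (‖x‖ * 0, ‖y‖ * (c * 0 + s * 1)) = _
    rw [hL]
    ring
  rw [e3, e4]
  have hcs : s ^ 2 + c ^ 2 = 1 := Real.sin_sq_add_cos_sq _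
  have e5 : ‖L.comp T‖ ^ 2 = (α * ‖x‖ + β * (‖y‖ * c)) ^ 2 + (β * (‖y‖ * s)) ^ 2 := by
    rw [e2]
    linear_combination (-(β ^ 2 * ‖y‖ ^ 2)) * hcs
  have e6 : ((‖L.comp T‖ : ℝ) : ℂ) ^ 2
      = ((α * ‖x‖ + β * (‖y‖ * c) : ℝ) : ℂ) ^ 2 + ((β * (‖y‖ * s) : ℝ) : ℂ) ^ 2 := by
    exact_mod_cast e5
  rw [e6]
  ring

lemma map_inner_stdGaussian {k : ℕ} {x : Vec k} (hx : ‖x‖ = 1) :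
    (stdGaussian (Vec k)).map (fun a => ⟪x, a⟫) = gaussianReal 0 1 := by
  have h := congrArg (Measure.map Prod.fst) (map_inner_pair_stdGaussian x x)
  rw [Measure.map_map (by fun_prop) (by fun_prop), Measure.map_map (by fun_prop) (by fun_prop)] at h
  have e1 : (Prod.fst ∘ fun a : Vec k => (⟪x, a⟫, ⟪x, a⟫)) = fun a => ⟪x, a⟫ := rfl
  rw [e1] at h
  rw [h]
  simp only [hx, one_mul, Function.comp_def]
  exact Measure.map_fst_prod.trans (by simp)

lemma integral_rpow_three_mul_exp :
    ∫ r in Set.Ioi (0 : ℝ), r ^ 3 * Real.exp (-(r ^ 2) / 2) = 2 := by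
  have h := integral_rpow_mul_exp_neg_mul_rpow (p := 2) (q := 3) (b := 1 / 2) (by norm_num)
    (by norm_num) (by norm_num)
  have e : ∀ r : ℝ, r ^ (3 : ℝ) * Real.exp (-(1 / 2) * r ^ (2 : ℝ))
      = r ^ 3 * Real.exp (-(r ^ 2) / 2) := by
    intro r
    rw [show (3 : ℝ) = ((3 : ℕ) : ℝ) by norm_num, show (2 : ℝ) = ((2 : ℕ) : ℝ) by norm_num,
      Real.rpow_natCast, Real.rpow_natCast]
    congr 2
    push_cast
    ring
  simp_rw [e] at h
  rw [h, show ((3 : ℝ) + 1) / 2 = 2 by norm_num, show -((3 : ℝ) + 1) / 2 = -2 by norm_num,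
    Real.Gamma_two]
  rw [Real.rpow_neg (by norm_num), show (2 : ℝ) = ((2 : ℕ) : ℝ) by norm_num, Real.rpow_natCast]
  norm_num

/-- The planar Gaussian integral of a function that is homogeneous of degree two. -/
lemma integral_gaussian_prod_of_homogeneous {f : ℝ × ℝ → ℝ}
    (hf : ∀ r : ℝ, 0 < r → ∀ u v, f (r * u, r * v) = r ^ 2 * f (u, v)) :
    ∫ q, f q ∂((gaussianReal 0 1).prod (gaussianReal 0 1))
      = Real.pi⁻¹ * ∫ t in Set.Ioo (-Real.pi) Real.pi, f (Real.cos t, Real.sin t) := by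
  rw [gaussianReal_of_var_ne_zero 0 one_ne_zero,
    prod_withDensity (measurable_gaussianPDF _ _) (measurable_gaussianPDF _ _),
    integral_withDensity_eq_integral_toReal_smul (by fun_prop)
      (Eventually.of_forall fun q => by
        exact ENNReal.mul_lt_top gaussianPDF_lt_top gaussianPDF_lt_top)]
  rw [← Measure.volume_eq_prod, ← integral_comp_polarCoord_symm, polarCoord_target]
  have e : ∀ q ∈ Set.Ioi (0 : ℝ) ×ˢ Set.Ioo (-Real.pi) Real.pi,
      q.1 • ((gaussianPDF 0 1 (polarCoord.symm q).1 * gaussianPDF 0 1 (polarCoord.symm q).2).toReal •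
        f (polarCoord.symm q))
      = (q.1 ^ 3 * Real.exp (-(q.1 ^ 2) / 2)) *
        ((2 * Real.pi)⁻¹ * f (Real.cos q.2, Real.sin q.2)) := by
    rintro ⟨r, t⟩ ⟨hr, -⟩
    rw [polarCoord_symm_apply, ENNReal.toReal_mul, toReal_gaussianPDF, toReal_gaussianPDF,
      hf r hr]
    simp only [gaussianPDFReal, sub_zero, NNReal.coe_one, mul_one, smul_eq_mul]
    have h1 : Real.exp (-(r * Real.cos t) ^ 2 / 2) * Real.exp (-(r * Real.sin t) ^ 2 / 2)
        = Real.exp (-(r ^ 2) / 2) := by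
      rw [← Real.exp_add]
      congr 1
      linear_combination (-(r ^ 2) / 2) * Real.sin_sq_add_cos_sq t
    have h2 : (√(2 * Real.pi))⁻¹ * (√(2 * Real.pi))⁻¹ = (2 * Real.pi)⁻¹ := by
      rw [← mul_inv, Real.mul_self_sqrt (by positivity)]
    rw [← h1, ← h2]
    ring
  rw [setIntegral_congr_fun (measurableSet_Ioi.prod measurableSet_Ioo) e, Measure.volume_eq_prod,
    setIntegral_prod_mul (fun r : ℝ => r ^ 3 * Real.exp (-(r ^ 2) / 2))
      (fun t : ℝ => (2 * Real.pi)⁻¹ * f (Real.cos t, Real.sin t)), integral_rpow_three_mul_exp,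
    integral_const_mul]
  rw [mul_inv]
  ring

lemma setIntegral_angular {θ : ℝ} (hθ : θ ∈ Set.Icc 0 Real.pi) {f F : ℝ → ℝ} {g : ℝ → ℝ}
    (hg : ∀ t ∈ Set.Ioo (-Real.pi) Real.pi, g t = if 0 < Real.cos t ∧ 0 < Real.cos (t - θ)
      then f t else 0)
    (hF : ∀ t, HasDerivAt F (f t) t) (hf : Continuous f) :
    ∫ t in Set.Ioo (-Real.pi) Real.pi, g t = F (Real.pi / 2) - F (θ - Real.pi / 2) := by
  have hpi := Real.pi_pos
  have hsub : Set.Ioo (θ - Real.pi / 2) (Real.pi / 2) ⊆ Set.Ioo (-Real.pi) Real.pi := by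
    refine Set.Ioo_subset_Ioo ?_ ?_ <;> linarith [hθ.1]
  rw [← intervalIntegral.integral_eq_sub_of_hasDerivAt (fun t _ => hF t)
    (hf.intervalIntegrable _ _), intervalIntegral.integral_of_le (by linarith [hθ.2]),
    integral_Ioc_eq_integral_Ioo]
  have key : ∀ t ∈ Set.Ioo (-Real.pi) Real.pi, (0 < Real.cos t ∧ 0 < Real.cos (t - θ)) ↔
      t ∈ Set.Ioo (θ - Real.pi / 2) (Real.pi / 2) := by
    intro t ht
    constructor
    · rintro ⟨h1, h2⟩
      have ht1 : t < Real.pi / 2 := by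
        by_contra h
        exact absurd h1 (not_lt.2 (Real.cos_nonpos_of_pi_div_two_le_of_le (not_lt.1 h)
          (by linarith [ht.2])))
      have ht2 : -(Real.pi / 2) < t := by
        by_contra h
        rw [← Real.cos_neg] at h1
        exact absurd h1 (not_lt.2 (Real.cos_nonpos_of_pi_div_two_le_of_le
          (by linarith [not_lt.1 h]) (by linarith [ht.1])))
      refine ⟨?_, ht1⟩
      by_contra h
      rw [← Real.cos_neg] at h2
      exact absurd h2 (not_lt.2 (Real.cos_nonpos_of_pi_div_two_le_of_le
        (by linarith [not_lt.1 h]) (by linarith [hθ.2])))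
    · rintro ⟨h1, h2⟩
      exact ⟨Real.cos_pos_of_mem_Ioo ⟨by linarith [hθ.1], h2⟩,
        Real.cos_pos_of_mem_Ioo ⟨by linarith, by linarith [hθ.1]⟩⟩
  rw [setIntegral_eq_of_subset_of_forall_sdiff_eq_zero measurableSet_Ioo hsub (f := g)]
  · refine setIntegral_congr_fun measurableSet_Ioo fun t ht => ?_
    rw [hg t (hsub ht), if_pos ((key t (hsub ht)).2 ht)]
  · rintro t ⟨ht, ht'⟩
    rw [hg t ht, if_neg]
    rwa [key t ht]

lemma integral_relu_mul_relu_gaussian_prod {θ : ℝ} (hθ : θ ∈ Set.Icc 0 Real.pi) :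
    2 * ∫ q, (max q.1 0 * max (Real.cos θ * q.1 + Real.sin θ * q.2) 0)
      ∂((gaussianReal 0 1).prod (gaussianReal 0 1)) = cosAngleMap θ := by
  rw [integral_gaussian_prod_of_homogeneous]
  · have h := setIntegral_angular hθ (f := fun t => Real.cos t * Real.cos (t - θ))
      (F := fun t => (t * Real.cos θ + Real.sin (2 * t - θ) / 2) / 2)
      (g := fun t => max (Real.cos t) 0 *
        max (Real.cos θ * Real.cos t + Real.sin θ * Real.sin t) 0) ?_ ?_ (by fun_prop)
    · rw [h]
      have e1 : Real.sin (2 * (Real.pi / 2) - θ) = Real.sin θ := by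
        rw [show 2 * (Real.pi / 2) - θ = Real.pi - θ by ring, Real.sin_pi_sub]
      have e2 : Real.sin (2 * (θ - Real.pi / 2) - θ) = -Real.sin θ := by
        rw [show 2 * (θ - Real.pi / 2) - θ = θ - Real.pi by ring, Real.sin_sub_pi]
      simp only [e1, e2, cosAngleMap]
      field_simp
      ring
    · intro t _
      rw [show Real.cos θ * Real.cos t + Real.sin θ * Real.sin t = Real.cos (t - θ) by
        rw [Real.cos_sub]; ring]
      split_ifs with h
      · rw [max_eq_left h.1.le, max_eq_left h.2.le]
      · rw [not_and_or, not_lt, not_lt] at h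
        rcases h with h | h <;> simp [max_eq_right h]
    · intro t
      have h1 : HasDerivAt (fun t => Real.sin (2 * t - θ)) (Real.cos (2 * t - θ) * 2) t := by
        have := ((hasDerivAt_id t).const_mul 2).sub_const θ
        simpa using this.sin
      have h2 := (((hasDerivAt_id t).mul_const (Real.cos θ)).add (h1.div_const 2)).div_const 2
      refine h2.congr_deriv ?_
      have e : Real.cos (2 * t - θ)
          = Real.cos t * Real.cos (t - θ) - Real.sin t * Real.sin (t - θ) := by
        rw [← Real.cos_add]; congr 1; ring
      have e' : Real.cos θ = Real.cos t * Real.cos (t - θ) + Real.sin t * Real.sin (t - θ) := by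
        rw [← Real.cos_sub]; congr 1; ring
      rw [e, e']
      ring
  · intro r hr u v
    have h1 : max (r * u) 0 = r * max u 0 := by
      rw [mul_max_of_nonneg _ _ hr.le, mul_zero]
    have h2 : max (Real.cos θ * (r * u) + Real.sin θ * (r * v)) 0
        = r * max (Real.cos θ * u + Real.sin θ * v) 0 := by
      rw [mul_max_of_nonneg _ _ hr.le, mul_zero]
      congr 1
      ring
    simp only [h1, h2]
    ring

lemma integral_pos_mul_relu_sq_gaussian_prod {θ : ℝ} (hθ : θ ∈ Set.Icc 0 Real.pi) :
    2 * ∫ q, ((if 0 < q.1 then max (Real.cos θ * q.1 + Real.sin θ * q.2) 0 else 0) ^ 2 : ℝ)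
      ∂((gaussianReal 0 1).prod (gaussianReal 0 1))
      = 1 - θ / Real.pi + Real.sin θ * Real.cos θ / Real.pi := by
  rw [integral_gaussian_prod_of_homogeneous (f := fun q : ℝ × ℝ =>
    ((if 0 < q.1 then max (Real.cos θ * q.1 + Real.sin θ * q.2) 0 else 0) ^ 2 : ℝ))]
  · have h := setIntegral_angular hθ (f := fun t => Real.cos (t - θ) ^ 2)
      (F := fun t => (t + Real.sin (t - θ) * Real.cos (t - θ)) / 2)
      (g := fun t => ((if 0 < Real.cos t then
        max (Real.cos θ * Real.cos t + Real.sin θ * Real.sin t) 0 else 0) ^ 2 : ℝ)) ?_ ?_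
      (by fun_prop)
    · rw [h]
      have e1 : Real.sin (Real.pi / 2 - θ) = Real.cos θ := Real.sin_pi_div_two_sub θ
      have e2 : Real.cos (Real.pi / 2 - θ) = Real.sin θ := Real.cos_pi_div_two_sub θ
      have e3 : Real.cos (θ - Real.pi / 2 - θ) = 0 := by
        rw [show θ - Real.pi / 2 - θ = -(Real.pi / 2) by ring, Real.cos_neg, Real.cos_pi_div_two]
      simp only [e1, e2, e3]
      field_simp
      ring
    · intro t _
      rw [show Real.cos θ * Real.cos t + Real.sin θ * Real.sin t = Real.cos (t - θ) by
        rw [Real.cos_sub]; ring]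
      by_cases h1 : 0 < Real.cos t
      · by_cases h2 : 0 < Real.cos (t - θ)
        · simp [h1, h2, max_eq_left h2.le]
        · simp [h1, h2, max_eq_right (not_lt.1 h2)]
      · simp [h1]
    · intro t
      have h0 : HasDerivAt (fun t => t - θ) 1 t := (hasDerivAt_id t).sub_const θ
      have h1 : HasDerivAt (fun t => Real.sin (t - θ)) (Real.cos (t - θ)) t := by
        simpa using h0.sin
      have h2 : HasDerivAt (fun t => Real.cos (t - θ)) (-Real.sin (t - θ)) t := by
        simpa using h0.cos
      refine (((hasDerivAt_id t).add (h1.mul h2)).div_const 2).congr_deriv ?_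
      linear_combination (-1 / 2) * Real.sin_sq_add_cos_sq (t - θ)
  · intro r hr u v
    have h2 : max (Real.cos θ * (r * u) + Real.sin θ * (r * v)) 0
        = r * max (Real.cos θ * u + Real.sin θ * v) 0 := by
      rw [mul_max_of_nonneg _ _ hr.le, mul_zero]
      congr 1
      ring
    simp only [h2, mul_pos_iff_of_pos_left hr]
    split_ifs <;> ring

/-! ### The expectation of a pair of layers -/

/-- The contribution `1_{⟪x, a⟫ > 0} ⟪v, a⟫ relu ⟪y, a⟫` of the row `a` of a weight matrix to
`⟪selLayer W x v, layer W y⟫`. -/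
def rowTerm {k : ℕ} (x v y a : Vec k) : ℝ :=
  (if 0 < ⟪x, a⟫ then ⟪v, a⟫ else 0) * max ⟪y, a⟫ 0

section RowTerm

variable {k : ℕ}

@[fun_prop]
lemma measurable_rowTerm (x v y : Vec k) : Measurable (rowTerm x v y) := by
  unfold rowTerm
  refine Measurable.mul (Measurable.ite ?_ (by fun_prop) (by fun_prop)) (by fun_prop)
  exact measurableSet_lt measurable_const (by fun_prop)

lemma abs_max_zero_le (u : ℝ) : |max u 0| ≤ |u| := by
  rcases le_total u 0 with h | h
  · rw [max_eq_right h, abs_zero]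
    exact abs_nonneg _
  · rw [max_eq_left h]

lemma abs_rowTerm_le (x v y a : Vec k) : |rowTerm x v y a| ≤ |⟪v, a⟫| * |⟪y, a⟫| := by
  unfold rowTerm
  rw [abs_mul]
  refine mul_le_mul ?_ (abs_max_zero_le _) (abs_nonneg _) (abs_nonneg _)
  split_ifs
  · exact le_rfl
  · simp

lemma integrable_norm_sq_stdGaussian : Integrable (fun a => ‖a‖ ^ 2) (stdGaussian (Vec k)) := by
  have h := (IsGaussian.memLp_two_id (μ := stdGaussian (Vec k))).integrable_norm_pow two_ne_zero
  simpa using h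

lemma integrable_rowTerm (x v y : Vec k) : Integrable (rowTerm x v y) (stdGaussian (Vec k)) := by
  refine (integrable_norm_sq_stdGaussian.const_mul (‖v‖ * ‖y‖)).mono'
    (by fun_prop) (Eventually.of_forall fun a => ?_)
  rw [Real.norm_eq_abs]
  refine (abs_rowTerm_le x v y a).trans ?_
  have h1 := abs_real_inner_le_norm v a
  have h2 := abs_real_inner_le_norm y a
  have := mul_le_mul h1 h2 (abs_nonneg _) (by positivity)
  nlinarith

lemma rowTerm_add (x v v' y a : Vec k) :
    rowTerm x (v + v') y a = rowTerm x v y a + rowTerm x v' y a := by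
  unfold rowTerm
  rw [inner_add_left]
  split_ifs <;> ring

lemma rowTerm_smul (c : ℝ) (x v y a : Vec k) : rowTerm x (c • v) y a = c * rowTerm x v y a := by
  unfold rowTerm
  rw [inner_smul_left]
  simp only [conj_trivial]
  split_ifs <;> ring

/-- By reflection, the expectation vanishes for `v` orthogonal to `x` and `y`. -/
lemma integral_rowTerm_of_orthogonal {x v y : Vec k} (hx : ⟪x, v⟫ = 0) (hy : ⟪y, v⟫ = 0) :
    ∫ a, rowTerm x v y a ∂(stdGaussian (Vec k)) = 0 := by
  have hR := stdGaussian_map (((ℝ ∙ v)ᗮ).reflection)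
  have h1 : ∫ a, rowTerm x v y a ∂(stdGaussian (Vec k))
      = ∫ a, rowTerm x v y (((ℝ ∙ v)ᗮ).reflection a) ∂(stdGaussian (Vec k)) := by
    conv_lhs => rw [← hR]
    rw [integral_map (by fun_prop) (by fun_prop)]
  have h2 : ∀ a, rowTerm x v y (((ℝ ∙ v)ᗮ).reflection a) = -rowTerm x v y a := by
    intro a
    have swap : ∀ u : Vec k, ⟪u, ((ℝ ∙ v)ᗮ).reflection a⟫ = ⟪((ℝ ∙ v)ᗮ).reflection u, a⟫ := by
      intro u
      rw [← LinearIsometryEquiv.inner_map_map (((ℝ ∙ v)ᗮ).reflection) u,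
        Submodule.reflection_reflection]
    have ex : ((ℝ ∙ v)ᗮ).reflection x = x := Submodule.reflection_mem_subspace_eq_self
      (Submodule.mem_orthogonal_singleton_iff_inner_left.2 hx)
    have ey : ((ℝ ∙ v)ᗮ).reflection y = y := Submodule.reflection_mem_subspace_eq_self
      (Submodule.mem_orthogonal_singleton_iff_inner_left.2 hy)
    have ev : ((ℝ ∙ v)ᗮ).reflection v = -v :=
      Submodule.reflection_orthogonalComplement_singleton_eq_neg v
    unfold rowTerm
    rw [swap, swap, swap, ex, ey, ev, inner_neg_left]
    split_ifs <;> ring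
  simp_rw [h2, integral_neg] at h1
  linarith

/-- The expectation of the product of a rectified standard Gaussian pair. -/
lemma two_mul_integral_relu_mul_relu (x y : Vec k) :
    2 * ∫ a, max ⟪x, a⟫ 0 * max ⟪y, a⟫ 0 ∂(stdGaussian (Vec k))
      = ‖x‖ * ‖y‖ * cosAngleMap (InnerProductGeometry.angle x y) := by
  have h1 : ∫ a, max ⟪x, a⟫ 0 * max ⟪y, a⟫ 0 ∂(stdGaussian (Vec k))
      = ∫ q : ℝ × ℝ, max q.1 0 * max q.2 0
        ∂((stdGaussian (Vec k)).map fun a => (⟪x, a⟫, ⟪y, a⟫)) := by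
    rw [integral_map (by fun_prop) (by fun_prop)]
  rw [h1, map_inner_pair_stdGaussian, integral_map (by fun_prop) (by fun_prop),
    ← integral_relu_mul_relu_gaussian_prod (angle_mem_Icc x y), ← integral_const_mul,
    ← integral_const_mul, ← integral_const_mul]
  refine integral_congr_ae (Eventually.of_forall fun q => ?_)
  have e : ∀ {c : ℝ} (u : ℝ), 0 ≤ c → max (c * u) 0 = c * max u 0 := by
    intro c u hc
    rw [mul_max_of_nonneg _ _ hc, mul_zero]
  simp only [e _ (norm_nonneg _)]
  ring

/-- The expectation of the contribution of one row is given by `arcVec`. -/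
theorem two_mul_integral_rowTerm {x : Vec k} (x0 : x ≠ 0) (v y : Vec k) :
    2 * ∫ a, rowTerm x v y a ∂(stdGaussian (Vec k)) = ⟪v, arcVec x y⟫ := by
  have hx : 0 < ‖x‖ := norm_pos_iff.2 x0
  set θ := InnerProductGeometry.angle x y with hθ
  have hX : 2 * ∫ a, rowTerm x x y a ∂(stdGaussian (Vec k)) = ⟪x, arcVec x y⟫ := by
    have e : ∀ a, rowTerm x x y a = max ⟪x, a⟫ 0 * max ⟪y, a⟫ 0 := by
      intro a
      unfold rowTerm
      split_ifs with h
      · rw [max_eq_left h.le]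
      · rw [max_eq_right (not_lt.1 h)]
    simp_rw [e]
    rw [two_mul_integral_relu_mul_relu, inner_self_arcVec x0]
  have hY : 2 * ∫ a, rowTerm x y y a ∂(stdGaussian (Vec k)) = ⟪y, arcVec x y⟫ := by
    have h1 : ∫ a, rowTerm x y y a ∂(stdGaussian (Vec k))
        = ∫ q : ℝ × ℝ, ((if 0 < q.1 then max q.2 0 else 0) ^ 2 : ℝ)
          ∂((stdGaussian (Vec k)).map fun a => (⟪x, a⟫, ⟪y, a⟫)) := by
      rw [integral_map (by fun_prop)]
      · refine integral_congr_ae (Eventually.of_forall fun a => ?_)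
        unfold rowTerm
        simp only
        split_ifs with h
        · rcases le_total ⟪y, a⟫ 0 with h2 | h2
          · simp [max_eq_right h2]
          · rw [max_eq_left h2]; ring
        · simp
      · refine (Measurable.pow_const (Measurable.ite ?_ (by fun_prop) (by fun_prop))
          2).aestronglyMeasurable
        exact measurableSet_lt measurable_const measurable_fst
    have hs := integral_pos_mul_relu_sq_gaussian_prod (angle_mem_Icc x y)
    rw [← hθ] at hs
    have harc : ⟪y, arcVec x y⟫
        = ‖y‖ ^ 2 * (1 - θ / Real.pi + Real.sin θ * Real.cos θ / Real.pi) := by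
      rw [arcVec, inner_add_right, inner_smul_right, inner_smul_right, real_inner_self_eq_norm_sq,
        real_inner_comm, ← InnerProductGeometry.cos_angle_mul_norm_mul_norm x y, ← hθ]
      field_simp
    rw [h1, map_inner_pair_stdGaussian, ← hθ, integral_map (by fun_prop), harc, ← hs,
      ← integral_const_mul, ← integral_const_mul, ← integral_const_mul]
    · refine integral_congr_ae (Eventually.of_forall fun q => ?_)
      simp only [mul_pos_iff_of_pos_left hx]
      have e : ∀ u : ℝ, max (‖y‖ * u) 0 = ‖y‖ * max u 0 := by
        intro u
        rw [mul_max_of_nonneg _ _ (norm_nonneg y), mul_zero]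
      rw [e]
      split_ifs <;> ring
    · refine (Measurable.pow_const (Measurable.ite ?_ (by fun_prop) (by fun_prop))
          2).aestronglyMeasurable
      exact measurableSet_lt measurable_const measurable_fst
  -- decompose `v` along the span of `x` and `y`
  set U := Submodule.span ℝ {x, y} with hU
  obtain ⟨α, β, hαβ⟩ := Submodule.mem_span_pair.1 (U.starProjection_apply_mem v)
  have hperp : v - U.starProjection v ∈ Uᗮ := U.sub_starProjection_mem_orthogonal v
  set w := v - U.starProjection v with hw
  have hv : v = α • x + β • y + w := by rw [hαβ, hw]; abel
  have hwx : ⟪x, w⟫ = 0 := (Submodule.mem_orthogonal _ _).1 hperp _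
    (Submodule.subset_span (by simp))
  have hwy : ⟪y, w⟫ = 0 := (Submodule.mem_orthogonal _ _).1 hperp _
    (Submodule.subset_span (by simp))
  have hwarc : ⟪w, arcVec x y⟫ = 0 := by
    rw [arcVec, inner_add_right, inner_smul_right, inner_smul_right, real_inner_comm, hwy,
      real_inner_comm, hwx]
    simp
  have hi := integrable_rowTerm (k := k) x
  conv_lhs =>
    rw [hv]
    simp only [rowTerm_add, rowTerm_smul]
  have hxy : Integrable (fun a => α * rowTerm x x y a + β * rowTerm x y y a)
      (stdGaussian (Vec k)) := ((hi x y).const_mul _).add ((hi y y).const_mul _)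
  rw [integral_add hxy (hi w y),
    integral_add ((hi x y).const_mul _) ((hi y y).const_mul _), integral_const_mul,
    integral_const_mul, integral_rowTerm_of_orthogonal hwx hwy, hv, inner_add_left, inner_add_left,
    inner_smul_left, inner_smul_left, hwarc, ← hX, ← hY]
  simp only [conj_trivial]
  ring

end RowTerm

/-! ### Moments and tails of standard Gaussian vectors -/

lemma integral_exp_sq_gaussianReal : ∫ u, Real.exp (u ^ 2 / 4) ∂(gaussianReal 0 1) = √2 := by
  rw [integral_gaussianReal_eq_integral_smul one_ne_zero]
  have e : ∀ u : ℝ, gaussianPDFReal 0 1 u • Real.exp (u ^ 2 / 4)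
      = (√(2 * Real.pi))⁻¹ * Real.exp (-(1 / 4) * u ^ 2) := by
    intro u
    simp only [gaussianPDFReal, sub_zero, NNReal.coe_one, mul_one, smul_eq_mul]
    rw [mul_assoc, ← Real.exp_add]
    congr 2
    ring
  simp_rw [e]
  rw [integral_const_mul, integral_gaussian, show Real.pi / (1 / 4) = 2 * (2 * Real.pi) by ring,
    Real.sqrt_mul (by norm_num : (0 : ℝ) ≤ 2) (2 * Real.pi)]
  have : √(2 * Real.pi) ≠ 0 := by positivity
  rw [mul_comm, mul_assoc, mul_inv_cancel₀ this, mul_one]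

lemma integrable_of_integral_pos {α : Type*} [MeasurableSpace α] {μ : Measure α} {f : α → ℝ}
    (h : 0 < ∫ x, f x ∂μ) : Integrable f μ := by
  by_contra hf
  rw [integral_undef hf] at h
  exact lt_irrefl _ h

section Moments

variable {k : ℕ}

lemma integral_exp_inner_sq {v : Vec k} (hv : ‖v‖ = 1) :
    ∫ a, Real.exp (⟪v, a⟫ ^ 2 / 4) ∂(stdGaussian (Vec k)) = √2 := by
  rw [← integral_exp_sq_gaussianReal, ← map_inner_stdGaussian hv,
    integral_map (by fun_prop) (by fun_prop)]

lemma integrable_exp_inner_sq {v : Vec k} (hv : ‖v‖ = 1) :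
    Integrable (fun a => Real.exp (⟪v, a⟫ ^ 2 / 4)) (stdGaussian (Vec k)) :=
  integrable_of_integral_pos (by rw [integral_exp_inner_sq hv]; positivity)

lemma sq_mul_exp_le (z w : ℝ) : (z * w) ^ 2 * Real.exp (|z * w| / 8)
    ≤ 64 * (Real.exp (z ^ 2 / 4) + Real.exp (w ^ 2 / 4)) := by
  set S := z ^ 2 + w ^ 2 with hS
  have hS0 : 0 ≤ S := by positivity
  have h1 : |z * w| ≤ S / 2 := by
    rw [abs_mul]
    nlinarith [sq_nonneg (|z| - |w|), sq_abs z, sq_abs w]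
  have h2 : (z * w) ^ 2 ≤ S ^ 2 / 4 := by
    rw [← sq_abs]
    have := pow_le_pow_left₀ (abs_nonneg _) h1 2
    linarith
  have h3 : S ^ 2 ≤ 512 * Real.exp (S / 16) := by
    have := Real.quadratic_le_exp_of_nonneg (x := S / 16) (by positivity)
    nlinarith
  have h4 : Real.exp (|z * w| / 8) ≤ Real.exp (S / 16) := Real.exp_le_exp.2 (by linarith)
  have h5 : Real.exp (S / 16) * Real.exp (S / 16)
      = Real.exp (z ^ 2 / 8) * Real.exp (w ^ 2 / 8) := by
    rw [← Real.exp_add, ← Real.exp_add, hS]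
    congr 1
    ring
  have h6 : Real.exp (z ^ 2 / 4) = Real.exp (z ^ 2 / 8) ^ 2 := by
    rw [← Real.exp_nat_mul]
    congr 1
    push_cast
    ring
  have h7 : Real.exp (w ^ 2 / 4) = Real.exp (w ^ 2 / 8) ^ 2 := by
    rw [← Real.exp_nat_mul]
    congr 1
    push_cast
    ring
  have h8 : (z * w) ^ 2 * Real.exp (|z * w| / 8) ≤ 128 * Real.exp (S / 16) * Real.exp (S / 16) :=
    mul_le_mul (by linarith) h4 (Real.exp_pos _).le (by positivity)
  rw [mul_assoc, h5] at h8
  rw [h6, h7]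
  nlinarith [sq_nonneg (Real.exp (z ^ 2 / 8) - Real.exp (w ^ 2 / 8))]

lemma integrable_sq_mul_exp {v y : Vec k} (hv : ‖v‖ = 1) (hy : ‖y‖ = 1) :
    Integrable (fun a => (⟪v, a⟫ * ⟪y, a⟫) ^ 2 * Real.exp (|⟪v, a⟫ * ⟪y, a⟫| / 8))
      (stdGaussian (Vec k)) := by
  refine (((integrable_exp_inner_sq hv).add (integrable_exp_inner_sq hy)).const_mul 64).mono'
    (by fun_prop) (Eventually.of_forall fun a => ?_)
  rw [Real.norm_eq_abs, abs_of_nonneg (by positivity)]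
  exact sq_mul_exp_le _ _

lemma integral_sq_mul_exp_le {v y : Vec k} (hv : ‖v‖ = 1) (hy : ‖y‖ = 1) :
    ∫ a, (⟪v, a⟫ * ⟪y, a⟫) ^ 2 * Real.exp (|⟪v, a⟫ * ⟪y, a⟫| / 8) ∂(stdGaussian (Vec k)) ≤ 200 := by
  have h1 := integral_mono (integrable_sq_mul_exp hv hy)
    (((integrable_exp_inner_sq hv).add (integrable_exp_inner_sq hy)).const_mul 64)
    fun a => sq_mul_exp_le ⟪v, a⟫ ⟪y, a⟫
  refine h1.trans ?_
  rw [integral_const_mul, integral_add' (integrable_exp_inner_sq hv) (integrable_exp_inner_sq hy),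
    integral_exp_inner_sq hv, integral_exp_inner_sq hy]
  have : √2 ≤ 1.5 := by
    rw [Real.sqrt_le_left (by norm_num)]
    norm_num
  linarith

lemma integrable_sq_inner_mul_inner {v y : Vec k} (hv : ‖v‖ = 1) (hy : ‖y‖ = 1) :
    Integrable (fun a => (⟪v, a⟫ * ⟪y, a⟫) ^ 2) (stdGaussian (Vec k)) := by
  refine (integrable_sq_mul_exp hv hy).mono' (by fun_prop) (Eventually.of_forall fun a => ?_)
  rw [Real.norm_eq_abs, abs_of_nonneg (by positivity)]
  exact le_mul_of_one_le_right (by positivity) (Real.one_le_exp (by positivity))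

lemma integral_sq_inner_mul_inner_le {v y : Vec k} (hv : ‖v‖ = 1) (hy : ‖y‖ = 1) :
    ∫ a, (⟪v, a⟫ * ⟪y, a⟫) ^ 2 ∂(stdGaussian (Vec k)) ≤ 200 :=
  (integral_mono (integrable_sq_inner_mul_inner hv hy) (integrable_sq_mul_exp hv hy) fun _ =>
    le_mul_of_one_le_right (by positivity) (Real.one_le_exp (by positivity))).trans
    (integral_sq_mul_exp_le hv hy)

/-- The Gaussian measure of a thin slab. -/
lemma measureReal_abs_inner_le {x : Vec k} (hx : ‖x‖ = 1) {κ : ℝ} (hκ : 0 ≤ κ) :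
    (stdGaussian (Vec k)).real {a | |⟪x, a⟫| ≤ κ} ≤ κ := by
  have h1 : (stdGaussian (Vec k)).real {a | |⟪x, a⟫| ≤ κ}
      = (gaussianReal 0 1).real (Set.Icc (-κ) κ) := by
    rw [← map_inner_stdGaussian hx, map_measureReal_apply (by fun_prop) measurableSet_Icc]
    congr 1
    ext a
    simp only [Set.mem_ofPred_eq, Set.mem_preimage, Set.mem_Icc, abs_le]
  rw [h1, measureReal_def, gaussianReal_apply _ one_ne_zero]
  refine ENNReal.toReal_le_of_le_ofReal hκ ?_
  have h2 : ∀ u : ℝ, gaussianPDF 0 1 u ≤ ENNReal.ofReal (1 / 2) := by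
    intro u
    refine ENNReal.ofReal_le_ofReal ?_
    simp only [gaussianPDFReal, sub_zero, NNReal.coe_one, mul_one]
    have h3 : Real.exp (-u ^ 2 / 2) ≤ 1 := Real.exp_le_one_iff.2 (by nlinarith [sq_nonneg u])
    have h4 : (√(2 * Real.pi))⁻¹ ≤ 1 / 2 := by
      rw [one_div]
      refine inv_anti₀ (by norm_num) (Real.le_sqrt_of_sq_le ?_)
      linarith [Real.pi_gt_three]
    exact (mul_le_mul h4 h3 (Real.exp_pos _).le (by norm_num)).trans (by norm_num)
  refine (lintegral_mono fun u => h2 u).trans ?_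
  rw [lintegral_const, Measure.restrict_apply_univ, Real.volume_Icc,
    ← ENNReal.ofReal_mul (by norm_num)]
  exact ENNReal.ofReal_le_ofReal (by linarith)

lemma integral_exp_norm_sq_stdGaussian :
    ∫ a, Real.exp (‖a‖ ^ 2 / 4) ∂(stdGaussian (Vec k)) = √2 ^ k := by
  rw [← map_pi_eq_stdGaussian, integral_map (by fun_prop) (by fun_prop)]
  have e : ∀ u : Fin k → ℝ, Real.exp (‖WithLp.toLp 2 u‖ ^ 2 / 4) = ∏ i, Real.exp (u i ^ 2 / 4) := by
    intro u
    rw [EuclideanSpace.real_norm_sq_eq, ← Real.exp_sum, Finset.sum_div]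
  simp_rw [e]
  rw [integral_fintype_prod_eq_pow (fun u : ℝ => Real.exp (u ^ 2 / 4)),
    integral_exp_sq_gaussianReal, Fintype.card_fin]

lemma measureReal_norm_gt_le :
    (stdGaussian (Vec k)).real {a | 3 * √k < ‖a‖} ≤ Real.exp (-k) := by
  have hint : Integrable (fun a => Real.exp (‖a‖ ^ 2 / 4)) (stdGaussian (Vec k)) :=
    integrable_of_integral_pos (by rw [integral_exp_norm_sq_stdGaussian]; positivity)
  have h1 := mul_meas_ge_le_integral_of_nonneg
    (Eventually.of_forall fun a : Vec k => (Real.exp_pos (‖a‖ ^ 2 / 4)).le) hint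
    (Real.exp (9 * k / 4))
  rw [integral_exp_norm_sq_stdGaussian] at h1
  have h2 : (stdGaussian (Vec k)).real {a | 3 * √k < ‖a‖}
      ≤ (stdGaussian (Vec k)).real {a | Real.exp (9 * k / 4) ≤ Real.exp (‖a‖ ^ 2 / 4)} := by
    refine measureReal_mono fun a ha => ?_
    simp only [Set.mem_ofPred_eq] at ha ⊢
    rw [Real.exp_le_exp]
    have := pow_le_pow_left₀ (by positivity) ha.le 2
    rw [mul_pow, Real.sq_sqrt (by positivity)] at this
    linarith
  have h3 : √2 ^ k ≤ Real.exp (k / 2) := by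
    have : √2 ≤ Real.exp (1 / 2) := by
      rw [Real.sqrt_le_left (Real.exp_pos _).le, ← Real.exp_nat_mul]
      have := Real.add_one_le_exp (((2 : ℕ) : ℝ) * (1 / 2))
      norm_num at this ⊢
      linarith
    refine (pow_le_pow_left₀ (by positivity) this k).trans ?_
    rw [← Real.exp_nat_mul]
    exact le_of_eq (by congr 1; ring)
  have h4 : Real.exp (9 * k / 4) * (stdGaussian (Vec k)).real {a | 3 * √k < ‖a‖}
      ≤ Real.exp (9 * k / 4) * Real.exp (-k) := by
    refine (mul_le_mul_of_nonneg_left h2 (Real.exp_pos _).le).trans (h1.trans (h3.trans ?_))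
    rw [← Real.exp_add, Real.exp_le_exp]
    have : (0 : ℝ) ≤ k := by positivity
    linarith
  exact le_of_mul_le_mul_left h4 (Real.exp_pos _)

end Moments

/-! ### Concentration of empirical means -/

/-- The random variables `X j` are independent, with law `ρ`. -/
def IsIIDSample {Ω S : Type*} [MeasurableSpace Ω] [MeasurableSpace S] {N : ℕ} (P : Measure Ω)
    (ρ : Measure S) (X : Fin N → Ω → S) : Prop :=
  iIndepFun X P ∧ ∀ j, HasLaw (X j) ρ P

lemma exp_le_one_add_add_sq_mul_exp (u : ℝ) : Real.exp u ≤ 1 + u + u ^ 2 * Real.exp |u| := by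
  have h1 := Real.add_one_le_exp (-u)
  have h2 : Real.exp (-u) * Real.exp u = 1 := by rw [← Real.exp_add]; simp
  have h3 := Real.exp_pos u
  have h4 : Real.exp u - 1 ≤ u * Real.exp u := by nlinarith
  rcases le_total 0 u with h | h
  · rw [abs_of_nonneg h]
    have h5 : 1 + u ≤ Real.exp u := by linarith [Real.add_one_le_exp u]
    have h6 : u * (u * Real.exp u - (Real.exp u - 1)) ≥ 0 := mul_nonneg h (by linarith)
    nlinarith
  · have h5 : u + 1 ≤ Real.exp u := Real.add_one_le_exp u
    have h6 : 1 ≤ Real.exp |u| := Real.one_le_exp (abs_nonneg _)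
    have h7 : u ^ 2 ≤ u ^ 2 * Real.exp |u| := le_mul_of_one_le_right (sq_nonneg _) h6
    nlinarith

section Chernoff

variable {Ω S : Type*} [MeasurableSpace Ω] [MeasurableSpace S] {N : ℕ} {P : Measure Ω}
  [IsProbabilityMeasure P] {ρ : Measure S} [IsProbabilityMeasure ρ] {X : Fin N → Ω → S}

lemma integrable_of_integrable_sq_mul_exp {Z : S → ℝ} (hZ : Measurable Z) {L : ℝ} (hL : 0 ≤ L)
    (hint : Integrable (fun s => Z s ^ 2 * Real.exp (L * |Z s|)) ρ) : Integrable Z ρ := by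
  refine ((integrable_const 1).add hint).mono' hZ.aestronglyMeasurable
    (Eventually.of_forall fun s => ?_)
  have h1 : 1 ≤ Real.exp (L * |Z s|) := Real.one_le_exp (by positivity)
  have h2 : Z s ^ 2 ≤ Z s ^ 2 * Real.exp (L * |Z s|) := le_mul_of_one_le_right (sq_nonneg _) h1
  rw [Real.norm_eq_abs, Pi.add_apply]
  nlinarith [sq_abs (Z s), sq_nonneg (|Z s| - 1)]

/-- Chernoff bound for the upper tail, for variables with an exponential moment. -/
lemma measureReal_sum_ge_le (hX : IsIIDSample P ρ X) {Z : S → ℝ} (hZ : Measurable Z)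
    {L V t l : ℝ} (hint : Integrable (fun s => Z s ^ 2 * Real.exp (L * |Z s|)) ρ)
    (hV : ∫ s, Z s ^ 2 * Real.exp (L * |Z s|) ∂ρ ≤ V) (hl : 0 ≤ l) (hlL : l ≤ L)
    (hlV : l * V ≤ t / 2) :
    P.real {ω | N * t ≤ ∑ j, (Z (X j ω) - ∫ s, Z s ∂ρ)} ≤ Real.exp (-(N * (l * t / 2))) := by
  have hL : 0 ≤ L := hl.trans hlL
  have hZi := integrable_of_integrable_sq_mul_exp hZ hL hint
  set m := ∫ s, Z s ∂ρ with hm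
  have hpt : ∀ s, Real.exp (l * Z s) ≤ 1 + l * Z s + l ^ 2 * (Z s ^ 2 * Real.exp (L * |Z s|)) := by
    intro s
    refine (exp_le_one_add_add_sq_mul_exp _).trans ?_
    have h1 : Real.exp |l * Z s| ≤ Real.exp (L * |Z s|) := by
      rw [abs_mul, abs_of_nonneg hl]
      gcongr
    have h2 := mul_le_mul_of_nonneg_left h1 (sq_nonneg (l * Z s))
    nlinarith
  have hbi : Integrable (fun s => 1 + l * Z s + l ^ 2 * (Z s ^ 2 * Real.exp (L * |Z s|))) ρ :=
    ((integrable_const 1).add (hZi.const_mul l)).add (hint.const_mul (l ^ 2))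
  have hei : Integrable (fun s => Real.exp (l * Z s)) ρ := by
    refine hbi.mono' (by fun_prop) (Eventually.of_forall fun s => ?_)
    rw [Real.norm_eq_abs, abs_of_pos (Real.exp_pos _)]
    exact hpt s
  have hE : ∫ s, Real.exp (l * Z s) ∂ρ ≤ 1 + l * m + l ^ 2 * V := by
    refine (integral_mono hei hbi hpt).trans ?_
    have hi1 : Integrable (fun s => 1 + l * Z s) ρ := (integrable_const 1).add (hZi.const_mul l)
    rw [integral_add hi1 (hint.const_mul (l ^ 2)),
      integral_add (integrable_const 1) (hZi.const_mul l), integral_const_mul, integral_const_mul]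
    simp only [integral_const, probReal_univ, smul_eq_mul, mul_one]
    nlinarith [sq_nonneg l]
  set Y : Fin N → Ω → ℝ := fun j => (fun s => Z s - m) ∘ X j with hY
  have hYm : ∀ j, AEMeasurable (Y j) P := fun j =>
    Measurable.comp_aemeasurable (by fun_prop) (hX.2 j).aemeasurable
  have hYind : iIndepFun Y P := hX.1.comp (fun _ s => Z s - m) fun _ => by fun_prop
  have hmgf : ∀ j, mgf (Y j) P l ≤ Real.exp (l ^ 2 * V) ∧ 0 < mgf (Y j) P l := by
    intro j
    have h1 : mgf (Y j) P l = Real.exp (-(l * m)) * ∫ s, Real.exp (l * Z s) ∂ρ := by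
      rw [← integral_const_mul, mgf]
      have h2 := (hX.2 j).integral_comp (f := fun s => Real.exp (l * (Z s - m)))
        (Measurable.aestronglyMeasurable (by fun_prop))
      refine Eq.trans h2 (integral_congr_ae (Eventually.of_forall fun s => ?_))
      simp only
      rw [← Real.exp_add]
      congr 1
      ring
    rw [h1]
    refine ⟨?_, mul_pos (Real.exp_pos _) (integral_exp_pos hei)⟩
    have h3 : 1 + l * m + l ^ 2 * V ≤ Real.exp (l * m + l ^ 2 * V) := by
      linarith [Real.add_one_le_exp (l * m + l ^ 2 * V)]
    refine (mul_le_mul_of_nonneg_left (hE.trans h3) (Real.exp_pos _).le).trans (le_of_eq ?_)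
    rw [← Real.exp_add]
    congr 1
    ring
  have hsum : mgf (∑ j, Y j) P l ≤ Real.exp (N * (l ^ 2 * V)) ∧ 0 < mgf (∑ j, Y j) P l := by
    rw [hYind.mgf_sum₀ hYm]
    refine ⟨?_, Finset.prod_pos fun j _ => (hmgf j).2⟩
    refine (Finset.prod_le_prod (fun j _ => (hmgf j).2.le) fun j _ => (hmgf j).1).trans ?_
    rw [Finset.prod_const, Finset.card_univ, Fintype.card_fin, ← Real.exp_nat_mul]
  have hch := measure_ge_le_exp_mul_mgf (μ := P) (X := ∑ j, Y j) (t := l) (N * t) hl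
    (mgf_pos_iff.1 hsum.2)
  have hset : {ω | N * t ≤ ∑ j, (Z (X j ω) - m)} = {ω | N * t ≤ (∑ j, Y j) ω} := by
    ext ω
    simp [hY, Finset.sum_apply]
  rw [hset]
  refine hch.trans ((mul_le_mul_of_nonneg_left hsum.1 (Real.exp_pos _).le).trans ?_)
  rw [← Real.exp_add, Real.exp_le_exp]
  have hN : (0 : ℝ) ≤ N := by positivity
  have h5 : l * (l * V) ≤ l * (t / 2) := mul_le_mul_of_nonneg_left hlV hl
  nlinarith [mul_le_mul_of_nonneg_left h5 hN]

lemma measureReal_abs_sum_ge_le (hX : IsIIDSample P ρ X) {Z : S → ℝ} (hZ : Measurable Z)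
    {L V t l : ℝ} (hint : Integrable (fun s => Z s ^ 2 * Real.exp (L * |Z s|)) ρ)
    (hV : ∫ s, Z s ^ 2 * Real.exp (L * |Z s|) ∂ρ ≤ V) (hl : 0 ≤ l) (hlL : l ≤ L)
    (hlV : l * V ≤ t / 2) :
    P.real {ω | N * t ≤ |∑ j, Z (X j ω) - N * ∫ s, Z s ∂ρ|}
      ≤ 2 * Real.exp (-(N * (l * t / 2))) := by
  have h1 := measureReal_sum_ge_le hX hZ hint hV hl hlL hlV
  have h2 := measureReal_sum_ge_le (Z := fun s => -Z s) hX hZ.neg (L := L) (V := V) (t := t)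
    (by simpa using hint) (by simpa using hV) hl hlL hlV
  have hsub : {ω | N * t ≤ |∑ j, Z (X j ω) - N * ∫ s, Z s ∂ρ|}
      ⊆ {ω | N * t ≤ ∑ j, (Z (X j ω) - ∫ s, Z s ∂ρ)} ∪
        {ω | N * t ≤ ∑ j, (-Z (X j ω) - ∫ s, -Z s ∂ρ)} := by
    intro ω hω
    simp only [Set.mem_union, Set.mem_ofPred_eq, Finset.sum_sub_distrib, Finset.sum_neg_distrib,
      integral_neg, Finset.sum_const, Finset.card_univ, Fintype.card_fin, nsmul_eq_mul] at hω ⊢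
    rcases le_abs.1 hω with h | h
    · exact Or.inl h
    · exact Or.inr (by linarith)
  refine (measureReal_mono hsub).trans ((measureReal_union_le _ _).trans ?_)
  linarith

end Chernoff

/-! ### Empirical means of products of a row term and an independent weight -/

section RowChernoff

variable {Ω U : Type*} [MeasurableSpace Ω] [MeasurableSpace U] {N k : ℕ} {P : Measure Ω}
  [IsProbabilityMeasure P] {ν : Measure U} [IsProbabilityMeasure ν] {X : Fin N → Ω → Vec k × U}

/-- Concentration of the empirical mean of `φ(a) b(u)`, where `φ` is dominated by the product of two
Gaussian variables and the independent weight `b` is bounded by `B`. Only the bound on the second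
moment of `b` is independent of `B`, so that the variance proxy is linear in `B`. -/
lemma measureReal_abs_sum_mul_ge_le (hX : IsIIDSample P ((stdGaussian (Vec k)).prod ν) X)
    {φ : Vec k → ℝ} (hφm : Measurable φ) {v y : Vec k} (hv : ‖v‖ = 1) (hy : ‖y‖ = 1)
    (hφ : ∀ a, |φ a| ≤ |⟪v, a⟫ * ⟪y, a⟫|) {b : U → ℝ} (hbm : Measurable b) {B : ℝ} (hB : 1 ≤ B)
    (hb0 : ∀ u, 0 ≤ b u) (hbB : ∀ u, b u ≤ B) (hb2 : ∫ u, b u ^ 2 ∂ν ≤ 200) {t : ℝ}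
    (ht0 : 0 < t) (ht1 : t ≤ 1) :
    P.real {ω | N * t ≤ |∑ j, φ (X j ω).1 * b (X j ω).2
        - N * ((∫ a, φ a ∂(stdGaussian (Vec k))) * ∫ u, b u ∂ν)|}
      ≤ 2 * Real.exp (-(N * (t ^ 2 / (160000 * B)))) := by
  set Z : Vec k × U → ℝ := fun q => φ q.1 * b q.2 with hZ
  have hZm : Measurable Z := by fun_prop
  have hB0 : 0 < B := by linarith
  set G : Vec k → ℝ := fun a => (⟪v, a⟫ * ⟪y, a⟫) ^ 2 * Real.exp (|⟪v, a⟫ * ⟪y, a⟫| / 8) with hG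
  have hb2i : Integrable (fun u => b u ^ 2) ν := by
    refine (integrable_const (B ^ 2)).mono' (by fun_prop) (Eventually.of_forall fun u => ?_)
    rw [Real.norm_eq_abs, abs_of_nonneg (by positivity)]
    exact pow_le_pow_left₀ (hb0 u) (hbB u) 2
  have hdom : ∀ q : Vec k × U, Z q ^ 2 * Real.exp (1 / (8 * B) * |Z q|) ≤ G q.1 * b q.2 ^ 2 := by
    rintro ⟨a, u⟩
    simp only [hZ, hG]
    have h1 : φ a ^ 2 ≤ (⟪v, a⟫ * ⟪y, a⟫) ^ 2 := sq_le_sq.2 (hφ a)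
    have h2 : 1 / (8 * B) * |φ a * b u| ≤ |⟪v, a⟫ * ⟪y, a⟫| / 8 := by
      rw [abs_mul, abs_of_nonneg (hb0 u)]
      have h3 : |φ a| * b u ≤ |⟪v, a⟫ * ⟪y, a⟫| * B :=
        mul_le_mul (hφ a) (hbB u) (hb0 u) (abs_nonneg _)
      rw [one_div, inv_mul_le_iff₀ (by positivity)]
      linarith
    have h4 := mul_le_mul h1 (Real.exp_le_exp.2 h2) (Real.exp_pos _).le (sq_nonneg _)
    have h5 := mul_le_mul_of_nonneg_right h4 (sq_nonneg (b u))
    refine le_trans (le_of_eq (by ring)) h5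
  have hGb : Integrable (fun q : Vec k × U => G q.1 * b q.2 ^ 2) ((stdGaussian (Vec k)).prod ν) :=
    (integrable_sq_mul_exp hv hy).mul_prod hb2i
  have hint : Integrable (fun q => Z q ^ 2 * Real.exp (1 / (8 * B) * |Z q|))
      ((stdGaussian (Vec k)).prod ν) := by
    refine hGb.mono' (by fun_prop) (Eventually.of_forall fun q => ?_)
    rw [Real.norm_eq_abs, abs_of_nonneg (by positivity)]
    exact hdom q
  have hV : ∫ q, Z q ^ 2 * Real.exp (1 / (8 * B) * |Z q|) ∂((stdGaussian (Vec k)).prod ν)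
      ≤ 40000 := by
    refine (integral_mono hint hGb hdom).trans ?_
    rw [integral_prod_mul G (fun u => b u ^ 2)]
    have h1 := integral_sq_mul_exp_le hv hy
    have h2 : 0 ≤ ∫ u, b u ^ 2 ∂ν := integral_nonneg fun u => sq_nonneg _
    exact (mul_le_mul h1 hb2 h2 (by norm_num)).trans (by norm_num)
  have hmain := measureReal_abs_sum_ge_le hX hZm hint hV (l := t / (80000 * B)) (t := t)
    (by positivity) (by
      rw [div_le_div_iff₀ (by positivity) (by positivity)]
      nlinarith) (by
      rw [div_mul_eq_mul_div, div_le_div_iff₀ (by positivity) (by positivity)]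
      nlinarith)
  rw [integral_prod_mul φ b] at hmain
  refine hmain.trans (le_of_eq ?_)
  congr 3
  field_simp
  ring

end RowChernoff

/-! ### Finite nets of the unit sphere -/

lemma exists_sphere_net (k : ℕ) {τ : ℝ} (hτ : 0 < τ) (hτ1 : τ ≤ 1) :
    ∃ S : Finset (Vec k), (∀ x ∈ S, ‖x‖ = 1) ∧ (S.card : ℝ) ≤ (5 * k / τ) ^ k ∧
      ∀ x : Vec k, ‖x‖ = 1 → ∃ x₀ ∈ S, ‖x - x₀‖ ≤ τ := by
  classical
  rcases Nat.eq_zero_or_pos k with rfl | hk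
  · refine ⟨∅, by simp, by simp, fun x hx => ?_⟩
    rw [Subsingleton.elim x 0] at hx
    simp at hx
  have hk1 : (1 : ℝ) ≤ k := by exact_mod_cast hk
  have hk0 : (0 : ℝ) < k := by linarith
  -- the grid cell containing a point
  let cell : Vec k → Fin k → ℤ := fun x i => ⌊x i * (k / τ)⌋
  set M : ℤ := ⌈(k : ℝ) / τ⌉ with hM
  have hkτ : 1 ≤ (k : ℝ) / τ := by rw [le_div_iff₀ hτ]; linarith
  have hMge : (k : ℝ) / τ ≤ M := Int.le_ceil _
  have hMle : (M : ℝ) ≤ k / τ + 1 := (Int.ceil_lt_add_one _).le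
  let T : Finset (Fin k → ℤ) := Fintype.piFinset fun _ => Finset.Icc (-M) M
  have hcell : ∀ x : Vec k, ‖x‖ = 1 → cell x ∈ T := by
    intro x hx
    refine Fintype.mem_piFinset.2 fun i => Finset.mem_Icc.2 ?_
    have h1 : |x i| ≤ 1 := by
      rw [← hx]
      exact PiLp.norm_apply_le x i
    have h2 := abs_le.1 h1
    constructor
    · refine Int.le_floor.2 ?_
      push_cast
      nlinarith
    · have h3 : ((⌊x i * (k / τ)⌋ : ℤ) : ℝ) ≤ M := (Int.floor_le _).trans (by nlinarith)
      exact_mod_cast h3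
  let pick : (Fin k → ℤ) → Vec k := fun c =>
    if h : ∃ x : Vec k, ‖x‖ = 1 ∧ cell x = c then h.choose else 0
  refine ⟨(T.image pick).filter fun x => ‖x‖ = 1, fun x hx => (Finset.mem_filter.1 hx).2, ?_, ?_⟩
  · have h1 : ((T.image pick).filter fun x => ‖x‖ = 1).card ≤ T.card :=
      (Finset.card_filter_le _ _).trans Finset.card_image_le
    have h2 : T.card = (2 * M + 1).toNat ^ k := by
      rw [Fintype.card_piFinset]
      simp only [Int.card_Icc, Finset.prod_const, Finset.card_univ, Fintype.card_fin]
      congr 2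
      ring
    have hM0 : 0 ≤ 2 * M + 1 := by
      have : (0 : ℝ) ≤ 2 * M + 1 := by linarith
      exact_mod_cast this
    have h3 : (((2 * M + 1).toNat : ℕ) : ℝ) = 2 * M + 1 := by
      rw [← Int.cast_natCast, Int.toNat_of_nonneg hM0]
      push_cast
      ring
    calc ((((T.image pick).filter fun x => ‖x‖ = 1).card : ℕ) : ℝ) ≤ (T.card : ℝ) := by
          exact_mod_cast h1
      _ = (2 * M + 1) ^ k := by rw [h2]; push_cast; rw [h3]
      _ ≤ (5 * k / τ) ^ k := by
          refine pow_le_pow_left₀ (by linarith) ?_ k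
          have : 5 * (k : ℝ) / τ = 5 * (k / τ) := by ring
          linarith
  · intro x hx
    have hex : ∃ x' : Vec k, ‖x'‖ = 1 ∧ cell x' = cell x := ⟨x, hx, rfl⟩
    have hp : pick (cell x) = hex.choose := dif_pos hex
    obtain ⟨hn, hc⟩ := hex.choose_spec
    refine ⟨hex.choose, Finset.mem_filter.2 ⟨Finset.mem_image.2 ⟨cell x, hcell x hx, hp⟩, hn⟩, ?_⟩
    set x₀ := hex.choose
    have hcoord : ∀ i, |x i - x₀ i| ≤ τ / k := by
      intro i
      have h1 : ⌊x₀ i * (k / τ)⌋ = ⌊x i * (k / τ)⌋ := congrFun hc i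
      have h2 := Int.abs_sub_lt_one_of_floor_eq_floor h1.symm
      rw [← sub_mul, abs_mul, abs_of_pos (show 0 < (k : ℝ) / τ by positivity)] at h2
      rw [le_div_iff₀ hk0]
      have h3 := mul_lt_mul_of_pos_right h2 hτ
      rw [mul_assoc, div_mul_cancel₀ _ hτ.ne', one_mul] at h3
      exact h3.le
    have h4 : ‖x - x₀‖ ^ 2 ≤ τ ^ 2 := by
      rw [EuclideanSpace.real_norm_sq_eq]
      have h5 : ∀ i ∈ Finset.univ, (x - x₀) i ^ 2 ≤ (τ / k) ^ 2 := by
        intro i _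
        rw [← sq_abs]
        exact pow_le_pow_left₀ (abs_nonneg _) (hcoord i) 2
      refine (Finset.sum_le_sum h5).trans ?_
      rw [Finset.sum_const, Finset.card_univ, Fintype.card_fin, nsmul_eq_mul, div_pow]
      rw [mul_div_assoc', div_le_iff₀ (by positivity)]
      nlinarith [mul_nonneg (sq_nonneg τ) (mul_nonneg hk0.le (sub_nonneg.2 hk1))]
    exact le_of_sq_le_sq h4 hτ.le

/-! ### Lipschitz bounds on the unit sphere -/

section Lipschitz

variable {k : ℕ}

lemma angle_le_mul_norm_sub {x y : Vec k} (hx : ‖x‖ = 1) (hy : ‖y‖ = 1) :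
    InnerProductGeometry.angle x y ≤ Real.pi / 2 * ‖x - y‖ := by
  set α := InnerProductGeometry.angle x y with hα
  have hm := angle_mem_Icc x y
  have hpi := Real.pi_pos
  have h1 : ‖x - y‖ ^ 2 = (2 * Real.sin (α / 2)) ^ 2 := by
    have h2 := InnerProductGeometry.cos_angle_mul_norm_mul_norm x y
    rw [hx, hy, ← hα] at h2
    have h3 : Real.cos (α / 2) ^ 2 = 1 / 2 + Real.cos α / 2 := by
      rw [Real.cos_sq, mul_div_cancel₀ α two_ne_zero]
    have h4 := Real.sin_sq_add_cos_sq (α / 2)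
    rw [norm_sub_sq_real, ← h2, hx, hy]
    linear_combination (-4) * h4 + 4 * h3
  have h5 := Real.mul_le_sin (x := α / 2) (by linarith [hm.1]) (by linarith [hm.2])
  have h6 : 0 ≤ Real.sin (α / 2) := le_trans (mul_nonneg (by positivity) (by linarith [hm.1])) h5
  have h7 : ‖x - y‖ = 2 * Real.sin (α / 2) :=
    (pow_left_inj₀ (norm_nonneg _) (by positivity) two_ne_zero).1 h1
  rw [h7]
  have h8 := mul_le_mul_of_nonneg_left h5 hpi.le
  have h9 : Real.pi * (2 / Real.pi * (α / 2)) = α := by field_simp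
  linarith

lemma abs_angle_sub_angle_le {x y x₀ y₀ : Vec k} (hx : ‖x‖ = 1) (hy : ‖y‖ = 1) (hx₀ : ‖x₀‖ = 1)
    (hy₀ : ‖y₀‖ = 1) : |InnerProductGeometry.angle x y - InnerProductGeometry.angle x₀ y₀|
      ≤ Real.pi / 2 * (‖x - x₀‖ + ‖y - y₀‖) := by
  have a1 := angle_le_mul_norm_sub hx hx₀
  have a2 := angle_le_mul_norm_sub hy hy₀
  have t1 := InnerProductGeometry.angle_le_angle_add_angle x x₀ y
  have t2 := InnerProductGeometry.angle_le_angle_add_angle x₀ y₀ y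
  have t3 := InnerProductGeometry.angle_le_angle_add_angle x₀ x y₀
  have t4 := InnerProductGeometry.angle_le_angle_add_angle x y y₀
  rw [InnerProductGeometry.angle_comm y₀ y] at t2
  rw [InnerProductGeometry.angle_comm x₀ x] at t3
  rw [abs_le]
  constructor <;> linarith

lemma norm_arcVec_sub_le {x y x₀ y₀ : Vec k} (hx : ‖x‖ = 1) (hy : ‖y‖ = 1) (hx₀ : ‖x₀‖ = 1)
    (hy₀ : ‖y₀‖ = 1) {τ : ℝ} (h1 : ‖x - x₀‖ ≤ τ) (h2 : ‖y - y₀‖ ≤ τ) :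
    ‖arcVec x y - arcVec x₀ y₀‖ ≤ 4 * τ := by
  have hpi := Real.pi_pos
  have hpi3 := Real.pi_gt_three
  have hτ : 0 ≤ τ := (norm_nonneg _).trans h1
  have hang : |InnerProductGeometry.angle x y - InnerProductGeometry.angle x₀ y₀|
      ≤ Real.pi * τ := by
    refine (abs_angle_sub_angle_le hx hy hx₀ hy₀).trans ?_
    nlinarith
  unfold arcVec
  set θ := InnerProductGeometry.angle x y with hθ
  set θ₀ := InnerProductGeometry.angle x₀ y₀ with hθ₀
  rw [hx, hy, hx₀, hy₀]
  have e : (1 - θ / Real.pi) • y + (Real.sin θ / Real.pi * (1 / 1)) • x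
      - ((1 - θ₀ / Real.pi) • y₀ + (Real.sin θ₀ / Real.pi * (1 / 1)) • x₀)
      = ((θ₀ - θ) / Real.pi) • y + (1 - θ₀ / Real.pi) • (y - y₀)
        + ((Real.sin θ - Real.sin θ₀) / Real.pi) • x + (Real.sin θ₀ / Real.pi) • (x - x₀) := by
    module
  rw [e]
  have b1 : ‖((θ₀ - θ) / Real.pi) • y‖ ≤ τ := by
    rw [norm_smul, hy, mul_one, Real.norm_eq_abs, abs_div, abs_of_pos hpi, div_le_iff₀ hpi,
      abs_sub_comm]
    linarith
  have b2 : ‖(1 - θ₀ / Real.pi) • (y - y₀)‖ ≤ τ := by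
    have h3 := one_sub_div_pi_nonneg (angle_mem_Icc x₀ y₀)
    have h4 : 0 ≤ θ₀ / Real.pi := div_nonneg (angle_mem_Icc x₀ y₀).1 hpi.le
    rw [norm_smul, Real.norm_eq_abs, abs_of_nonneg h3]
    exact (mul_le_mul (show 1 - θ₀ / Real.pi ≤ 1 by linarith) h2 (norm_nonneg _)
      zero_le_one).trans (by linarith)
  have b3 : ‖((Real.sin θ - Real.sin θ₀) / Real.pi) • x‖ ≤ τ := by
    rw [norm_smul, hx, mul_one, Real.norm_eq_abs, abs_div, abs_of_pos hpi, div_le_iff₀ hpi]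
    have := Real.abs_sin_sub_sin_le θ θ₀
    linarith
  have b4 : ‖(Real.sin θ₀ / Real.pi) • (x - x₀)‖ ≤ τ := by
    rw [norm_smul, Real.norm_eq_abs, abs_div, abs_of_pos hpi]
    have h5 : |Real.sin θ₀| / Real.pi ≤ 1 := by
      rw [div_le_one hpi]
      linarith [Real.abs_sin_le_one θ₀]
    exact (mul_le_mul h5 h1 (norm_nonneg _) zero_le_one).trans (by linarith)
  refine (norm_add_le _ _).trans ?_
  have c1 := norm_add_le (((θ₀ - θ) / Real.pi) • y + (1 - θ₀ / Real.pi) • (y - y₀))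
    (((Real.sin θ - Real.sin θ₀) / Real.pi) • x)
  have c2 := norm_add_le (((θ₀ - θ) / Real.pi) • y) ((1 - θ₀ / Real.pi) • (y - y₀))
  linarith

lemma norm_arcVec_le {x y : Vec k} (hx : ‖x‖ = 1) (hy : ‖y‖ = 1) : ‖arcVec x y‖ ≤ 2 := by
  have hpi := Real.pi_pos
  have hpi3 := Real.pi_gt_three
  unfold arcVec
  rw [hx, hy]
  refine (norm_add_le _ _).trans ?_
  have h3 := one_sub_div_pi_nonneg (angle_mem_Icc x y)
  have h4 : 0 ≤ InnerProductGeometry.angle x y / Real.pi := div_nonneg (angle_mem_Icc x y).1 hpi.le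
  rw [norm_smul, norm_smul, hx, hy, Real.norm_eq_abs, Real.norm_eq_abs, abs_of_nonneg h3, div_one,
    mul_one, mul_one, mul_one, abs_div, abs_of_pos hpi]
  have h5 : |Real.sin (InnerProductGeometry.angle x y)| / Real.pi ≤ 1 := by
    rw [div_le_one hpi]
    linarith [Real.abs_sin_le_one (InnerProductGeometry.angle x y)]
  linarith

lemma abs_inner_arcVec_sub_le {x v y x₀ v₀ y₀ : Vec k} (hx : ‖x‖ = 1) (hy : ‖y‖ = 1)
    (hx₀ : ‖x₀‖ = 1) (hv₀ : ‖v₀‖ = 1) (hy₀ : ‖y₀‖ = 1) {τ : ℝ} (h1 : ‖x - x₀‖ ≤ τ)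
    (h2 : ‖v - v₀‖ ≤ τ) (h3 : ‖y - y₀‖ ≤ τ) :
    |⟪v, arcVec x y⟫ - ⟪v₀, arcVec x₀ y₀⟫| ≤ 6 * τ := by
  have hτ : 0 ≤ τ := (norm_nonneg _).trans h1
  have e : ⟪v, arcVec x y⟫ - ⟪v₀, arcVec x₀ y₀⟫
      = ⟪v - v₀, arcVec x y⟫ + ⟪v₀, arcVec x y - arcVec x₀ y₀⟫ := by
    rw [inner_sub_left, inner_sub_right]
    ring
  rw [e]
  refine (abs_add_le _ _).trans ?_
  have a1 := (abs_real_inner_le_norm (v - v₀) (arcVec x y)).trans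
    (mul_le_mul h2 (norm_arcVec_le hx hy) (norm_nonneg _) hτ)
  have a2 := (abs_real_inner_le_norm v₀ (arcVec x y - arcVec x₀ y₀)).trans
    (mul_le_mul hv₀.le (norm_arcVec_sub_le hx hy hx₀ hy₀ h1 h3) (norm_nonneg _) zero_le_one)
  linarith

/-! ### Perturbation of the row terms -/

/-- The bound on the change of a row term caused by a sign change of `⟪x, a⟫`, which happens only in
a slab of width `κ`. -/
def slabTerm (κ : ℝ) (x v y a : Vec k) : ℝ :=
  if |⟪x, a⟫| ≤ κ then |⟪v, a⟫ * ⟪y, a⟫| else 0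

@[fun_prop]
lemma measurable_slabTerm (κ : ℝ) (x v y : Vec k) : Measurable (slabTerm κ x v y) := by
  unfold slabTerm
  refine Measurable.ite ?_ (by fun_prop) (by fun_prop)
  exact measurableSet_le (by fun_prop) measurable_const

lemma abs_slabTerm_le (κ : ℝ) (x v y a : Vec k) : |slabTerm κ x v y a| ≤ |⟪v, a⟫ * ⟪y, a⟫| := by
  unfold slabTerm
  split_ifs
  · rw [abs_abs]
  · rw [abs_zero]
    exact abs_nonneg _

lemma slabTerm_nonneg (κ : ℝ) (x v y a : Vec k) : 0 ≤ slabTerm κ x v y a := by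
  unfold slabTerm
  split_ifs
  · exact abs_nonneg _
  · exact le_rfl

lemma integral_slabTerm_le {κ : ℝ} (hκ : 0 < κ) {x v y : Vec k} (hx : ‖x‖ = 1) (hv : ‖v‖ = 1)
    (hy : ‖y‖ = 1) : ∫ a, slabTerm κ x v y a ∂(stdGaussian (Vec k)) ≤ 201 * √κ := by
  have hs : 0 < √κ := Real.sqrt_pos.2 hκ
  have hms : MeasurableSet {a : Vec k | |⟪x, a⟫| ≤ κ} :=
    measurableSet_le (by fun_prop) measurable_const
  -- the optimal threshold `M = κ^{-1/2}` in `z ≤ M + z² / M`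
  have hpt : ∀ a, slabTerm κ x v y a
      ≤ {a : Vec k | |⟪x, a⟫| ≤ κ}.indicator (fun _ => (√κ)⁻¹) a + √κ * (⟪v, a⟫ * ⟪y, a⟫) ^ 2 := by
    intro a
    have h0 : 0 ≤ √κ * (⟪v, a⟫ * ⟪y, a⟫) ^ 2 := by positivity
    unfold slabTerm
    by_cases h : |⟪x, a⟫| ≤ κ
    · rw [if_pos h, Set.indicator_of_mem (by exact h)]
      set z := ⟪v, a⟫ * ⟪y, a⟫
      have h1 : √κ * (√κ)⁻¹ = 1 := mul_inv_cancel₀ hs.ne'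
      rw [← sq_abs z]
      have h2 : 0 ≤ (√κ)⁻¹ * (√κ * |z| - 1) ^ 2 + |z| := by positivity
      have h3 : (√κ)⁻¹ * (√κ * |z| - 1) ^ 2 = √κ * |z| ^ 2 - 2 * |z| + (√κ)⁻¹ := by
        field_simp
        ring
      linarith
    · rw [if_neg h, Set.indicator_of_notMem (by exact h)]
      linarith
  have hi1 : Integrable ({a : Vec k | |⟪x, a⟫| ≤ κ}.indicator fun _ => (√κ)⁻¹)
      (stdGaussian (Vec k)) := (integrable_const _).indicator hms
  have hi2 := (integrable_sq_inner_mul_inner hv hy).const_mul √κ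
  refine (integral_mono_of_nonneg (Eventually.of_forall fun a => slabTerm_nonneg _ _ _ _ a)
    (hi1.add hi2) (Eventually.of_forall hpt)).trans ?_
  rw [integral_add' hi1 hi2, integral_const_mul, integral_indicator hms, setIntegral_const,
    smul_eq_mul]
  have h1 := mul_le_mul_of_nonneg_right (measureReal_abs_inner_le hx hκ.le) (inv_nonneg.2 hs.le)
  have h2 := mul_le_mul_of_nonneg_left (integral_sq_inner_mul_inner_le hv hy) hs.le
  have h3 : κ * (√κ)⁻¹ = √κ := by
    rw [← div_eq_mul_inv, Real.div_sqrt]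
  linarith

lemma abs_max_sub_max_le (u w : ℝ) : |max u 0 - max w 0| ≤ |u - w| :=
  abs_max_sub_max_le_abs u w 0

lemma abs_inner_le_of_norm_le {x a : Vec k} {τ : ℝ} (h : ‖x‖ ≤ τ) : |⟪x, a⟫| ≤ τ * ‖a‖ :=
  (abs_real_inner_le_norm x a).trans (mul_le_mul_of_nonneg_right h (norm_nonneg _))

lemma abs_rowTerm_sub_le {x v y x₀ v₀ y₀ a : Vec k} (hy : ‖y‖ = 1) (hv₀ : ‖v₀‖ = 1)
    {τ κ : ℝ} (h1 : ‖x - x₀‖ ≤ τ) (h2 : ‖v - v₀‖ ≤ τ) (h3 : ‖y - y₀‖ ≤ τ) (ha : τ * ‖a‖ ≤ κ) :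
    |rowTerm x v y a - rowTerm x₀ v₀ y₀ a| ≤ slabTerm κ x₀ v₀ y₀ a + 2 * τ * ‖a‖ ^ 2 := by
  have hτ : 0 ≤ τ := (norm_nonneg _).trans h1
  have i1 := abs_inner_le_of_norm_le (a := a) h1
  have i2 := abs_inner_le_of_norm_le (a := a) h2
  have i3 := abs_inner_le_of_norm_le (a := a) h3
  have i4 := abs_inner_le_of_norm_le (a := a) hy.le
  have i5 := abs_inner_le_of_norm_le (a := a) hv₀.le
  rw [inner_sub_left] at i1 i2 i3
  rw [one_mul] at i4 i5
  -- the change of the second and third arguments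
  have hA : |⟪v, a⟫ * max ⟪y, a⟫ 0 - ⟪v₀, a⟫ * max ⟪y₀, a⟫ 0| ≤ 2 * τ * ‖a‖ ^ 2 := by
    have e : ⟪v, a⟫ * max ⟪y, a⟫ 0 - ⟪v₀, a⟫ * max ⟪y₀, a⟫ 0
        = (⟪v, a⟫ - ⟪v₀, a⟫) * max ⟪y, a⟫ 0 + ⟪v₀, a⟫ * (max ⟪y, a⟫ 0 - max ⟪y₀, a⟫ 0) := by ring
    rw [e]
    refine (abs_add_le _ _).trans ?_
    rw [abs_mul, abs_mul]
    have b1 := mul_le_mul i2 ((abs_max_zero_le _).trans i4) (abs_nonneg _) (by positivity)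
    have b2 := mul_le_mul i5 ((abs_max_sub_max_le ⟪y, a⟫ ⟪y₀, a⟫).trans i3) (abs_nonneg _)
      (by positivity)
    nlinarith
  have hB : |⟪v₀, a⟫ * max ⟪y₀, a⟫ 0| ≤ |⟪v₀, a⟫ * ⟪y₀, a⟫| := by
    rw [abs_mul, abs_mul]
    exact mul_le_mul_of_nonneg_left (abs_max_zero_le _) (abs_nonneg _)
  have hpos : 0 ≤ 2 * τ * ‖a‖ ^ 2 := by positivity
  have hslab := slabTerm_nonneg κ x₀ v₀ y₀ a
  have i6 := abs_le.1 (i1.trans ha)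
  unfold rowTerm
  by_cases c1 : 0 < ⟪x, a⟫ <;> by_cases c2 : 0 < ⟪x₀, a⟫
  · rw [if_pos c1, if_pos c2]
    linarith
  · rw [if_pos c1, if_neg c2]
    have hmem : |⟪x₀, a⟫| ≤ κ := by rw [abs_le]; constructor <;> linarith [not_lt.1 c2]
    rw [slabTerm, if_pos hmem, zero_mul, sub_zero]
    have := abs_sub_abs_le_abs_sub (⟪v, a⟫ * max ⟪y, a⟫ 0) (⟪v₀, a⟫ * max ⟪y₀, a⟫ 0)
    linarith
  · rw [if_neg c1, if_pos c2]
    have hmem : |⟪x₀, a⟫| ≤ κ := by rw [abs_le]; constructor <;> linarith [not_lt.1 c1]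
    rw [slabTerm, if_pos hmem, zero_mul, zero_sub, abs_neg]
    linarith
  · rw [if_neg c1, if_neg c2]
    simp only [zero_mul, sub_zero, abs_zero]
    linarith

end Lipschitz

/-! ### Uniform concentration -/

section Uniform

variable {Ω U ι : Type*} [MeasurableSpace Ω] [MeasurableSpace U] {N k : ℕ} {P : Measure Ω}
  [IsProbabilityMeasure P] {ν : Measure U} [IsProbabilityMeasure ν] {X : Fin N → Ω → Vec k × U}

/-- The radius of the net in the proof of the uniform bound. -/
def netRadius (k : ℕ) (B t : ℝ) : ℝ := t ^ 2 / (10 ^ 7 * k * B)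

/-- The passage from a net to the sphere. -/
lemma abs_sum_rowTerm_sub_le_of_net {S : Finset (Vec k)} {B t : ℝ} (hB : 1 ≤ B) (ht0 : 0 < t)
    (ht1 : t ≤ 1) (hS : ∀ x ∈ S, ‖x‖ = 1)
    (hnet : ∀ x : Vec k, ‖x‖ = 1 → ∃ x₀ ∈ S, ‖x - x₀‖ ≤ netRadius k B t)
    {a : Fin N → Vec k} (ha : ∀ j, ‖a j‖ ≤ 3 * √k) {w : Fin N → ℝ} (hw0 : ∀ j, 0 ≤ w j)
    (hwB : ∀ j, w j ≤ B) {E : ℝ} (hE0 : 0 ≤ E) (hE1 : E ≤ 1)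
    (h₁ : ∀ x ∈ S, ∀ v ∈ S, ∀ y ∈ S, |∑ j, rowTerm x v y (a j) * w j
      - N * ((∫ a, rowTerm x v y a ∂(stdGaussian (Vec k))) * E)| ≤ N * t)
    (h₂ : ∀ x ∈ S, ∀ v ∈ S, ∀ y ∈ S, |∑ j, slabTerm (3 * √k * netRadius k B t) x v y (a j) * w j
      - N * ((∫ a, slabTerm (3 * √k * netRadius k B t) x v y a ∂(stdGaussian (Vec k))) * E)|
        ≤ N * t)
    {x v y : Vec k} (hx : ‖x‖ = 1) (hv : ‖v‖ = 1) (hy : ‖y‖ = 1) :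
    |∑ j, rowTerm x v y (a j) * w j - N * (⟪v, arcVec x y⟫ / 2 * E)| ≤ 3 * (N * t) := by
  obtain ⟨x₀, hx₀S, hx₀⟩ := hnet x hx
  obtain ⟨v₀, hv₀S, hv₀⟩ := hnet v hv
  obtain ⟨y₀, hy₀S, hy₀⟩ := hnet y hy
  have hk0 : 0 < k := by
    rcases Nat.eq_zero_or_pos k with rfl | h
    · rw [Subsingleton.elim x 0, norm_zero] at hx
      norm_num at hx
    · exact h
  have hk1 : (1 : ℝ) ≤ k := by exact_mod_cast hk0
  set τ := netRadius k B t with hτdef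
  have hB0 : 0 < B := by linarith
  have hτ0 : 0 < τ := by rw [hτdef, netRadius]; positivity
  have hkB : 1 ≤ (k : ℝ) * B := one_le_mul_of_one_le_of_one_le hk1 hB
  have hτkB : τ * (k * B) = t ^ 2 / 10 ^ 7 := by
    rw [hτdef, netRadius]
    field_simp
  have ht2 : t ^ 2 ≤ t := by nlinarith
  have hτt : τ ≤ t / 10 ^ 7 := by
    have : τ ≤ τ * (k * B) := le_mul_of_one_le_right hτ0.le hkB
    linarith
  set κ := 3 * √k * τ with hκdef
  have hsk : √(k : ℝ) ≤ k := by
    rw [Real.sqrt_le_left (by positivity)]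
    nlinarith
  have hsk0 : 0 < √(k : ℝ) := Real.sqrt_pos.2 (by linarith)
  have hκ0 : 0 < κ := by positivity
  have hκt : √κ ≤ t / 1000 := by
    rw [Real.sqrt_le_left (by positivity)]
    have h1 : √k * τ ≤ τ * (k * B) := by
      have : √k * τ ≤ (k * B) * τ := by
        refine mul_le_mul_of_nonneg_right (hsk.trans ?_) hτ0.le
        exact le_mul_of_one_le_right (by positivity) hB
      linarith
    have h2 : κ ≤ 3 * (t ^ 2 / 10 ^ 7) := by rw [hκdef]; linarith
    nlinarith [sq_nonneg t]
  have hN : (0 : ℝ) ≤ N := by positivity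
  have hslabE := integral_slabTerm_le hκ0 (hS _ hx₀S) (hS _ hv₀S) (hS _ hy₀S)
  have hslab0 : 0 ≤ ∫ a, slabTerm κ x₀ v₀ y₀ a ∂(stdGaussian (Vec k)) :=
    integral_nonneg fun a => slabTerm_nonneg _ _ _ _ a
  have g1 := h₁ x₀ hx₀S v₀ hv₀S y₀ hy₀S
  have g2 := h₂ x₀ hx₀S v₀ hv₀S y₀ hy₀S
  set Q := ∫ a, slabTerm κ x₀ v₀ y₀ a ∂(stdGaussian (Vec k)) with hQ
  have hx₀0 : x₀ ≠ 0 := by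
    rintro rfl
    simpa using hS _ hx₀S
  have hR : ∫ a, rowTerm x₀ v₀ y₀ a ∂(stdGaussian (Vec k)) = ⟪v₀, arcVec x₀ y₀⟫ / 2 := by
    rw [← two_mul_integral_rowTerm hx₀0]
    ring
  rw [hR] at g1
  -- the sum over the slab
  have hsl : ∑ j, slabTerm κ x₀ v₀ y₀ (a j) * w j ≤ N * (t / 4) + N * t := by
    have h1 : Q * E ≤ t / 4 := by
      have : Q * E ≤ Q * 1 := mul_le_mul_of_nonneg_left hE1 hslab0
      linarith
    have h2 := (abs_le.1 g2).2
    have h3 := mul_le_mul_of_nonneg_left h1 hN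
    linarith
  -- the difference of the sums
  have hdiff : |∑ j, rowTerm x v y (a j) * w j - ∑ j, rowTerm x₀ v₀ y₀ (a j) * w j|
      ≤ N * (t / 4) + N * t + N * (t / 4) := by
    rw [← Finset.sum_sub_distrib]
    refine (Finset.abs_sum_le_sum_abs _ _).trans ?_
    have h1 : ∀ j ∈ Finset.univ, |rowTerm x v y (a j) * w j - rowTerm x₀ v₀ y₀ (a j) * w j|
        ≤ slabTerm κ x₀ v₀ y₀ (a j) * w j + t / 4 := by
      intro j _
      rw [← sub_mul, abs_mul, abs_of_nonneg (hw0 j)]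
      have h2 := abs_rowTerm_sub_le (x := x) (v := v) (y := y) (x₀ := x₀) (y₀ := y₀) (a := a j)
        hy (hS _ hv₀S) (κ := κ) hx₀ hv₀ hy₀ (by
          rw [hκdef]
          nlinarith [ha j])
      have h3 : ‖a j‖ ^ 2 ≤ 9 * k := by
        have := pow_le_pow_left₀ (norm_nonneg _) (ha j) 2
        rw [mul_pow, Real.sq_sqrt (by positivity)] at this
        linarith
      have h4 : 2 * τ * ‖a j‖ ^ 2 * w j ≤ t / 4 := by
        have h5 : 2 * τ * ‖a j‖ ^ 2 * w j ≤ 2 * τ * (9 * k) * B := by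
          refine mul_le_mul ?_ (hwB j) (hw0 j) (by positivity)
          exact mul_le_mul_of_nonneg_left h3 (by positivity)
        linarith
      have h6 := mul_le_mul_of_nonneg_right h2 (hw0 j)
      linarith
    refine (Finset.sum_le_sum h1).trans ?_
    rw [Finset.sum_add_distrib, Finset.sum_const, Finset.card_univ, Fintype.card_fin, nsmul_eq_mul]
    linarith
  have harc := abs_inner_arcVec_sub_le (v := v) (v₀ := v₀) hx hy (hS _ hx₀S) (hS _ hv₀S)
    (hS _ hy₀S) hx₀ hv₀ hy₀
  have hexp : |N * (⟪v₀, arcVec x₀ y₀⟫ / 2 * E) - N * (⟪v, arcVec x y⟫ / 2 * E)| ≤ N * (t / 4) := by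
    rw [← mul_sub, ← sub_mul, ← sub_div, abs_mul, abs_of_nonneg hN, abs_mul, abs_of_nonneg hE0,
      abs_div, abs_two, abs_sub_comm]
    refine mul_le_mul_of_nonneg_left ?_ hN
    have h7 : |⟪v, arcVec x y⟫ - ⟪v₀, arcVec x₀ y₀⟫| / 2 ≤ t / 4 := by linarith
    exact (mul_le_mul h7 hE1 hE0 (by positivity)).trans (by linarith)
  have a1 := abs_le.1 hdiff
  have a2 := abs_le.1 g1
  have a3 := abs_le.1 hexp
  have hNt : 0 ≤ (N : ℝ) * t := by positivity
  rw [abs_le]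
  constructor <;> linarith [a1.1, a1.2, a2.1, a2.2, a3.1, a3.2]

/-- Simultaneous concentration of all weighted empirical means of row terms. -/
theorem measureReal_uniform_le (hX : IsIIDSample P ((stdGaussian (Vec k)).prod ν) X)
    (I : Finset ι) {b : ι → U → ℝ} (hbm : ∀ i ∈ I, Measurable (b i)) {B : ℝ} (hB : 1 ≤ B)
    (hb0 : ∀ i ∈ I, ∀ u, 0 ≤ b i u) (hbB : ∀ i ∈ I, ∀ u, b i u ≤ B)
    (hb2 : ∀ i ∈ I, ∫ u, b i u ^ 2 ∂ν ≤ 200) (hb1 : ∀ i ∈ I, ∫ u, b i u ∂ν ≤ 1) {t : ℝ}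
    (ht0 : 0 < t) (ht1 : t ≤ 1) :
    P.real {ω | ¬ ((∀ j, ‖(X j ω).1‖ ≤ 3 * √k) ∧ ∀ i ∈ I, ∀ x v y : Vec k, ‖x‖ = 1 → ‖v‖ = 1 →
        ‖y‖ = 1 → |∑ j, rowTerm x v y (X j ω).1 * b i (X j ω).2
          - N * (⟪v, arcVec x y⟫ / 2 * ∫ u, b i u ∂ν)| ≤ 3 * (N * t))}
      ≤ N * Real.exp (-k) + I.card * ((5 * k / netRadius k B t) ^ k) ^ 3 *
        (4 * Real.exp (-(N * (t ^ 2 / (160000 * B))))) := by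
  classical
  rcases Nat.eq_zero_or_pos k with rfl | hk0
  · refine le_trans (le_of_eq ?_) (by positivity : (0 : ℝ) ≤ _)
    rw [measureReal_def]
    convert ENNReal.toReal_zero
    convert measure_empty (μ := P)
    ext ω
    simp only [Set.mem_ofPred_eq, Set.mem_empty_iff_false, iff_false, not_not]
    refine ⟨fun j => ?_, fun i _ x v y hx => ?_⟩
    · rw [Subsingleton.elim (X j ω).1 0]
      simp
    · rw [Subsingleton.elim x 0, norm_zero] at hx
      norm_num at hx
  have hk1 : (1 : ℝ) ≤ k := by exact_mod_cast hk0
  have hB0 : 0 < B := by linarith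
  have hτ0 : 0 < netRadius k B t := by rw [netRadius]; positivity
  have hτ1 : netRadius k B t ≤ 1 := by
    rw [netRadius, div_le_one (by positivity)]
    have : 1 ≤ (k : ℝ) * B := one_le_mul_of_one_le_of_one_le hk1 hB
    nlinarith
  obtain ⟨S, hS, hcard, hnet⟩ := exists_sphere_net k hτ0 hτ1
  set κ := 3 * √k * netRadius k B t with hκ
  set q := Real.exp (-(N * (t ^ 2 / (160000 * B)))) with hq
  let bad₀ : Fin N → Set Ω := fun j => {ω | 3 * √k < ‖(X j ω).1‖}
  let bad₁ : ι × Vec k × Vec k × Vec k → Set Ω := fun p =>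
    {ω | N * t ≤ |∑ j, rowTerm p.2.1 p.2.2.1 p.2.2.2 (X j ω).1 * b p.1 (X j ω).2
      - N * ((∫ a, rowTerm p.2.1 p.2.2.1 p.2.2.2 a ∂(stdGaussian (Vec k))) * ∫ u, b p.1 u ∂ν)|}
  let bad₂ : ι × Vec k × Vec k × Vec k → Set Ω := fun p =>
    {ω | N * t ≤ |∑ j, slabTerm κ p.2.1 p.2.2.1 p.2.2.2 (X j ω).1 * b p.1 (X j ω).2
      - N * ((∫ a, slabTerm κ p.2.1 p.2.2.1 p.2.2.2 a ∂(stdGaussian (Vec k))) * ∫ u, b p.1 u ∂ν)|}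
  let T := I ×ˢ S ×ˢ S ×ˢ S
  have hsub : {ω | ¬ ((∀ j, ‖(X j ω).1‖ ≤ 3 * √k) ∧ ∀ i ∈ I, ∀ x v y : Vec k, ‖x‖ = 1 → ‖v‖ = 1 →
        ‖y‖ = 1 → |∑ j, rowTerm x v y (X j ω).1 * b i (X j ω).2
          - N * (⟪v, arcVec x y⟫ / 2 * ∫ u, b i u ∂ν)| ≤ 3 * (N * t))}
      ⊆ (⋃ j ∈ Finset.univ, bad₀ j) ∪ ⋃ p ∈ T, (bad₁ p ∪ bad₂ p) := by
    intro ω hω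
    by_contra hnot
    simp only [Set.mem_union, Set.mem_iUnion, not_or, not_exists, Finset.mem_univ] at hnot
    obtain ⟨n0, n1⟩ := hnot
    have ha : ∀ j, ‖(X j ω).1‖ ≤ 3 * √k := fun j => not_lt.1 (n0 j trivial)
    refine hω ⟨ha, fun i hi x v y hx hv hy => ?_⟩
    refine abs_sum_rowTerm_sub_le_of_net hB ht0 ht1 hS hnet ha (fun j => hb0 i hi _)
      (fun j => hbB i hi _) (integral_nonneg (hb0 i hi)) (hb1 i hi) ?_ ?_ hx hv hy
    · intro x' hx' v' hv' y' hy'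
      have := (n1 (i, x', v', y') (by simp [T, hi, hx', hv', hy'])).1
      exact (not_le.1 this).le
    · intro x' hx' v' hv' y' hy'
      have := (n1 (i, x', v', y') (by simp [T, hi, hx', hv', hy'])).2
      exact (not_le.1 this).le
  refine (measureReal_mono hsub).trans ((measureReal_union_le _ _).trans (add_le_add ?_ ?_))
  · refine (measureReal_biUnion_finset_le _ _).trans ?_
    have h1 : ∀ j ∈ Finset.univ, P.real (bad₀ j) ≤ Real.exp (-k) := by
      intro j _
      have hlaw := (hX.2 j).measureReal_eq (p := fun q => 3 * √k < ‖q.1‖)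
        (measurableSet_lt measurable_const (by fun_prop))
      change P.real {ω | 3 * √k < ‖(X j ω).1‖} ≤ _
      rw [hlaw]
      have h2 : {q : Vec k × U | 3 * √k < ‖q.1‖} = {a : Vec k | 3 * √k < ‖a‖} ×ˢ Set.univ := by
        ext q
        simp
      rw [h2, measureReal_prod_prod, probReal_univ, mul_one]
      exact measureReal_norm_gt_le
    refine (Finset.sum_le_sum h1).trans (le_of_eq ?_)
    rw [Finset.sum_const, Finset.card_univ, Fintype.card_fin, nsmul_eq_mul]
  · refine (measureReal_biUnion_finset_le _ _).trans ?_
    have h1 : ∀ p ∈ T, P.real (bad₁ p ∪ bad₂ p) ≤ 4 * q := by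
      rintro ⟨i, x, v, y⟩ hp
      simp only [T, Finset.mem_product] at hp
      obtain ⟨hi, hx, hv, hy⟩ := hp
      refine (measureReal_union_le _ _).trans ?_
      have c1 := measureReal_abs_sum_mul_ge_le hX (measurable_rowTerm x v y) (hS v hv) (hS y hy)
        (fun a => by rw [abs_mul]; exact abs_rowTerm_le x v y a) (hbm i hi) hB (hb0 i hi) (hbB i hi)
        (hb2 i hi) ht0 ht1
      have c2 := measureReal_abs_sum_mul_ge_le hX (measurable_slabTerm κ x v y) (hS v hv) (hS y hy)
        (abs_slabTerm_le κ x v y) (hbm i hi) hB (hb0 i hi) (hbB i hi) (hb2 i hi) ht0 ht1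
      linarith
    refine (Finset.sum_le_sum h1).trans ?_
    rw [Finset.sum_const, nsmul_eq_mul]
    refine mul_le_mul_of_nonneg_right ?_ (by positivity)
    have h3 : (T.card : ℝ) = I.card * (S.card : ℝ) ^ 3 := by
      simp only [T, Finset.card_product]
      push_cast
      ring
    rw [h3]
    gcongr

end Uniform

/-! ### The rows of the random weights -/

section Rows

variable {Ω S : Type*} [MeasurableSpace Ω] [MeasurableSpace S] {P : Measure Ω}
  {N k : ℕ}

/-- The `j`-th row of `V`, scaled so that it is standard Gaussian if the entries have variance
`1/N`. -/
def scaledRow (V : Matrix (Fin N) (Fin k) ℝ) (j : Fin N) : Vec k :=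
  WithLp.toLp 2 fun i => √N * V j i

lemma mulVec_eq_inner_scaledRow (hN : 0 < N) (V : Matrix (Fin N) (Fin k) ℝ) (x : Vec k)
    (j : Fin N) : V.mulVec x.ofLp j = (√N)⁻¹ * ⟪x, scaledRow V j⟫ := by
  have h : √(N : ℝ) ≠ 0 := by positivity
  simp only [Matrix.mulVec, dotProduct, scaledRow, PiLp.inner_apply, RCLike.inner_apply,
    conj_trivial, Finset.mul_sum]
  refine Finset.sum_congr rfl fun i _ => ?_
  field_simp

lemma truncRows_eq_self (hN : 0 < N) {V : Matrix (Fin N) (Fin k) ℝ}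
    (h : ∀ j, ‖scaledRow V j‖ ≤ 3 * √k) : truncRows V = V := by
  have hN0 : 0 < √(N : ℝ) := by positivity
  ext i j
  rw [truncRows, Matrix.of_apply, if_pos]
  have h1 : scaledRow V i = √N • (WithLp.toLp 2 (V i) : Vec k) := by
    ext j
    simp [scaledRow]
  have h2 := h i
  rw [h1, norm_smul, Real.norm_of_nonneg hN0.le] at h2
  rw [Real.sqrt_div (by positivity), ← mul_div_assoc, le_div_iff₀ hN0]
  linarith

/-- The product of two entries of the layer maps as a row term. -/
lemma selLayer_mul_layer (hN : 0 < N) (V : Matrix (Fin N) (Fin k) ℝ) (x v y : Vec k) (j : Fin N) :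
    selLayer V x v j * layer V y j = (N : ℝ)⁻¹ * rowTerm x v y (scaledRow V j) := by
  have h : 0 < (√(N : ℝ))⁻¹ := by positivity
  have h1 : (N : ℝ)⁻¹ = (√(N : ℝ))⁻¹ * (√(N : ℝ))⁻¹ := by
    rw [← mul_inv, Real.mul_self_sqrt (by positivity)]
  rw [selLayer_apply, layer_apply, mulVec_eq_inner_scaledRow hN, mulVec_eq_inner_scaledRow hN,
    mulVec_eq_inner_scaledRow hN, rowTerm, h1]
  simp only [mul_pos_iff_of_pos_left h]
  have h2 : max ((√(N : ℝ))⁻¹ * ⟪y, scaledRow V j⟫) 0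
      = (√(N : ℝ))⁻¹ * max ⟪y, scaledRow V j⟫ 0 := by
    rw [mul_max_of_nonneg _ _ h.le, mul_zero]
  rw [h2]
  split_ifs <;> ring

lemma layer_mul_layer (hN : 0 < N) (V : Matrix (Fin N) (Fin k) ℝ) (y y' : Vec k) (j : Fin N) :
    layer V y j * layer V y' j
      = (N : ℝ)⁻¹ * (max ⟪y, scaledRow V j⟫ 0 * max ⟪y', scaledRow V j⟫ 0) := by
  have h : 0 < (√(N : ℝ))⁻¹ := by positivity
  have h1 : (N : ℝ)⁻¹ = (√(N : ℝ))⁻¹ * (√(N : ℝ))⁻¹ := by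
    rw [← mul_inv, Real.mul_self_sqrt (by positivity)]
  have h2 : ∀ y : Vec k, max ((√(N : ℝ))⁻¹ * ⟪y, scaledRow V j⟫) 0
      = (√(N : ℝ))⁻¹ * max ⟪y, scaledRow V j⟫ 0 := by
    intro y
    rw [mul_max_of_nonneg _ _ h.le, mul_zero]
  rw [layer_apply, layer_apply, mulVec_eq_inner_scaledRow hN, mulVec_eq_inner_scaledRow hN, h1, h2,
    h2]
  ring

lemma hasLaw_scaledRow (hN : 0 < N) {V : Ω → Matrix (Fin N) (Fin k) ℝ}
    (hV : IsIIDGaussian P N V) :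
    HasLaw (fun ω j => scaledRow (V ω) j) (Measure.pi fun _ => stdGaussian (Vec k)) P := by
  have hN0 : (N : ℝ) ≠ 0 := by positivity
  have h1 : ∀ ij : Fin N × Fin k,
      HasLaw (fun ω => √N * V ω ij.1 ij.2) (gaussianReal 0 1) P := by
    intro ij
    have h := gaussianReal_const_mul (hV.1 ij.1 ij.2) √N
    convert h using 2
    · simp
    · ext
      simp [Real.sq_sqrt, hN0]
  have h2 : iIndepFun (fun (ij : Fin N × Fin k) ω => √N * V ω ij.1 ij.2) P :=
    hV.2.comp (fun _ x => √N * x) fun _ => by fun_prop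
  have h3 := iIndepFun.hasLaw_pi h1 h2
  have h4 : MeasurePreserving (MeasurableEquiv.curry (Fin N) (Fin k) ℝ)
      (Measure.pi fun _ => gaussianReal 0 1)
      (Measure.pi fun _ => Measure.pi fun _ => gaussianReal 0 1) := by
    refine ⟨by fun_prop, ?_⟩
    have h := Measure.infinitePi_map_curry (fun (_ : Fin N) (_ : Fin k) => gaussianReal 0 1)
    simpa only [Measure.infinitePi_eq_pi] using h
  have h5 : MeasurePreserving (fun (a : Fin N → Fin k → ℝ) j => (WithLp.toLp 2 (a j) : Vec k))
      (Measure.pi fun _ => Measure.pi fun _ => gaussianReal 0 1)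
      (Measure.pi fun _ => stdGaussian (Vec k)) :=
    measurePreserving_pi _ _ fun _ => ⟨by fun_prop, map_pi_eq_stdGaussian⟩
  exact h5.comp_hasLaw (h4.comp_hasLaw h3)

variable [IsProbabilityMeasure P]

lemma isIIDSample_of_hasLaw_pi {ρ : Measure S} [IsProbabilityMeasure ρ] {X : Fin N → Ω → S}
    (h : HasLaw (fun ω j => X j ω) (Measure.pi fun _ => ρ) P) : IsIIDSample P ρ X := by
  have h1 : ∀ j, HasLaw (X j) ρ P := fun j =>
    (measurePreserving_eval (fun _ : Fin N => ρ) j).comp_hasLaw h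
  exact ⟨(iIndepFun_iff_hasLaw_pi_pi h1).2 h, h1⟩

lemma isIIDSample_scaledRow_unit (hN : 0 < N) {V : Ω → Matrix (Fin N) (Fin k) ℝ}
    (hV : IsIIDGaussian P N V) :
    IsIIDSample P ((stdGaussian (Vec k)).prod (Measure.dirac ()))
      fun j ω => (scaledRow (V ω) j, ()) := by
  refine isIIDSample_of_hasLaw_pi ?_
  have h5 : MeasurePreserving (fun (a : Fin N → Vec k) j => (a j, ()))
      (Measure.pi fun _ => stdGaussian (Vec k))
      (Measure.pi fun _ => (stdGaussian (Vec k)).prod (Measure.dirac ())) :=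
    measurePreserving_pi _ _ fun _ => ⟨by fun_prop, (Measure.prod_dirac ()).symm⟩
  exact h5.comp_hasLaw (hasLaw_scaledRow hN hV)

lemma isIIDSample_scaledRow_pair {q : ℕ} (hN : 0 < N) {V : Ω → Matrix (Fin N) (Fin k) ℝ}
    {V' : Ω → Matrix (Fin N) (Fin q) ℝ} (hV : IsIIDGaussian P N V) (hV' : IsIIDGaussian P N V')
    (hind : IndepFun (fun ω (ij : Fin N × Fin k) => V ω ij.1 ij.2)
      (fun ω (ij : Fin N × Fin q) => V' ω ij.1 ij.2) P) :
    IsIIDSample P ((stdGaussian (Vec k)).prod (stdGaussian (Vec q)))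
      fun j ω => (scaledRow (V ω) j, scaledRow (V' ω) j) := by
  refine isIIDSample_of_hasLaw_pi ?_
  have h1 : IndepFun (fun ω j => scaledRow (V ω) j) (fun ω j => scaledRow (V' ω) j) P :=
    hind.comp (φ := fun (a : Fin N × Fin k → ℝ) j => (WithLp.toLp 2 fun i => √N * a (j, i) : Vec k))
      (ψ := fun (a : Fin N × Fin q → ℝ) j => (WithLp.toLp 2 fun i => √N * a (j, i) : Vec q))
      (by fun_prop) (by fun_prop)
  have h2 := h1.hasLaw_prod (hasLaw_scaledRow hN hV) (hasLaw_scaledRow hN hV')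
  exact (measurePreserving_arrowProdEquivProdArrow (Vec k) (Vec q) (Fin N)
    (fun _ => stdGaussian (Vec k)) (fun _ => stdGaussian (Vec q))).symm.comp_hasLaw h2

end Rows

/-! ### Gaussian weights satisfy the distribution conditions -/

section Homogeneity

variable {N k q : ℕ} {δ : ℝ}

lemma eq_norm_smul_unit {k : ℕ} {x : Vec k} (hx : x ≠ 0) : ∃ u : Vec k, ‖u‖ = 1 ∧ x = ‖x‖ • u :=
  ⟨‖x‖⁻¹ • x, norm_smul_inv_norm hx, by
    rw [smul_smul, mul_inv_cancel₀ (norm_ne_zero_iff.2 hx), one_smul]⟩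

lemma arcVec_smul {a b : ℝ} (ha : 0 < a) (hb : 0 < b) (x y : Vec k) :
    arcVec (a • x) (b • y) = b • arcVec x y := by
  rw [arcVec, arcVec, InnerProductGeometry.angle_smul_left_of_pos _ _ ha,
    InnerProductGeometry.angle_smul_right_of_pos _ _ hb, norm_smul, norm_smul,
    Real.norm_of_nonneg ha.le, Real.norm_of_nonneg hb.le, smul_add, smul_smul, smul_smul, smul_smul,
    smul_smul]
  congr 1
  · rw [mul_comm]
  · congr 1
    field_simp

lemma layer_zero_right (W : Matrix (Fin N) (Fin k) ℝ) : layer W 0 = 0 := by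
  have := layer_smul W le_rfl (0 : Vec k)
  simpa using this

lemma wdc_of_unit {W : Matrix (Fin N) (Fin k) ℝ}
    (h : ∀ x v y : Vec k, ‖x‖ = 1 → ‖v‖ = 1 → ‖y‖ = 1 →
      |2 * ⟪selLayer W x v, layer W y⟫ - ⟪v, arcVec x y⟫| ≤ δ) : WDC δ W := by
  intro x v y hx
  rcases eq_or_ne v 0 with rfl | hv
  · simp
  rcases eq_or_ne y 0 with rfl | hy
  · simp [layer_zero_right, arcVec_zero_right]
  have px := norm_pos_iff.2 hx
  have pv := norm_pos_iff.2 hv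
  have py := norm_pos_iff.2 hy
  obtain ⟨x', hx', ex⟩ := eq_norm_smul_unit hx
  obtain ⟨v', hv', ev⟩ := eq_norm_smul_unit hv
  obtain ⟨y', hy', ey⟩ := eq_norm_smul_unit hy
  have e : 2 * ⟪selLayer W x v, layer W y⟫ - ⟪v, arcVec x y⟫
      = (2 * ⟪selLayer W x' v', layer W y'⟫ - ⟪v', arcVec x' y'⟫) * (‖v‖ * ‖y‖) := by
    conv_lhs => rw [ex, ev, ey]
    rw [selLayer_smul_left W px, map_smul, layer_smul W py.le, arcVec_smul px py,
      real_inner_smul_left, real_inner_smul_right, real_inner_smul_left, real_inner_smul_right]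
    ring
  rw [e, abs_mul, abs_of_pos (mul_pos pv py)]
  exact mul_le_mul_of_nonneg_right (h x' v' y' hx' hv' hy') (mul_pos pv py).le

lemma jointWDC_of_unit {A : Matrix (Fin N) (Fin k) ℝ} {B : Matrix (Fin N) (Fin q) ℝ}
    (h : ∀ x v x' : Vec k, ‖x‖ = 1 → ‖v‖ = 1 → ‖x'‖ = 1 → ∀ y y' : Vec q, ‖y‖ = 1 → ‖y'‖ = 1 →
      |4 * N * ∑ j, selLayer A x v j * layer A x' j * (layer B y j * layer B y' j)
        - ⟪v, arcVec x x'⟫ * ⟪y, arcVec y y'⟫| ≤ δ) : JointWDC δ A B := by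
  intro x v z hx y w
  rcases eq_or_ne v 0 with rfl | hv
  · simp
  rcases eq_or_ne z 0 with rfl | hz
  · simp [layer_zero_right, arcVec_zero_right]
  rcases eq_or_ne y 0 with rfl | hy
  · simp [layer_zero_right]
  rcases eq_or_ne w 0 with rfl | hw
  · simp [layer_zero_right, arcVec_zero_right]
  have px := norm_pos_iff.2 hx
  have pv := norm_pos_iff.2 hv
  have pz := norm_pos_iff.2 hz
  have py := norm_pos_iff.2 hy
  have pw := norm_pos_iff.2 hw
  obtain ⟨x', hx', ex⟩ := eq_norm_smul_unit hx
  obtain ⟨v', hv', ev⟩ := eq_norm_smul_unit hv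
  obtain ⟨z', hz', ez⟩ := eq_norm_smul_unit hz
  obtain ⟨y', hy', ey⟩ := eq_norm_smul_unit hy
  obtain ⟨w', hw', ew⟩ := eq_norm_smul_unit hw
  have pos : 0 < ‖v‖ * ‖z‖ * (‖y‖ * ‖w‖) := by positivity
  have e : 4 * N * ∑ j, selLayer A x v j * layer A z j * (layer B y j * layer B w j)
        - ⟪v, arcVec x z⟫ * ⟪y, arcVec y w⟫
      = (4 * N * ∑ j, selLayer A x' v' j * layer A z' j * (layer B y' j * layer B w' j)
        - ⟪v', arcVec x' z'⟫ * ⟪y', arcVec y' w'⟫) * (‖v‖ * ‖z‖ * (‖y‖ * ‖w‖)) := by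
    conv_lhs => rw [ex, ev, ez, ey, ew]
    rw [selLayer_smul_left A px, map_smul, layer_smul A pz.le, layer_smul B py.le,
      layer_smul B pw.le, arcVec_smul px pz, arcVec_smul py pw,
      real_inner_smul_left, real_inner_smul_right, real_inner_smul_left, real_inner_smul_right]
    simp only [PiLp.smul_apply, smul_eq_mul]
    rw [sub_mul, mul_assoc _ (∑ j, _) (‖v‖ * _ * _), Finset.sum_mul]
    congr 1
    · congr 1
      exact Finset.sum_congr rfl fun j _ => by ring
    · ring
  rw [e, abs_mul, abs_of_pos pos]
  exact mul_le_mul_of_nonneg_right (h x' v' z' hx' hv' hz' y' w' hy' hw') pos.le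

end Homogeneity

section Probability

variable {Ω : Type*} [MeasurableSpace Ω] {P : Measure Ω} [IsProbabilityMeasure P] {N k q : ℕ}

/-- A Gaussian matrix satisfies the weight distribution condition, except on an event whose
probability is bounded by the union bound over a net. -/
theorem measureReal_not_wdc_le (hN : 0 < N) {V : Ω → Matrix (Fin N) (Fin k) ℝ}
    (hV : IsIIDGaussian P N V) {t δ : ℝ} (ht0 : 0 < t) (ht1 : t ≤ 1) (hδ : 6 * t ≤ δ) :
    P.real {ω | ¬ WDC δ (V ω)} ≤ N * Real.exp (-k) +
      ((5 * k / netRadius k 1 t) ^ k) ^ 3 * (4 * Real.exp (-(N * (t ^ 2 / 160000)))) := by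
  have h := measureReal_uniform_le (isIIDSample_scaledRow_unit hN hV) {()} (b := fun _ _ => 1)
    (fun _ _ => measurable_const) le_rfl (fun _ _ _ => zero_le_one) (fun _ _ _ => le_rfl)
    (by simp) (by simp) ht0 ht1
  rw [Finset.card_singleton, Nat.cast_one, one_mul, mul_one] at h
  refine (measureReal_mono ?_).trans h
  intro ω hω hgood
  refine hω (wdc_of_unit fun x v y hx hv hy => ?_)
  have h1 := hgood.2 () (Finset.mem_singleton_self _) x v y hx hv hy
  have hN0 : (0 : ℝ) < N := by positivity
  simp only [mul_one, integral_const, probReal_univ, smul_eq_mul] at h1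
  have e : 2 * ⟪selLayer (V ω) x v, layer (V ω) y⟫ - ⟪v, arcVec x y⟫
      = 2 / N * (∑ j, rowTerm x v y (scaledRow (V ω) j) - N * (⟪v, arcVec x y⟫ / 2)) := by
    have h2 : ⟪selLayer (V ω) x v, layer (V ω) y⟫
        = (N : ℝ)⁻¹ * ∑ j, rowTerm x v y (scaledRow (V ω) j) := by
      rw [PiLp.inner_apply, Finset.mul_sum]
      refine Finset.sum_congr rfl fun j _ => ?_
      rw [← selLayer_mul_layer hN, RCLike.inner_apply, conj_trivial, mul_comm]
    rw [h2]
    field_simp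
  rw [e, abs_mul, abs_of_pos (by positivity)]
  refine (mul_le_mul_of_nonneg_left h1 (by positivity)).trans (le_trans (le_of_eq ?_) hδ)
  field_simp
  ring

/-- The product of two rectified linear functions, truncated at the level which it exceeds only for
vectors of norm more than `3 √q`. -/
def truncWeight (i : Vec q × Vec q) (u : Vec q) : ℝ :=
  min (max ⟪i.1, u⟫ 0 * max ⟪i.2, u⟫ 0) (9 * q)

lemma measurable_truncWeight (i : Vec q × Vec q) : Measurable (truncWeight i) := by
  unfold truncWeight
  fun_prop

lemma truncWeight_nonneg (i : Vec q × Vec q) (u : Vec q) : 0 ≤ truncWeight i u :=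
  le_min (mul_nonneg (le_max_right _ _) (le_max_right _ _)) (by positivity)

lemma relu_mul_relu_le_abs (y y' u : Vec q) :
    max ⟪y, u⟫ 0 * max ⟪y', u⟫ 0 ≤ |⟪y, u⟫ * ⟪y', u⟫| := by
  rw [abs_mul]
  exact mul_le_mul (max_le (le_abs_self _) (abs_nonneg _)) (max_le (le_abs_self _) (abs_nonneg _))
    (le_max_right _ _) (abs_nonneg _)

lemma integrable_relu_mul_relu {y y' : Vec q} (hy : ‖y‖ = 1) (hy' : ‖y'‖ = 1) :
    Integrable (fun u => max ⟪y, u⟫ 0 * max ⟪y', u⟫ 0) (stdGaussian (Vec q)) := by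
  refine ((integrable_const 1).add (integrable_sq_inner_mul_inner hy hy')).mono'
    (by fun_prop) (Eventually.of_forall fun u => ?_)
  have h0 : 0 ≤ max ⟪y, u⟫ 0 * max ⟪y', u⟫ 0 := by positivity
  rw [Real.norm_of_nonneg h0, Pi.add_apply, ← sq_abs (⟪y, u⟫ * ⟪y', u⟫)]
  have h1 := relu_mul_relu_le_abs y y' u
  nlinarith [sq_nonneg (|⟪y, u⟫ * ⟪y', u⟫| - 1)]

lemma two_mul_integral_relu_eq_inner {y y' : Vec q} (hy : ‖y‖ = 1) :
    2 * ∫ u, max ⟪y, u⟫ 0 * max ⟪y', u⟫ 0 ∂(stdGaussian (Vec q)) = ⟪y, arcVec y y'⟫ := by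
  have h0 : y ≠ 0 := by
    rintro rfl
    simp at hy
  rw [two_mul_integral_relu_mul_relu, inner_self_arcVec h0]

lemma integral_truncWeight_sq_le {i : Vec q × Vec q} (h1 : ‖i.1‖ = 1) (h2 : ‖i.2‖ = 1) :
    ∫ u, truncWeight i u ^ 2 ∂(stdGaussian (Vec q)) ≤ 200 := by
  refine (integral_mono_of_nonneg (Eventually.of_forall fun u => sq_nonneg _)
    (integrable_sq_inner_mul_inner h1 h2) (Eventually.of_forall fun u => ?_)).trans
    (integral_sq_inner_mul_inner_le h1 h2)
  change truncWeight i u ^ 2 ≤ (⟪i.1, u⟫ * ⟪i.2, u⟫) ^ 2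
  rw [← sq_abs (⟪i.1, u⟫ * ⟪i.2, u⟫)]
  exact pow_le_pow_left₀ (truncWeight_nonneg i u)
    ((min_le_left _ _).trans (relu_mul_relu_le_abs _ _ _)) 2

lemma integrable_truncWeight {i : Vec q × Vec q} (h1 : ‖i.1‖ = 1) (h2 : ‖i.2‖ = 1) :
    Integrable (truncWeight i) (stdGaussian (Vec q)) := by
  refine (integrable_relu_mul_relu h1 h2).mono' (measurable_truncWeight i).aestronglyMeasurable
    (Eventually.of_forall fun u => ?_)
  rw [Real.norm_of_nonneg (truncWeight_nonneg i u)]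
  exact min_le_left _ _

lemma integral_truncWeight_le_integral_relu {i : Vec q × Vec q} (h1 : ‖i.1‖ = 1) (h2 : ‖i.2‖ = 1) :
    ∫ u, truncWeight i u ∂(stdGaussian (Vec q))
      ≤ ∫ u, max ⟪i.1, u⟫ 0 * max ⟪i.2, u⟫ 0 ∂(stdGaussian (Vec q)) :=
  integral_mono (integrable_truncWeight h1 h2) (integrable_relu_mul_relu h1 h2)
    fun _ => min_le_left _ _

lemma integral_truncWeight_le_one {i : Vec q × Vec q} (h1 : ‖i.1‖ = 1) (h2 : ‖i.2‖ = 1) :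
    ∫ u, truncWeight i u ∂(stdGaussian (Vec q)) ≤ 1 := by
  have h := integral_truncWeight_le_integral_relu h1 h2
  have h3 := two_mul_integral_relu_mul_relu i.1 i.2
  rw [h1, h2, one_mul, one_mul] at h3
  have hm := angle_mem_Icc i.1 i.2
  have h4 := (abs_le.1 (abs_cosAngleMap_le hm.1 hm.2)).2
  linarith

/-- The truncation changes the expectation by at most `200 / (9 q)`, because
`max (z - M, 0) ≤ z² / M`. -/
lemma integral_relu_le_integral_truncWeight_add {i : Vec q × Vec q} (hq : 0 < q) (h1 : ‖i.1‖ = 1)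
    (h2 : ‖i.2‖ = 1) : ∫ u, max ⟪i.1, u⟫ 0 * max ⟪i.2, u⟫ 0 ∂(stdGaussian (Vec q))
      ≤ ∫ u, truncWeight i u ∂(stdGaussian (Vec q)) + 200 / (9 * q) := by
  have hM : (0 : ℝ) < 9 * q := by positivity
  have hi := (integrable_sq_inner_mul_inner h1 h2).div_const (9 * q)
  have h3 : ∫ u, max ⟪i.1, u⟫ 0 * max ⟪i.2, u⟫ 0 ∂(stdGaussian (Vec q))
      ≤ ∫ u, (truncWeight i u + (⟪i.1, u⟫ * ⟪i.2, u⟫) ^ 2 / (9 * q)) ∂(stdGaussian (Vec q)) := by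
    refine integral_mono (integrable_relu_mul_relu h1 h2) ((integrable_truncWeight h1 h2).add hi)
      fun u => ?_
    change max ⟪i.1, u⟫ 0 * max ⟪i.2, u⟫ 0 ≤ truncWeight i u + (⟪i.1, u⟫ * ⟪i.2, u⟫) ^ 2 / (9 * q)
    have h4 := relu_mul_relu_le_abs i.1 i.2 u
    have h5 : 0 ≤ max ⟪i.1, u⟫ 0 * max ⟪i.2, u⟫ 0 := by positivity
    rw [← sq_abs (⟪i.1, u⟫ * ⟪i.2, u⟫), truncWeight]
    rcases le_total (max ⟪i.1, u⟫ 0 * max ⟪i.2, u⟫ 0) (9 * q) with h | h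
    · rw [min_eq_left h]
      exact le_add_of_nonneg_right (by positivity)
    · rw [min_eq_right h]
      have h6 : max ⟪i.1, u⟫ 0 * max ⟪i.2, u⟫ 0 ≤ |⟪i.1, u⟫ * ⟪i.2, u⟫| ^ 2 / (9 * q) := by
        rw [le_div_iff₀ hM]
        nlinarith
      linarith
  rw [integral_add (integrable_truncWeight h1 h2) hi, integral_div] at h3
  have h7 := div_le_div_of_nonneg_right (integral_sq_inner_mul_inner_le h1 h2) hM.le
  linarith

lemma truncWeight_eq {y y' u : Vec q} (hy : ‖y‖ = 1) (hy' : ‖y'‖ = 1) (hu : ‖u‖ ≤ 3 * √q) :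
    truncWeight (y, y') u = max ⟪y, u⟫ 0 * max ⟪y', u⟫ 0 := by
  refine min_eq_left ((relu_mul_relu_le_abs _ _ _).trans ?_)
  have h1 := abs_inner_le_of_norm_le (a := u) hy.le
  have h2 := abs_inner_le_of_norm_le (a := u) hy'.le
  rw [abs_mul]
  refine (mul_le_mul h1 h2 (abs_nonneg _) (by positivity)).trans ?_
  have h3 := pow_le_pow_left₀ (norm_nonneg _) hu 2
  rw [mul_pow, Real.sq_sqrt (by positivity)] at h3
  linarith

lemma abs_relu_mul_relu_sub_le {y y' y₀ y₀' u : Vec q} (hy' : ‖y'‖ = 1) (hy₀ : ‖y₀‖ = 1)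
    {τ : ℝ} (h1 : ‖y - y₀‖ ≤ τ) (h2 : ‖y' - y₀'‖ ≤ τ) :
    |max ⟪y, u⟫ 0 * max ⟪y', u⟫ 0 - max ⟪y₀, u⟫ 0 * max ⟪y₀', u⟫ 0| ≤ 2 * τ * ‖u‖ ^ 2 := by
  have hτ : 0 ≤ τ := (norm_nonneg _).trans h1
  have i1 := abs_inner_le_of_norm_le (a := u) h1
  have i2 := abs_inner_le_of_norm_le (a := u) h2
  have i3 := abs_inner_le_of_norm_le (a := u) hy'.le
  have i4 := abs_inner_le_of_norm_le (a := u) hy₀.le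
  rw [inner_sub_left] at i1 i2
  have e : max ⟪y, u⟫ 0 * max ⟪y', u⟫ 0 - max ⟪y₀, u⟫ 0 * max ⟪y₀', u⟫ 0
      = (max ⟪y, u⟫ 0 - max ⟪y₀, u⟫ 0) * max ⟪y', u⟫ 0
        + max ⟪y₀, u⟫ 0 * (max ⟪y', u⟫ 0 - max ⟪y₀', u⟫ 0) := by ring
  rw [e]
  refine (abs_add_le _ _).trans ?_
  rw [abs_mul, abs_mul]
  have b1 := mul_le_mul ((abs_max_sub_max_le _ _).trans i1) ((abs_max_zero_le _).trans i3)
    (abs_nonneg _) (by positivity)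
  have b2 := mul_le_mul ((abs_max_zero_le _).trans i4) ((abs_max_sub_max_le _ _).trans i2)
    (abs_nonneg _) (by positivity)
  nlinarith

/-- The passage from weights indexed by a net to weights indexed by the sphere. -/
lemma jointWDC_of_net (hN : 0 < N) (hk : 0 < k) (hq : 0 < q) {A : Matrix (Fin N) (Fin k) ℝ}
    {B : Matrix (Fin N) (Fin q) ℝ} {t δ : ℝ} (ht0 : 0 < t) (ht1 : t ≤ 1) (hδ : 20 * t ≤ δ)
    (hqt : 50 ≤ q * t) (hA : ∀ j, ‖scaledRow A j‖ ≤ 3 * √k) (hB : ∀ j, ‖scaledRow B j‖ ≤ 3 * √q)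
    {S : Finset (Vec q)} (hS : ∀ x ∈ S, ‖x‖ = 1)
    (hnet : ∀ x : Vec q, ‖x‖ = 1 → ∃ x₀ ∈ S, ‖x - x₀‖ ≤ t / (1000 * k * q))
    (h : ∀ i ∈ S ×ˢ S, ∀ x v y : Vec k, ‖x‖ = 1 → ‖v‖ = 1 → ‖y‖ = 1 →
      |∑ j, rowTerm x v y (scaledRow A j) * truncWeight i (scaledRow B j)
        - N * (⟪v, arcVec x y⟫ / 2 * ∫ u, truncWeight i u ∂(stdGaussian (Vec q)))|
        ≤ 3 * (N * t)) : JointWDC δ A B := by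
  refine jointWDC_of_unit fun x v x' hx hv hx' y y' hy hy' => ?_
  have hN0 : (0 : ℝ) < N := by positivity
  have hk1 : (1 : ℝ) ≤ k := by exact_mod_cast hk
  have hq1 : (1 : ℝ) ≤ q := by exact_mod_cast hq
  obtain ⟨y₀, hy₀S, hy₀⟩ := hnet y hy
  obtain ⟨y₀', hy₀S', hy₀'⟩ := hnet y' hy'
  set τ := t / (1000 * k * q) with hτ
  have hτ0 : 0 < τ := by positivity
  have hτkq : τ * (k * q) = t / 1000 := by
    rw [hτ]
    field_simp
  have hτt : τ ≤ t / 1000 := by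
    rw [← hτkq]
    exact le_mul_of_one_le_right hτ0.le (one_le_mul_of_one_le_of_one_le hk1 hq1)
  have g1 := h (y₀, y₀') (Finset.mem_product.2 ⟨hy₀S, hy₀S'⟩) x v x' hx hv hx'
  have t1 := integral_truncWeight_le_integral_relu (i := (y₀, y₀')) (hS _ hy₀S) (hS _ hy₀S')
  have t2 := integral_relu_le_integral_truncWeight_add (i := (y₀, y₀')) hq (hS _ hy₀S) (hS _ hy₀S')
  have t3 := two_mul_integral_relu_eq_inner (y' := y₀') (hS _ hy₀S)
  have t4 := abs_le.1 (abs_inner_arcVec_sub_le hy hy' (hS _ hy₀S) (hS _ hy₀S) (hS _ hy₀S') hy₀ hy₀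
    hy₀')
  dsimp only at t1 t2
  set I := ∫ u, truncWeight (y₀, y₀') u ∂(stdGaussian (Vec q))
  have hq200 : 200 / (9 * (q : ℝ)) ≤ t / 2 := by
    rw [div_le_iff₀ (by positivity)]
    linarith
  have hI : |2 * I - ⟪y, arcVec y y'⟫| ≤ 2 * t := by
    rw [abs_le]
    constructor <;> linarith [t4.1, t4.2]
  have hpert : |∑ j, rowTerm x v x' (scaledRow A j)
        * (max ⟪y, scaledRow B j⟫ 0 * max ⟪y', scaledRow B j⟫ 0)
      - ∑ j, rowTerm x v x' (scaledRow A j) * truncWeight (y₀, y₀') (scaledRow B j)|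
      ≤ N * (t / 4) := by
    rw [← Finset.sum_sub_distrib]
    refine (Finset.abs_sum_le_sum_abs _ _).trans ?_
    have h1 : ∀ j ∈ Finset.univ, |rowTerm x v x' (scaledRow A j)
          * (max ⟪y, scaledRow B j⟫ 0 * max ⟪y', scaledRow B j⟫ 0)
        - rowTerm x v x' (scaledRow A j) * truncWeight (y₀, y₀') (scaledRow B j)| ≤ t / 4 := by
      intro j _
      rw [← mul_sub, abs_mul, truncWeight_eq (hS _ hy₀S) (hS _ hy₀S') (hB j)]
      have a1 := abs_relu_mul_relu_sub_le (u := scaledRow B j) hy' (hS _ hy₀S) hy₀ hy₀'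
      have a2 : ‖scaledRow B j‖ ^ 2 ≤ 9 * q := by
        have := pow_le_pow_left₀ (norm_nonneg _) (hB j) 2
        rw [mul_pow, Real.sq_sqrt (by positivity)] at this
        linarith
      have a3 : ‖scaledRow A j‖ ^ 2 ≤ 9 * k := by
        have := pow_le_pow_left₀ (norm_nonneg _) (hA j) 2
        rw [mul_pow, Real.sq_sqrt (by positivity)] at this
        linarith
      have a4 : |rowTerm x v x' (scaledRow A j)| ≤ 9 * k := by
        refine (abs_rowTerm_le _ _ _ _).trans ?_
        have i1 := abs_inner_le_of_norm_le (a := scaledRow A j) hv.le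
        have i2 := abs_inner_le_of_norm_le (a := scaledRow A j) hx'.le
        have i3 := mul_le_mul i1 i2 (abs_nonneg _) (by positivity)
        linarith
      have a5 : 2 * τ * ‖scaledRow B j‖ ^ 2 ≤ 2 * τ * (9 * q) :=
        mul_le_mul_of_nonneg_left a2 (by positivity)
      refine (mul_le_mul a4 (a1.trans a5) (abs_nonneg _) (by positivity)).trans ?_
      linarith
    refine (Finset.sum_le_sum h1).trans (le_of_eq ?_)
    rw [Finset.sum_const, Finset.card_univ, Fintype.card_fin, nsmul_eq_mul]
  have e : 4 * N * ∑ j, selLayer A x v j * layer A x' j * (layer B y j * layer B y' j)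
      = 4 / N * ∑ j, rowTerm x v x' (scaledRow A j)
        * (max ⟪y, scaledRow B j⟫ 0 * max ⟪y', scaledRow B j⟫ 0) := by
    rw [Finset.mul_sum, Finset.mul_sum]
    refine Finset.sum_congr rfl fun j _ => ?_
    rw [selLayer_mul_layer hN, layer_mul_layer hN]
    field_simp
  have hv2 : |⟪v, arcVec x x'⟫| ≤ 2 :=
    (abs_real_inner_le_norm _ _).trans (by
      rw [hv, one_mul]
      exact norm_arcVec_le hx hx')
  have hmain : |⟪v, arcVec x x'⟫ * (2 * I - ⟪y, arcVec y y'⟫)| ≤ 4 * t := by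
    rw [abs_mul]
    exact (mul_le_mul hv2 hI (abs_nonneg _) zero_le_two).trans (by linarith)
  set Q₁ := ∑ j, rowTerm x v x' (scaledRow A j)
    * (max ⟪y, scaledRow B j⟫ 0 * max ⟪y', scaledRow B j⟫ 0)
  set Q₀ := ∑ j, rowTerm x v x' (scaledRow A j) * truncWeight (y₀, y₀') (scaledRow B j)
  have e2 : 4 / N * Q₁ - ⟪v, arcVec x x'⟫ * ⟪y, arcVec y y'⟫
      = 4 / N * (Q₁ - Q₀) + 4 / N * (Q₀ - N * (⟪v, arcVec x x'⟫ / 2 * I))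
        + ⟪v, arcVec x x'⟫ * (2 * I - ⟪y, arcVec y y'⟫) := by
    field_simp
    ring
  have hN4 : (0 : ℝ) < 4 / N := by positivity
  have f1 : |4 / N * (Q₁ - Q₀)| ≤ t := by
    rw [abs_mul, abs_of_pos hN4]
    refine (mul_le_mul_of_nonneg_left hpert hN4.le).trans (le_of_eq ?_)
    field_simp
  have f2 : |4 / N * (Q₀ - N * (⟪v, arcVec x x'⟫ / 2 * I))| ≤ 12 * t := by
    rw [abs_mul, abs_of_pos hN4]
    refine (mul_le_mul_of_nonneg_left g1 hN4.le).trans (le_of_eq ?_)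
    field_simp
    ring
  rw [e, e2]
  refine (abs_add_le _ _).trans ((add_le_add (abs_add_le _ _) le_rfl).trans ?_)
  linarith

/-- Two independent Gaussian matrices are not changed by the truncation of their rows and satisfy
the joint weight distribution condition, except on an event whose probability is bounded by the
union bound over a net. -/
theorem measureReal_not_jointWDC_le (hN : 0 < N) (hk : 0 < k) (hq : 0 < q)
    {V : Ω → Matrix (Fin N) (Fin k) ℝ} {V' : Ω → Matrix (Fin N) (Fin q) ℝ}
    (hV : IsIIDGaussian P N V) (hV' : IsIIDGaussian P N V')
    (hind : IndepFun (fun ω (ij : Fin N × Fin k) => V ω ij.1 ij.2)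
      (fun ω (ij : Fin N × Fin q) => V' ω ij.1 ij.2) P)
    {t δ : ℝ} (ht0 : 0 < t) (ht1 : t ≤ 1) (hδ : 20 * t ≤ δ) (hqt : 50 ≤ q * t) :
    P.real {ω | ¬ ((truncRows (V ω) = V ω ∧ truncRows (V' ω) = V' ω) ∧ JointWDC δ (V ω) (V' ω))}
      ≤ N * Real.exp (-k) + N * Real.exp (-q) +
        ((5 * q / (t / (1000 * k * q))) ^ q) ^ 2 * ((5 * k / netRadius k (9 * q) t) ^ k) ^ 3 *
          (4 * Real.exp (-(N * (t ^ 2 / (160000 * (9 * q)))))) := by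
  have hk1 : (1 : ℝ) ≤ k := by exact_mod_cast hk
  have hq1 : (1 : ℝ) ≤ q := by exact_mod_cast hq
  have hτ0 : 0 < t / (1000 * k * q) := by positivity
  have hτ1 : t / (1000 * k * q) ≤ 1 := by
    rw [div_le_one (by positivity)]
    nlinarith
  obtain ⟨S, hS, hcard, hnet⟩ := exists_sphere_net q hτ0 hτ1
  have hSS : ∀ i ∈ S ×ˢ S, ‖i.1‖ = 1 ∧ ‖i.2‖ = 1 := fun i hi =>
    ⟨hS _ (Finset.mem_product.1 hi).1, hS _ (Finset.mem_product.1 hi).2⟩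
  have h := measureReal_uniform_le (isIIDSample_scaledRow_pair hN hV hV' hind) (S ×ˢ S)
    (b := truncWeight) (B := 9 * q) (fun i _ => measurable_truncWeight i) (by linarith)
    (fun i _ => truncWeight_nonneg i) (fun i _ u => min_le_right _ _)
    (fun i hi => integral_truncWeight_sq_le (hSS i hi).1 (hSS i hi).2)
    (fun i hi => integral_truncWeight_le_one (hSS i hi).1 (hSS i hi).2) ht0 ht1
  have hsub : {ω | ¬ ((truncRows (V ω) = V ω ∧ truncRows (V' ω) = V' ω) ∧
        JointWDC δ (V ω) (V' ω))}
      ⊆ {ω | ¬ ((∀ j, ‖scaledRow (V ω) j‖ ≤ 3 * √k) ∧ ∀ i ∈ S ×ˢ S, ∀ x v y : Vec k, ‖x‖ = 1 →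
        ‖v‖ = 1 → ‖y‖ = 1 → |∑ j, rowTerm x v y (scaledRow (V ω) j)
          * truncWeight i (scaledRow (V' ω) j)
          - N * (⟪v, arcVec x y⟫ / 2 * ∫ u, truncWeight i u ∂(stdGaussian (Vec q)))|
            ≤ 3 * (N * t))}
        ∪ ⋃ j ∈ Finset.univ, {ω | 3 * √q < ‖scaledRow (V' ω) j‖} := by
    intro ω hω
    by_contra hnot
    simp only [Set.mem_union, Set.mem_iUnion, not_or, not_exists, Finset.mem_univ,
      Set.mem_ofPred_eq, not_not, not_lt] at hnot
    obtain ⟨⟨n0, n1⟩, n2⟩ := hnot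
    have hB : ∀ j, ‖scaledRow (V' ω) j‖ ≤ 3 * √q := fun j => n2 j trivial
    exact hω ⟨⟨truncRows_eq_self hN n0, truncRows_eq_self hN hB⟩,
      jointWDC_of_net hN hk hq ht0 ht1 hδ hqt n0 hB hS hnet n1⟩
  refine (measureReal_mono hsub).trans ((measureReal_union_le _ _).trans ?_)
  have h2 : P.real (⋃ j ∈ Finset.univ, {ω | 3 * √q < ‖scaledRow (V' ω) j‖})
      ≤ N * Real.exp (-q) := by
    refine (measureReal_biUnion_finset_le _ _).trans ?_
    have h1 : ∀ j ∈ Finset.univ, P.real {ω | 3 * √q < ‖scaledRow (V' ω) j‖}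
        ≤ Real.exp (-q) := by
      intro j _
      have hlaw := (measurePreserving_eval (fun _ : Fin N => stdGaussian (Vec q)) j).comp_hasLaw
        (hasLaw_scaledRow hN hV')
      exact (hlaw.measureReal_eq (p := fun a => 3 * √q < ‖a‖)
        (measurableSet_lt measurable_const (by fun_prop))).trans_le measureReal_norm_gt_le
    refine (Finset.sum_le_sum h1).trans (le_of_eq ?_)
    rw [Finset.sum_const, Finset.card_univ, Fintype.card_fin, nsmul_eq_mul]
  have h3 : ((S ×ˢ S).card : ℝ) ≤ ((5 * q / (t / (1000 * k * q))) ^ q) ^ 2 := by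
    rw [Finset.card_product, Nat.cast_mul, ← sq]
    gcongr
  have h4 := h.trans (add_le_add le_rfl (mul_le_mul_of_nonneg_right
    (mul_le_mul_of_nonneg_right h3 (by rw [netRadius]; positivity)) (by positivity)))
  linarith [add_le_add h4 h2]

end Probability

/-! ### The choice of the constants -/

section Constants

variable {N k q : ℕ} {t : ℝ}

lemma one_le_log_of_three_le {k : ℕ} (hk : 3 ≤ k) : 1 ≤ Real.log k := by
  have h3 : (3 : ℝ) ≤ k := by exact_mod_cast hk
  rw [Real.le_log_iff_exp_le (by linarith)]
  linarith [Real.exp_one_lt_d9]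

lemma three_le_of_const_le (ht0 : 0 < t) (ht1 : t ≤ 1) (hk : 10 ^ 9 / t ^ 2 ≤ (k : ℝ)) : 3 ≤ k := by
  have h1 : (10 : ℝ) ^ 9 ≤ 10 ^ 9 / t ^ 2 := by
    rw [le_div_iff₀ (by positivity)]
    nlinarith
  have h2 : (3 : ℝ) ≤ k := by linarith
  exact_mod_cast h2

lemma pow_eq_exp_mul_log (hk : 0 < k) (m : ℕ) : (k : ℝ) ^ m = Real.exp (m * Real.log k) := by
  rw [Real.exp_nat_mul, Real.exp_log (by positivity)]

lemma four_le_exp_two : (4 : ℝ) ≤ Real.exp 2 := by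
  have h : Real.exp 2 = Real.exp 1 * Real.exp 1 := by
    rw [← Real.exp_add]
    norm_num
  nlinarith [Real.exp_one_gt_d9]

lemma layer_net_bound_le (ht0 : 0 < t) (ht1 : t ≤ 1) (hk : 10 ^ 9 / t ^ 2 ≤ (k : ℝ))
    (hN : 10 ^ 9 / t ^ 2 * (k * Real.log k) ≤ N) :
    ((5 * k / netRadius k 1 t) ^ k) ^ 3 * (4 * Real.exp (-(N * (t ^ 2 / 160000))))
      ≤ Real.exp (-k) := by
  have hk3 := three_le_of_const_le ht0 ht1 hk
  have hk3' : (3 : ℝ) ≤ k := by exact_mod_cast hk3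
  have hlog := one_le_log_of_three_le hk3
  have hk0 : (0 : ℝ) < k := by linarith
  rw [div_le_iff₀ (by positivity)] at hk
  have hbase : 5 * k / netRadius k 1 t ≤ (k : ℝ) ^ 3 := by
    have e : 5 * k / netRadius k 1 t = 5 * 10 ^ 7 * (k : ℝ) ^ 2 / t ^ 2 := by
      rw [netRadius]
      field_simp
    rw [e, div_le_iff₀ (by positivity)]
    nlinarith [sq_nonneg (k : ℝ)]
  have hpos : 0 ≤ 5 * k / netRadius k 1 t := by
    rw [netRadius]
    positivity
  have h1 : ((5 * k / netRadius k 1 t) ^ k) ^ 3 ≤ Real.exp (9 * (k * Real.log k)) := by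
    calc ((5 * k / netRadius k 1 t) ^ k) ^ 3 ≤ (((k : ℝ) ^ 3) ^ k) ^ 3 := by gcongr
      _ = (k : ℝ) ^ (9 * k) := by
        rw [← pow_mul, ← pow_mul]
        congr 1
        ring
      _ = Real.exp (9 * (k * Real.log k)) := by
        rw [pow_eq_exp_mul_log (by omega)]
        push_cast
        ring_nf
  calc _ ≤ Real.exp (9 * (k * Real.log k)) * (Real.exp 2 * Real.exp (-(N * (t ^ 2 / 160000)))) := by
        gcongr
        exact four_le_exp_two
    _ = Real.exp (9 * (k * Real.log k) + 2 - N * (t ^ 2 / 160000)) := by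
        rw [← Real.exp_add, ← Real.exp_add]
        congr 1
        ring
    _ ≤ Real.exp (-k) := by
        rw [Real.exp_le_exp]
        have h2 := mul_le_mul_of_nonneg_right hN (show 0 ≤ t ^ 2 / 160000 by positivity)
        have h3 : 10 ^ 9 / t ^ 2 * (k * Real.log k) * (t ^ 2 / 160000)
            = 6250 * (k * Real.log k) := by
          field_simp
          norm_num
        nlinarith

lemma mul_add_mul_log_add_log_le (hk : 3 ≤ k) (hq : 3 ≤ q) :
    (q : ℝ) * ((k + q) * (Real.log k + Real.log q))
      ≤ 3 * ((k * Real.log k) ^ 2 + (q * Real.log q) ^ 2) := by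
  have hlk := one_le_log_of_three_le hk
  have hlq := one_le_log_of_three_le hq
  have hk3 : (3 : ℝ) ≤ k := by exact_mod_cast hk
  have hq3 : (3 : ℝ) ≤ q := by exact_mod_cast hq
  set a := (k : ℝ) * Real.log k with ha
  set b := (q : ℝ) * Real.log q with hb
  have ka : (k : ℝ) ≤ a := le_mul_of_one_le_right (by linarith) hlk
  have qb : (q : ℝ) ≤ b := le_mul_of_one_le_right (by linarith) hlq
  have h1 : q * a ≤ b * a := mul_le_mul_of_nonneg_right qb (by linarith)
  have h2 : k * b ≤ a * b := mul_le_mul_of_nonneg_right ka (by linarith)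
  have h3 : q * b ≤ b * b := mul_le_mul_of_nonneg_right qb (by linarith)
  have h4 : (q : ℝ) * (q * Real.log k) ≤ a ^ 2 + b ^ 2 := by
    rcases le_total (k : ℝ) q with h | h
    · have h5 : q * (q * Real.log k) ≤ q * b := by
        have := Real.log_le_log (by linarith) h
        rw [hb]
        gcongr
      nlinarith [sq_nonneg a]
    · have h5 : q * (q * Real.log k) ≤ q * a := by
        rw [ha]
        gcongr
      nlinarith [sq_nonneg (a - b)]
  have e : (q : ℝ) * ((k + q) * (Real.log k + Real.log q))
      = q * a + k * b + q * (q * Real.log k) + q * b := by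
    rw [ha, hb]
    ring
  nlinarith [sq_nonneg (a - b), sq_nonneg a]

lemma joint_net_bound_le (ht0 : 0 < t) (ht1 : t ≤ 1) (hk : 10 ^ 9 / t ^ 2 ≤ (k : ℝ))
    (hq : 10 ^ 9 / t ^ 2 ≤ (q : ℝ))
    (hN : 10 ^ 9 / t ^ 2 * ((k * Real.log k) ^ 2 + (q * Real.log q) ^ 2) ≤ N) :
    ((5 * q / (t / (1000 * k * q))) ^ q) ^ 2 * ((5 * k / netRadius k (9 * q) t) ^ k) ^ 3 *
      (4 * Real.exp (-(N * (t ^ 2 / (160000 * (9 * q)))))) ≤ Real.exp (-k) := by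
  have hk3 := three_le_of_const_le ht0 ht1 hk
  have hq3 := three_le_of_const_le ht0 ht1 hq
  have hk3' : (3 : ℝ) ≤ k := by exact_mod_cast hk3
  have hq3' : (3 : ℝ) ≤ q := by exact_mod_cast hq3
  have hlk := one_le_log_of_three_le hk3
  have hlq := one_le_log_of_three_le hq3
  have hk0 : (0 : ℝ) < k := by linarith
  have hq0 : (0 : ℝ) < q := by linarith
  have hkey := mul_add_mul_log_add_log_le hk3 hq3
  rw [div_le_iff₀ (by positivity)] at hk hq
  have ht2 : t ^ 2 ≤ t := by nlinarith
  have hb1 : 5 * q / (t / (1000 * k * q)) ≤ ((k * q : ℕ) : ℝ) ^ 2 := by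
    have e : 5 * q / (t / (1000 * k * q)) = 5000 * (k * q ^ 2 : ℝ) / t := by
      field_simp
      norm_num
    rw [e, div_le_iff₀ ht0]
    push_cast
    have h1 : (5000 : ℝ) ≤ k * t := by nlinarith
    have h2 : (0 : ℝ) ≤ k * q ^ 2 := by positivity
    nlinarith
  have hb2 : 5 * k / netRadius k (9 * q) t ≤ ((k * q : ℕ) : ℝ) ^ 2 := by
    have e : 5 * k / netRadius k (9 * q) t = 45 * 10 ^ 7 * ((k : ℝ) ^ 2 * q) / t ^ 2 := by
      rw [netRadius]
      field_simp
      norm_num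
    rw [e, div_le_iff₀ (by positivity)]
    push_cast
    have h2 : (0 : ℝ) ≤ k ^ 2 * q := by positivity
    nlinarith
  have hp2 : 0 ≤ 5 * k / netRadius k (9 * q) t := by
    rw [netRadius]
    positivity
  have h1 : ((5 * q / (t / (1000 * k * q))) ^ q) ^ 2 * ((5 * k / netRadius k (9 * q) t) ^ k) ^ 3
      ≤ Real.exp ((4 * q + 6 * k) * (Real.log k + Real.log q)) := by
    calc _ ≤ ((((k * q : ℕ) : ℝ) ^ 2) ^ q) ^ 2 * ((((k * q : ℕ) : ℝ) ^ 2) ^ k) ^ 3 := by gcongr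
      _ = ((k * q : ℕ) : ℝ) ^ (4 * q + 6 * k) := by
        rw [← pow_mul, ← pow_mul, ← pow_mul, ← pow_mul, ← pow_add]
        congr 1
        ring
      _ = Real.exp ((4 * q + 6 * k) * (Real.log k + Real.log q)) := by
        rw [pow_eq_exp_mul_log (Nat.mul_pos (by omega) (by omega)), Nat.cast_mul,
          Real.log_mul hk0.ne' hq0.ne']
        push_cast
        rfl
  calc _ ≤ Real.exp ((4 * q + 6 * k) * (Real.log k + Real.log q))
          * (Real.exp 2 * Real.exp (-(N * (t ^ 2 / (160000 * (9 * q)))))) := by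
        gcongr
        exact four_le_exp_two
    _ = Real.exp ((4 * q + 6 * k) * (Real.log k + Real.log q) + 2
          - N * (t ^ 2 / (160000 * (9 * q)))) := by
        rw [← Real.exp_add, ← Real.exp_add]
        congr 1
        ring
    _ ≤ Real.exp (-k) := by
        rw [Real.exp_le_exp]
        set L := ((k : ℝ) + q) * (Real.log k + Real.log q) with hL
        have h2 := mul_le_mul_of_nonneg_right hN
          (show 0 ≤ t ^ 2 / (160000 * (9 * (q : ℝ))) by positivity)
        have h3 : 10 ^ 9 / t ^ 2 * ((k * Real.log k) ^ 2 + (q * Real.log q) ^ 2)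
            * (t ^ 2 / (160000 * (9 * (q : ℝ))))
            = 10 ^ 9 / 1440000 * (((k * Real.log k) ^ 2 + (q * Real.log q) ^ 2) / q) := by
          field_simp
          norm_num
        have h4 : L / 3 ≤ ((k * Real.log k) ^ 2 + (q * Real.log q) ^ 2) / q := by
          rw [le_div_iff₀ hq0]
          linarith
        have h5 : (4 * q + 6 * k) * (Real.log k + Real.log q) ≤ 6 * L := by
          rw [hL]
          nlinarith
        have h6 : (k : ℝ) + q ≤ L := le_mul_of_one_le_right (by positivity) (by linarith)
        linarith

end Constants

/-! ### The event on which the landscape theorem applies -/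

section Event

variable {Ω : Type*} [MeasurableSpace Ω] {P : Measure Ω} [IsProbabilityMeasure P]

lemma measureReal_not_forall_wdc_le {n : ℕ → ℕ} {D : ℕ}
    {W : Ω → (i : ℕ) → Matrix (Fin (n (i + 1))) (Fin (n i)) ℝ}
    (hW : ∀ i < D, IsIIDGaussian P (n (i + 1)) fun ω => W ω i) {t δ : ℝ} (ht0 : 0 < t)
    (ht1 : t ≤ 1) (hδ : 6 * t ≤ δ) (hn : ∀ i < D, n i < n (i + 1))
    (hlarge : ∀ i < D, 10 ^ 9 / t ^ 2 ≤ (n i : ℝ))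
    (hexp : ∀ i < D, 10 ^ 9 / t ^ 2 * (n i * Real.log (n i)) ≤ (n (i + 1) : ℝ)) :
    P.real {ω | ¬ ∀ i < D, WDC δ (W ω i)}
      ≤ ∑ i ∈ Finset.range D, 2 * n (i + 1) * Real.exp (-n i) := by
  have hsub : {ω | ¬ ∀ i < D, WDC δ (W ω i)}
      ⊆ ⋃ i ∈ Finset.range D, {ω | ¬ WDC δ (W ω i)} := by
    intro ω hω
    simp only [Set.mem_ofPred_eq, not_forall] at hω
    obtain ⟨i, hi, h⟩ := hω
    exact Set.mem_biUnion (Finset.mem_coe.2 (Finset.mem_range.2 hi)) h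
  refine (measureReal_mono hsub (measure_ne_top _ _)).trans
    ((measureReal_biUnion_finset_le _ _).trans (Finset.sum_le_sum fun i hi => ?_))
  have hi' := Finset.mem_range.1 hi
  have h1 := measureReal_not_wdc_le (Nat.zero_lt_of_lt (hn i hi')) (hW i hi') ht0 ht1 hδ
  have h2 := layer_net_bound_le ht0 ht1 (hlarge i hi') (hexp i hi')
  have h3 : (1 : ℝ) ≤ n (i + 1) := by exact_mod_cast Nat.zero_lt_of_lt (hn i hi')
  have h4 := le_mul_of_one_le_left (Real.exp_pos (-(n i : ℝ))).le h3
  linarith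

/-- If some layer of the network is narrower than `γ⁻¹`, the failure probability exceeds `1`. -/
lemma one_le_failProb_of_small {n : ℕ → ℕ} {d ℓ : ℕ} {γ : ℝ} (hn : Expansive n d ℓ) {i : ℕ}
    (hi : i ≤ d - 1) (hγ : γ * n i ≤ 1) : 1 ≤ failProb 4 γ n d ℓ := by
  have hterm : ∀ m : ℕ, 1 ≤ m → 1 ≤ 4 * (m : ℝ) * Real.exp (-γ * n i) := by
    intro m hm
    have h1 : Real.exp (-1) ≤ Real.exp (-γ * n i) := Real.exp_le_exp.2 (by linarith)
    have h2 : (1 / 4 : ℝ) ≤ Real.exp (-1) := by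
      rw [Real.exp_neg, one_div]
      exact inv_anti₀ (Real.exp_pos _) (by linarith [Real.exp_one_lt_d9])
    have h3 : (1 : ℝ) ≤ m := by exact_mod_cast hm
    nlinarith
  unfold failProb
  have hnn : ∀ j ∈ Finset.range (d - 1), 0 ≤ 4 * (n (j + 1) : ℝ) * Real.exp (-γ * n j) :=
    fun j _ => by positivity
  rcases hi.lt_or_eq with h | h
  · have h1 := Finset.single_le_sum hnn (Finset.mem_range.2 h)
    have h2 := hterm (n (i + 1)) (Nat.succ_le_of_lt (Nat.zero_lt_of_lt (hn.1 i h)))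
    have h3 : 0 ≤ 4 * (ℓ : ℝ) * Real.exp (-γ * n (d - 1)) := by positivity
    linarith
  · have h2 := hterm ℓ (Nat.succ_le_of_lt (Nat.zero_lt_of_lt hn.2))
    have h3 := Finset.sum_nonneg hnn
    rw [h] at h2
    linarith

lemma failProb_nonneg {n : ℕ → ℕ} {d ℓ : ℕ} {γ : ℝ} : 0 ≤ failProb 4 γ n d ℓ := by
  unfold failProb
  positivity

lemma sum_add_le_failProb {n : ℕ → ℕ} {d ℓ : ℕ} {γ : ℝ} (hγ1 : γ ≤ 1) :
    ∑ i ∈ Finset.range (d - 1), 2 * n (i + 1) * Real.exp (-n i) + 3 * ℓ * Real.exp (-n (d - 1))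
      ≤ failProb 4 γ n d ℓ := by
  have h : ∀ m : ℕ, Real.exp (-m) ≤ Real.exp (-γ * m) := by
    intro m
    rw [Real.exp_le_exp]
    have : γ * m ≤ 1 * m := mul_le_mul_of_nonneg_right hγ1 (by positivity)
    linarith
  unfold failProb
  refine add_le_add (Finset.sum_le_sum fun i _ => ?_) ?_
  · exact mul_le_mul (by nlinarith [(n (i + 1)).cast_nonneg (α := ℝ)]) (h _) (Real.exp_pos _).le
      (by positivity)
  · exact mul_le_mul (by nlinarith [ℓ.cast_nonneg (α := ℝ)]) (h _) (Real.exp_pos _).le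
      (by positivity)

/-- With high probability, the truncation of the rows is inactive and all weights satisfy the
distribution conditions. -/
theorem exists_event {n p : ℕ → ℕ} {d s ℓ : ℕ} {t δ : ℝ} (ht0 : 0 < t) (ht1 : t ≤ 1)
    (hδ : 20 * t ≤ δ) (hn : Expansive n d ℓ) (hp : Expansive p s ℓ)
    (hne : InnerExpansive (10 ^ 9 / t ^ 2) n d) (hpe : InnerExpansive (10 ^ 9 / t ^ 2) p s)
    (hl : LastExpansive (10 ^ 9 / t ^ 2) n p d s ℓ)
    {W₁ : Ω → (i : ℕ) → Matrix (Fin (n (i + 1))) (Fin (n i)) ℝ}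
    {V₁ : Ω → Matrix (Fin ℓ) (Fin (n (d - 1))) ℝ}
    {W₂ : Ω → (i : ℕ) → Matrix (Fin (p (i + 1))) (Fin (p i)) ℝ}
    {V₂ : Ω → Matrix (Fin ℓ) (Fin (p (s - 1))) ℝ}
    (h₁ : IsGaussianModel P n d ℓ W₁ V₁) (h₂ : IsGaussianModel P p s ℓ W₂ V₂)
    (hind : IndepFun (fun ω (ij : Fin ℓ × Fin (n (d - 1))) => V₁ ω ij.1 ij.2)
      (fun ω (ij : Fin ℓ × Fin (p (s - 1))) => V₂ ω ij.1 ij.2) P) :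
    ∃ E : Set Ω, MeasurableSet E ∧
      1 - failProb 4 (10 ^ 9 / t ^ 2)⁻¹ n d ℓ - failProb 4 (10 ^ 9 / t ^ 2)⁻¹ p s ℓ ≤ P.real E ∧
      ∀ ω ∈ E, (∀ i < d - 1, WDC δ (W₁ ω i)) ∧ (∀ i < s - 1, WDC δ (W₂ ω i)) ∧
        (truncRows (V₁ ω) = V₁ ω ∧ truncRows (V₂ ω) = V₂ ω) ∧
        JointWDC δ (V₁ ω) (V₂ ω) ∧ JointWDC δ (V₂ ω) (V₁ ω) := by
  have hc0 : (0 : ℝ) < 10 ^ 9 / t ^ 2 := by positivity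
  have hc1 : (10 : ℝ) ^ 9 ≤ 10 ^ 9 / t ^ 2 := by
    rw [le_div_iff₀ (by positivity)]
    nlinarith
  -- a network with a narrow layer makes the claimed bound on the probability trivial
  by_cases hnl : ∃ i ≤ d - 1, (n i : ℝ) ≤ 10 ^ 9 / t ^ 2
  · obtain ⟨i, hi, hni⟩ := hnl
    have h := one_le_failProb_of_small hn hi ((inv_mul_le_one₀ hc0).2 hni)
    have h' := failProb_nonneg (n := p) (d := s) (ℓ := ℓ) (γ := (10 ^ 9 / t ^ 2)⁻¹)
    exact ⟨∅, MeasurableSet.empty, by rw [measureReal_empty]; linarith, by simp⟩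
  by_cases hpl : ∃ i ≤ s - 1, (p i : ℝ) ≤ 10 ^ 9 / t ^ 2
  · obtain ⟨i, hi, hpi⟩ := hpl
    have h := one_le_failProb_of_small hp hi ((inv_mul_le_one₀ hc0).2 hpi)
    have h' := failProb_nonneg (n := n) (d := d) (ℓ := ℓ) (γ := (10 ^ 9 / t ^ 2)⁻¹)
    exact ⟨∅, MeasurableSet.empty, by rw [measureReal_empty]; linarith, by simp⟩
  push Not at hnl hpl
  set c := 10 ^ 9 / t ^ 2 with hc
  have hk := (hnl (d - 1) le_rfl).le
  have hq := (hpl (s - 1) le_rfl).le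
  have hk3 := three_le_of_const_le ht0 ht1 hk
  have hq3 := three_le_of_const_le ht0 ht1 hq
  have hℓ : 0 < ℓ := Nat.zero_lt_of_lt hn.2
  have hwide : ∀ m : ℕ, c ≤ m → 50 ≤ m * t := by
    intro m hm
    rw [hc, div_le_iff₀ (by positivity)] at hm
    have : t ^ 2 ≤ t := by nlinarith
    have : (m : ℝ) * t ^ 2 ≤ m * t := by gcongr
    linarith
  let bad₁ := {ω | ¬ ∀ i < d - 1, WDC δ (W₁ ω i)}
  let bad₂ := {ω | ¬ ∀ i < s - 1, WDC δ (W₂ ω i)}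
  let bad₃ := {ω | ¬ ((truncRows (V₁ ω) = V₁ ω ∧ truncRows (V₂ ω) = V₂ ω) ∧
    JointWDC δ (V₁ ω) (V₂ ω))}
  let bad₄ := {ω | ¬ ((truncRows (V₂ ω) = V₂ ω ∧ truncRows (V₁ ω) = V₁ ω) ∧
    JointWDC δ (V₂ ω) (V₁ ω))}
  have b1 : P.real bad₁ ≤ _ := measureReal_not_forall_wdc_le h₁.1 ht0 ht1 (by linarith) hn.1
    (fun i hi => (hnl i hi.le).le) hne
  have b2 : P.real bad₂ ≤ _ := measureReal_not_forall_wdc_le h₂.1 ht0 ht1 (by linarith) hp.1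
    (fun i hi => (hpl i hi.le).le) hpe
  have b3 : P.real bad₃ ≤ _ := measureReal_not_jointWDC_le hℓ (by omega) (by omega) h₁.2 h₂.2 hind
    ht0 ht1 hδ (hwide _ hq)
  have b4 : P.real bad₄ ≤ _ := measureReal_not_jointWDC_le hℓ (by omega) (by omega) h₂.2 h₁.2
    hind.symm ht0 ht1 hδ (hwide _ hk)
  have c3 := joint_net_bound_le ht0 ht1 hk hq hl
  have c4 := joint_net_bound_le ht0 ht1 hq hk (N := ℓ) (by
    rw [add_comm]
    exact hl)
  have hℓ1 : (1 : ℝ) ≤ ℓ := by exact_mod_cast hℓ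
  have e1 := le_mul_of_one_le_left (Real.exp_pos (-(n (d - 1) : ℝ))).le hℓ1
  have e2 := le_mul_of_one_le_left (Real.exp_pos (-(p (s - 1) : ℝ))).le hℓ1
  have hγ : c⁻¹ ≤ 1 := inv_le_one_of_one_le₀ (by linarith)
  have f1 := sum_add_le_failProb (n := n) (d := d) (ℓ := ℓ) hγ
  have f2 := sum_add_le_failProb (n := p) (d := s) (ℓ := ℓ) hγ
  have hbad : P.real (bad₁ ∪ bad₂ ∪ bad₃ ∪ bad₄)
      ≤ failProb 4 c⁻¹ n d ℓ + failProb 4 c⁻¹ p s ℓ := by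
    have u1 := measureReal_union_le (μ := P) (bad₁ ∪ bad₂ ∪ bad₃) bad₄
    have u2 := measureReal_union_le (μ := P) (bad₁ ∪ bad₂) bad₃
    have u3 := measureReal_union_le (μ := P) bad₁ bad₂
    linarith
  refine ⟨(toMeasurable P (bad₁ ∪ bad₂ ∪ bad₃ ∪ bad₄))ᶜ, (measurableSet_toMeasurable _ _).compl,
    ?_, fun ω hω => ?_⟩
  · rw [probReal_compl_eq_one_sub (measurableSet_toMeasurable _ _), measureReal_def,
      measure_toMeasurable, ← measureReal_def]
    linarith
  · have hω' : ω ∉ bad₁ ∪ bad₂ ∪ bad₃ ∪ bad₄ := fun h => hω (subset_toMeasurable _ _ h)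
    simp only [Set.mem_union, not_or] at hω'
    obtain ⟨⟨⟨n1, n2⟩, n3⟩, n4⟩ := hω'
    have m3 := not_not.1 n3
    have m4 := not_not.1 n4
    exact ⟨not_not.1 n1, not_not.1 n2, m3.1, m3.2, m4.2⟩

end Event

end BlindDemodulation

end

open BlindDemodulation in
theorem mainTheorem1 :
    (∀ a ≥ 2, 0 < rho a) ∧ Tendsto rho atTop (𝓝 1) ∧
    ∃ c' K₁ K₂ C : ℝ, ∃ k : ℕ, 0 < c' ∧ 0 < K₁ ∧ 0 < K₂ ∧ 0 < C ∧
    ∀ ε : ℝ, 0 < ε →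
    ∃ c γ : ℝ, 0 < c ∧ c ≤ C * ε⁻¹ ^ k ∧ 0 < γ ∧ γ⁻¹ ≤ C * ε⁻¹ ^ k ∧
    ∀ d s : ℕ, 2 ≤ d → 2 ≤ s →
    K₁ * ((d : ℝ) ^ 7 * s ^ 2 + (d : ℝ) ^ 2 * s ^ 7) * ε ^ (1 / 4 : ℝ) < 1 →
    ∀ (ℓ : ℕ) (n p : ℕ → ℕ),
    Expansive n d ℓ → Expansive p s ℓ →
    InnerExpansive c n d → InnerExpansive c p s → LastExpansive c n p d s ℓ →
    ∀ (Ω : Type*) [MeasurableSpace Ω] (P : Measure Ω) [IsProbabilityMeasure P]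
      (W₁ : Ω → (i : ℕ) → Matrix (Fin (n (i + 1))) (Fin (n i)) ℝ)
      (V₁ : Ω → Matrix (Fin ℓ) (Fin (n (d - 1))) ℝ)
      (W₂ : Ω → (i : ℕ) → Matrix (Fin (p (i + 1))) (Fin (p i)) ℝ)
      (V₂ : Ω → Matrix (Fin ℓ) (Fin (p (s - 1))) ℝ),
    IsGaussianModel P n d ℓ W₁ V₁ → IsGaussianModel P p s ℓ W₂ V₂ →
    IndepFun (fun ω (ij : Fin ℓ × Fin (n (d - 1))) => V₁ ω ij.1 ij.2)
      (fun ω (ij : Fin ℓ × Fin (p (s - 1))) => V₂ ω ij.1 ij.2) P →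
    ∃ E : Set Ω, MeasurableSet E ∧
      1 - failProb c' γ n d ℓ - failProb c' γ p s ℓ - c * Real.exp (-γ * ℓ) ≤ P.real E ∧
      ∀ ω ∈ E, ∀ (h₀ : Vec (n 0)) (m₀ : Vec (p 0)), (h₀, m₀) ≠ 0 →
        ∀ f : Vec (n 0) × Vec (p 0) → ℝ,
        f = risk (net n d ℓ (W₁ ω) (truncRows (V₁ ω))) (net p s ℓ (W₂ ω) (truncRows (V₂ ω)))
          h₀ m₀ →
        (∃ w, ∀ z, DifferentiableAlong f z w) ∧
        (∀ z ∉ fourNhds K₂ ε d s h₀ m₀ ∪ axes (n 0) (p 0),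
          ∀ w, DifferentiableAlong f z w → HasDescent f z w) ∧
        (∀ z ∈ axes (n 0) (p 0), ∀ v, ∃ D ≤ 0, HasOneSidedDeriv f z v D) ∧
        (h₀ ≠ 0 → m₀ ≠ 0 → ∀ z ∈ axes (n 0) (p 0), IsLocalMax f z) := by
  refine ⟨fun a ha => rho_pos ha, tendsto_rho, 4, 1, 1, 10 ^ 33, 10, by norm_num, one_pos, one_pos,
    by norm_num, fun ε hε => ?_⟩
  set t := ε ^ 5 / 10 ^ 12 with ht
  have ht0 : 0 < t := by positivity
  have hc : (10 : ℝ) ^ 9 / t ^ 2 = 10 ^ 33 * ε⁻¹ ^ 10 := by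
    rw [ht]
    field_simp
  refine ⟨10 ^ 9 / t ^ 2, (10 ^ 9 / t ^ 2)⁻¹, by positivity, hc.le, by positivity,
    by rw [inv_inv]; exact hc.le, ?_⟩
  intro d s hd hs hK ℓ n p hn hp hne hpe hl Ω _ P _ W₁ V₁ W₂ V₂ h₁ h₂ hind
  have hd2 : (2 : ℝ) ≤ d := by exact_mod_cast hd
  have hs2 : (2 : ℝ) ≤ s := by exact_mod_cast hs
  have hr0 : 0 < ε ^ (1 / 4 : ℝ) := Real.rpow_pos_of_pos hε _
  have hd7 : (d : ℝ) ≤ (d : ℝ) ^ 7 * s ^ 2 := by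
    have a1 : (d : ℝ) ≤ (d : ℝ) ^ 7 := le_self_pow₀ (by linarith) (by norm_num)
    have a2 : (1 : ℝ) ≤ (s : ℝ) ^ 2 := one_le_pow₀ (by linarith)
    exact a1.trans (le_mul_of_one_le_right (by positivity) a2)
  have hs7 : (s : ℝ) ≤ (d : ℝ) ^ 2 * s ^ 7 := by
    have a1 : (s : ℝ) ≤ (s : ℝ) ^ 7 := le_self_pow₀ (by linarith) (by norm_num)
    have a2 : (1 : ℝ) ≤ (d : ℝ) ^ 2 := one_le_pow₀ (by linarith)
    exact a1.trans (le_mul_of_one_le_left (by positivity) a2)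
  rw [one_mul] at hK
  have hdε : d * ε ^ (1 / 4 : ℝ) ≤ 1 :=
    (mul_le_mul_of_nonneg_right (by linarith) hr0.le).trans hK.le
  have hsε : s * ε ^ (1 / 4 : ℝ) ≤ 1 :=
    (mul_le_mul_of_nonneg_right (by linarith) hr0.le).trans hK.le
  have hε1 : ε ≤ 1 := by
    by_contra hcon
    have := Real.one_le_rpow (not_le.1 hcon).le (by norm_num : (0 : ℝ) ≤ 1 / 4)
    nlinarith
  have ht1 : t ≤ 1 := by
    rw [ht, div_le_one (by positivity)]
    exact (pow_le_one₀ hε.le hε1).trans (by norm_num)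
  have hδ : 20 * t ≤ ε ^ 5 / 10 ^ 10 := by
    rw [ht]
    have : 0 < ε ^ 5 := by positivity
    linarith
  obtain ⟨E, hE, hEP, hgood⟩ := exists_event (P := P) ht0 ht1 hδ hn hp hne hpe hl h₁ h₂ hind
  refine ⟨E, hE, ?_, fun ω hω h₀ m₀ _ f hf => ?_⟩
  · have : 0 ≤ 10 ^ 9 / t ^ 2 * Real.exp (-(10 ^ 9 / t ^ 2)⁻¹ * ℓ) := by positivity
    linarith
  · obtain ⟨g₁, g₂, ⟨g₃, g₄⟩, g₅, g₆⟩ := hgood ω hω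
    rw [g₃, g₄] at hf
    exact landscape hd hs (Nat.zero_lt_of_lt hn.2) hε hdε hsε rfl g₁ g₂ g₅ g₆ h₀ m₀ hf
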